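/- Let $d\ge 1$. For $0<\alpha_1\le\alpha_2\le 1$ let $\mathcal T_{\alpha_1,\alpha_2}=(\mathbb R/\alpha_1^{-1/2}\mathbb Z)^d\times(\mathbb R/\alpha_2^{-1/2}\mathbb Z)^d$, and let $S(1,\alpha_1,\alpha_2)$ be the set of $p\in C^\infty(\mathcal T_{\alpha_1,\alpha_2};\mathbb C)$ all of whose partial derivatives are bounded, $|\partial_x^\beta\partial_\xi^\gamma p|\le C_{\beta,\gamma}$ for all multi-indices $\beta,\gamma$; the symbol $p$ may depend on $N,\alpha_1,\alpha_2$, but the constants $C_{\beta,\gamma}$ may not. Functions on $\mathcal T_{\alpha_1,\alpha_2}$ are identified with periodic functions on $\mathbb R^{2d}$. For $N\in\mathbb N^*$ let $h=\frac1{2\pi N}$ and $\tilde h=h/\sqrt{\alpha_1\alpha_2}$. Let $\mathcal H$ be the space of $u\in\mathscr S'(\mathbb R^d)$ such that $u$ is $\alpha_1^{-1/2}\mathbb Z^d$-periodic and its semiclassical Fourier transform $\mathcal F_{\tilde h}u$, where $\mathcal F_{\tilde h}u(\xi)=\int e^{-\frac{i}{\tilde h}\langle x,\xi\rangle}u(x)\,dx$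 (extended to $\mathscr S'$ by duality), is $\alpha_2^{-1/2}\mathbb Z^d$-periodic. It has the basis $$Q_k=(\alpha_1^{1/2}N)^{-d/2}\sum_{n\in\mathbb Z^d}\delta_{\alpha_1^{-1/2}(n+k/N)},\qquad k\in\{0,\dots,N-1\}^d .$$ Let $\mathrm{Op}^w_{\tilde h}(p)$ be the Weyl quantization $$\mathrm{Op}^w_{\tilde h}(p)u(x)=\frac1{(2\pi\tilde h)^d}\iint e^{\frac{i}{\tilde h}\langle x-y,\xi\rangle}\,p\Bigl(\frac{x+y}2,\xi\Bigr)u(y)\,dy\,d\xi ,$$ extended to $\mathscr S'(\mathbb R^d)$ by duality, and let $p_{N,\alpha_1,\alpha_2}$ be the $N^d\times N^d$ matrix, in the basis $(Q_k)$, of its restriction to $\mathcal H$. Let $\|\cdot\|$ be the operator norm $\ell^2\to\ell^2$ of matrices. **Proposition.** Fix $\omega\in(0,1)$ and constants $(C_{\beta,\gamma})_{\beta,\gamma\in\mathbb N^d}$. Then, as $N\to+\infty$, $$\|p_{N,\alpha_1,\alpha_2}\|\le\sup_{\rho\in\mathcal T_{\alpha_1,\alpha_2}}|p(\rho)|+o(1),$$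 uniformly with respect to all $0<\alpha_1\le\alpha_2\le1$ with $N^{-\omega}\le(\alpha_1\alpha_2)^{1/2}$ and all $p\in S(1,\alpha_1,\alpha_2)$ with symbol constants $(C_{\beta,\gamma})$. In particular, there is a constant $K>0$, independent of $N$, $\alpha_1$, $\alpha_2$ and $p$, such that $\|p_{N,\alpha_1,\alpha_2}\|\le K$ for all $N\ge1$ and all such $\alpha_1,\alpha_2,p$. -/

import Mathlib

open MeasureTheory SchwartzMap
open scoped ContDiff

noncomputable section

/-- `ℝᵈ` with its Euclidean norm. -/
abbrev Rd (d : ℕ) : Type := EuclideanSpace ℝ (Fin d)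

/-- The point of `ℝᵈ` with integer coordinates `n`. -/
def intVec {d : ℕ} (n : Fin d → ℤ) : Rd d := WithLp.toLp 2 fun i => (n i : ℝ)

/-- The set of symbols on the torus `(ℝ / α₁^(-1/2) ℤ)^d × (ℝ / α₂^(-1/2) ℤ)^d` with fixed symbol
constants: smooth functions on `ℝᵈ × ℝᵈ`, periodic with respect to `α₁^(-1/2) ℤᵈ` in `x` and to
`α₂^(-1/2) ℤᵈ` in `ξ`, whose derivatives of order `n` are bounded by `C n`.
The class `S(1, α₁, α₂)` is the union of these sets over all sequences `C`; a family of symbols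
that depend on parameters lies in the class, with constants uniform in the parameters, when
one sequence `C` serves for the whole family. -/
structure IsTorusSymbol {d : ℕ} (C : ℕ → ℝ) (α₁ α₂ : ℝ) (p : Rd d × Rd d → ℂ) : Prop where
  smooth : ContDiff ℝ ∞ p
  periodic_fst : ∀ (n : Fin d → ℤ) (x ξ : Rd d), p (x + (√α₁)⁻¹ • intVec n, ξ) = p (x, ξ)
  periodic_snd : ∀ (n : Fin d → ℤ) (x ξ : Rd d), p (x, ξ + (√α₂)⁻¹ • intVec n) = p (x, ξ)
  bound : ∀ (n : ℕ) (ρ : Rd d × Rd d), ‖iteratedFDeriv ℝ n p ρ‖ ≤ C n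

/-- The semiclassical Weyl quantization
`(2πh)^(-d) ∫ (∫ exp(i⟨x - y, ξ⟩ / h) p((x + y) / 2, ξ) φ(y) dy) dξ`.
For symbols with bounded derivatives and Schwartz functions `φ`, the inner integral decays rapidly
in `ξ`, so that this iterated integral is the oscillatory integral. -/
def weylFun {d : ℕ} (h : ℝ) (p : Rd d × Rd d → ℂ) (φ : Rd d → ℂ) (x : Rd d) : ℂ :=
  (((2 * Real.pi * h) ^ d)⁻¹ : ℝ) *
    ∫ ξ : Rd d, ∫ y : Rd d,
      Complex.exp (Complex.I * ((inner ℝ (x - y) ξ / h : ℝ) : ℂ)) *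
        p ((2⁻¹ : ℝ) • (x + y), ξ) * φ y

/-- `v = Op_h^w(p) u` for tempered distributions `u` and `v`. The Weyl quantization is extended
to tempered distributions by duality: its transpose for the bilinear pairing of a distribution with
a Schwartz function is the Weyl quantization of `(x, ξ) ↦ p(x, -ξ)`, so that
`⟨Op_h^w(p) u, φ⟩ = ⟨u, ψ⟩` where `ψ` is the Schwartz function `Op_h^w(p(x, -ξ)) φ`. -/
def IsWeylImage {d : ℕ} (h : ℝ) (p : Rd d × Rd d → ℂ) (u v : 𝓢'(Rd d, ℂ)) : Prop :=
  ∀ φ : 𝓢(Rd d, ℂ), ∃ ψ : 𝓢(Rd d, ℂ),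
    (∀ x, ψ x = weylFun h (fun ρ => p (ρ.1, -ρ.2)) φ x) ∧ v φ = u ψ

theorem summable_one_add_norm_lattice {d : ℕ} {a : ℝ} (ha : 0 < a) (c : Rd d) :
    Summable fun n : Fin d → ℤ => (((1 + ‖a • (intVec n + c)‖) ^ (d + 1))⁻¹ : ℝ) := by
  classical
  let B := (EuclideanSpace.basisFun (Fin d) ℝ).toBasis
  let L : Submodule ℤ (Rd d) := Submodule.span ℤ (Set.range B)
  have hmem : ∀ n : Fin d → ℤ, intVec n ∈ L := by
    intro n
    have : intVec n = ∑ i, n i • B i := by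
      ext j
      simp [intVec, B, Pi.single_apply]
    rw [this]
    exact L.sum_mem fun i _ => L.smul_mem _ (Submodule.subset_span ⟨i, rfl⟩)
  let f : (Fin d → ℤ) → L := fun n => ⟨intVec n, hmem n⟩
  have hf : Function.Injective f := by
    intro n m hnm
    have h1 : intVec n = intVec m := congrArg Subtype.val hnm
    funext i
    have h2 := congrArg (fun v : Rd d => v i) h1
    simpa [intVec] using h2
  have hfin : Module.finrank ℤ L < d + 1 := by
    have : Module.finrank ℤ L = Module.finrank ℝ (Rd d) := ZLattice.rank ℝ L
    rw [this]
    simp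
  have hs := ((ZLattice.summable_norm_sub_inv_pow L (d + 1) hfin (-c)).comp_injective hf).mul_left
    ((a⁻¹) ^ (d + 1))
  refine Summable.of_norm_bounded_eventually hs ?_
  have hsub : Set.Subsingleton {n : Fin d → ℤ | intVec n + c = 0} := by
    intro n hn m hm
    apply hf
    apply Subtype.ext
    exact (eq_neg_of_add_eq_zero_left hn).trans (eq_neg_of_add_eq_zero_left hm).symm
  refine Filter.mem_of_superset (hsub.finite.compl_mem_cofinite) ?_
  intro n hn
  have hpos : 0 < ‖intVec n + c‖ := norm_pos_iff.mpr hn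
  have e : ‖(f n : Rd d) - -c‖ = ‖intVec n + c‖ := by simp [f]
  simp only [Set.mem_ofPred_eq, Function.comp, e]
  rw [Real.norm_of_nonneg (by positivity), ← mul_pow, ← mul_inv, ← inv_pow]
  have : a * ‖intVec n + c‖ ≤ 1 + ‖a • (intVec n + c)‖ := by
    rw [norm_smul, Real.norm_of_nonneg ha.le]; linarith
  gcongr

theorem exists_schwartz_lattice_bound {d : ℕ} {a : ℝ} (ha : 0 < a) (c : Rd d) :
    ∃ K : ℝ, 0 ≤ K ∧ ∀ φ : 𝓢(Rd d, ℂ),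
      Summable (fun n : Fin d → ℤ => φ (a • (intVec n + c))) ∧
      ‖∑' n : Fin d → ℤ, φ (a • (intVec n + c))‖ ≤
        K * ((Finset.Iic ((d + 1, 0) : ℕ × ℕ)).sup (schwartzSeminormFamily ℂ (Rd d) ℂ)) φ := by
  have hs := summable_one_add_norm_lattice ha c
  refine ⟨(∑' n : Fin d → ℤ, (((1 + ‖a • (intVec n + c)‖) ^ (d + 1))⁻¹ : ℝ)) * 2 ^ (d + 1),
    mul_nonneg (tsum_nonneg fun n => by positivity) (by positivity), fun φ => ?_⟩
  set S := ((Finset.Iic ((d + 1, 0) : ℕ × ℕ)).sup (schwartzSeminormFamily ℂ (Rd d) ℂ)) φ with hS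
  have hb : ∀ n : Fin d → ℤ, ‖φ (a • (intVec n + c))‖ ≤
      ((1 + ‖a • (intVec n + c)‖) ^ (d + 1))⁻¹ * (2 ^ (d + 1) * S) := by
    intro n
    have h1 := SchwartzMap.one_add_le_sup_seminorm_apply (𝕜 := ℂ) (m := (d + 1, 0)) (k := d + 1)
      (n := 0) le_rfl le_rfl φ (a • (intVec n + c))
    rw [norm_iteratedFDeriv_zero] at h1
    rw [← div_eq_inv_mul, le_div_iff₀ (by positivity), mul_comm]
    exact h1
  have hs' := hs.mul_right (2 ^ (d + 1) * S)
  refine ⟨Summable.of_norm_bounded hs' hb, ?_⟩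
  refine (tsum_of_norm_bounded hs'.hasSum hb).trans (le_of_eq ?_)
  rw [tsum_mul_right, mul_assoc]

/-- The Dirac comb `∑_{n ∈ ℤᵈ} δ_{a (n + c)}` as a tempered distribution (zero if `a ≤ 0`). -/
def diracComb {d : ℕ} (a : ℝ) (c : Rd d) : 𝓢'(Rd d, ℂ) :=
  open Classical in
  if ha : 0 < a then
    ContinuousLinearMap.toPointwiseConvergenceCLM ℂ (RingHom.id ℂ) 𝓢(Rd d, ℂ) ℂ <|
      SchwartzMap.mkCLMtoNormedSpace (𝕜 := ℂ) (σ := RingHom.id ℂ)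
        (fun φ : 𝓢(Rd d, ℂ) => ∑' n : Fin d → ℤ, φ (a • (intVec n + c)))
        (fun f g => by
          obtain ⟨K, -, hK⟩ := exists_schwartz_lattice_bound ha c
          simpa using (hK f).1.tsum_add (hK g).1)
        (fun b f => by simp [tsum_mul_left])
        (by
          obtain ⟨K, hK0, hK⟩ := exists_schwartz_lattice_bound ha c
          exact ⟨_, K, hK0, fun f => (hK f).2⟩)
  else 0

theorem diracComb_apply {d : ℕ} {a : ℝ} (ha : 0 < a) (c : Rd d) (φ : 𝓢(Rd d, ℂ)) :
    diracComb a c φ = ∑' n : Fin d → ℤ, φ (a • (intVec n + c)) := by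
  rw [diracComb, dif_pos ha]
  rfl

/-- The basis vectors
`Q_k = (α₁^(1/2) N)^(-d/2) ∑_{n ∈ ℤᵈ} δ_{α₁^(-1/2) (n + k / N)}`, `k ∈ {0, …, N - 1}ᵈ`. -/
def basisQ {d : ℕ} (N : ℕ) (α₁ : ℝ) (k : Fin d → Fin N) : 𝓢'(Rd d, ℂ) :=
  (((√α₁ * N) ^ (-(d : ℝ) / 2) : ℝ) : ℂ) •
    diracComb (√α₁)⁻¹ ((N : ℝ)⁻¹ • intVec fun i => ((k i : ℕ) : ℤ))

/-- The rescaled semiclassical parameter `h / √(α₁ α₂)` with `h = 1 / (2πN)`. -/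
def hTilde (N : ℕ) (α₁ α₂ : ℝ) : ℝ := (2 * Real.pi * N)⁻¹ / √(α₁ * α₂)

/-- The semiclassical Fourier transform `ξ ↦ ∫ exp(-i⟨x, ξ⟩ / h) φ(x) dx` of a Schwartz function
(zero if `h = 0`). -/
def semiFourier {d : ℕ} (h : ℝ) (φ : 𝓢(Rd d, ℂ)) : 𝓢(Rd d, ℂ) :=
  open Classical in
  if hh : 2 * Real.pi * h ≠ 0 then
    SchwartzMap.compCLMOfContinuousLinearEquiv ℂ
      (ContinuousLinearEquiv.smulLeft (Units.mk0 (2 * Real.pi * h)⁻¹ (inv_ne_zero hh)))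
      (FourierTransform.fourier φ : 𝓢(Rd d, ℂ))
  else 0

theorem semiFourier_apply {d : ℕ} {h : ℝ} (hh : h ≠ 0) (φ : 𝓢(Rd d, ℂ)) (ξ : Rd d) :
    semiFourier h φ ξ =
      ∫ x : Rd d, Complex.exp (-(Complex.I * ((inner ℝ x ξ / h : ℝ) : ℂ))) * φ x := by
  have h2 : 2 * Real.pi * h ≠ 0 := mul_ne_zero (mul_ne_zero two_ne_zero Real.pi_ne_zero) hh
  rw [semiFourier, dif_pos h2]
  change FourierTransform.fourier (φ : Rd d → ℂ) ((2 * Real.pi * h)⁻¹ • ξ) = _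
  rw [Real.fourier_eq']
  refine integral_congr_ae (Filter.Eventually.of_forall fun x => ?_)
  simp only [smul_eq_mul]
  congr 2
  rw [inner_smul_right]
  push_cast
  have hc : (h : ℂ) ≠ 0 := by exact_mod_cast hh
  have hp : (Real.pi : ℂ) ≠ 0 := by exact_mod_cast Real.pi_ne_zero
  field_simp

/-- The space of tempered distributions that are `α₁^(-1/2) ℤᵈ`-periodic and whose semiclassical
Fourier transform with parameter `h` is `α₂^(-1/2) ℤᵈ`-periodic. Both translations and the
semiclassical Fourier transform act on distributions by duality. -/
def torusSpace (d : ℕ) (h α₁ α₂ : ℝ) : Submodule ℂ 𝓢'(Rd d, ℂ) where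
  carrier := {u | ∀ (n : Fin d → ℤ) (φ : 𝓢(Rd d, ℂ)),
    u (SchwartzMap.compSubConstCLM ℂ ((√α₁)⁻¹ • intVec n) φ) = u φ ∧
    u (semiFourier h (SchwartzMap.compSubConstCLM ℂ ((√α₂)⁻¹ • intVec n) φ)) =
      u (semiFourier h φ)}
  add_mem' := fun {u v} hu hv n φ => by
    constructor
    · change u _ + v _ = u _ + v _
      rw [(hu n φ).1, (hv n φ).1]
    · change u _ + v _ = u _ + v _
      rw [(hu n φ).2, (hv n φ).2]
  zero_mem' := fun _ _ => ⟨rfl, rfl⟩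
  smul_mem' := fun c u hu n φ => by
    constructor
    · change c • u _ = c • u _
      rw [(hu n φ).1]
    · change c • u _ = c • u _
      rw [(hu n φ).2]

theorem basisQ_mem_torusSpace {d : ℕ} (N : ℕ) (hN : 1 ≤ N) (α₁ α₂ : ℝ) (h1 : 0 < α₁) (h2 : 0 < α₂)
    (k : Fin d → Fin N) :
    basisQ N α₁ k ∈ torusSpace d (hTilde N α₁ α₂) α₁ α₂ := by
  have hs1 : 0 < √α₁ := Real.sqrt_pos.2 h1
  have hs2 : 0 < √α₂ := Real.sqrt_pos.2 h2
  have hN' : (0:ℝ) < N := by exact_mod_cast hN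
  have hh : hTilde N α₁ α₂ ≠ 0 := by
    unfold hTilde; rw [Real.sqrt_mul h1.le]; positivity
  unfold basisQ
  refine Submodule.smul_mem _ _ ?_
  intro n φ
  rw [diracComb_apply (inv_pos.2 hs1), diracComb_apply (inv_pos.2 hs1), diracComb_apply (inv_pos.2 hs1), diracComb_apply (inv_pos.2 hs1)]
  constructor
  · rw [← (Equiv.subRight n).tsum_eq (fun m => φ ((√α₁)⁻¹ • (intVec m + _)))]
    refine tsum_congr fun m => ?_
    rw [SchwartzMap.compSubConstCLM_apply, ← smul_sub]
    congr 2
    ext i; simp [intVec]; ring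
  · refine tsum_congr fun m => ?_
    rw [semiFourier_apply hh, semiFourier_apply hh]
    set ξ := ((√α₁)⁻¹ • (intVec m + (N : ℝ)⁻¹ • intVec fun i => ((k i : ℕ) : ℤ)) : Rd d) with hξ
    set s : Rd d := (√α₂)⁻¹ • intVec n with hs
    simp only [SchwartzMap.compSubConstCLM_apply]
    rw [← integral_add_right_eq_self _ s]
    refine integral_congr_ae (Filter.Eventually.of_forall fun x => ?_)
    simp only [add_sub_cancel_right]
    congr 1
    rw [inner_add_left, add_div]
    have : (inner ℝ s ξ / hTilde N α₁ α₂ : ℝ) = ((∑ i, n i * (N * m i + (k i : ℕ)) : ℤ) : ℝ) * (2 * Real.pi) := by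
      rw [hs, hξ, inner_smul_left, inner_smul_right, hTilde, Real.sqrt_mul h1.le]
      have : (inner ℝ (intVec n) (intVec m + (N : ℝ)⁻¹ • intVec fun i => ((k i : ℕ) : ℤ)) : ℝ) = (N:ℝ)⁻¹ * ((∑ i, n i * (N * m i + (k i : ℕ)) : ℤ) : ℝ) := by
        push_cast
        rw [PiLp.inner_apply, Finset.mul_sum]
        refine Finset.sum_congr rfl fun i _ => ?_
        simp [intVec]
        field_simp
      rw [this]
      simp
      field_simp
    rw [this]
    push_cast
    rw [Complex.exp_eq_exp_iff_exists_int]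
    refine ⟨-(∑ i, n i * (N * m i + (k i : ℕ)) : ℤ), ?_⟩
    push_cast
    ring

/-- `A` is the matrix, in the basis `(Q_k)` of the space `torusSpace d h α₁ α₂`, of the restriction
to this space of the Weyl quantization of `p` with parameter `h = hTilde N α₁ α₂`: if `u` in this
space has coordinates `c`, then its image has coordinates `A c`. -/
def IsQuantizationMatrix {d : ℕ} (N : ℕ) (α₁ α₂ : ℝ) (p : Rd d × Rd d → ℂ)
    (A : Matrix (Fin d → Fin N) (Fin d → Fin N) ℂ) : Prop :=
  ∀ u ∈ torusSpace d (hTilde N α₁ α₂) α₁ α₂, ∀ c : (Fin d → Fin N) → ℂ,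
    u = ∑ k, c k • basisQ N α₁ k →
      IsWeylImage (hTilde N α₁ α₂) p u (∑ k, A.mulVec c k • basisQ N α₁ k)

/-- The operator norm `ℓ² → ℓ²` of a complex square matrix. -/
def l2OpNorm {ι : Type} [Fintype ι] [DecidableEq ι] (A : Matrix ι ι ℂ) : ℝ :=
  ‖Matrix.toEuclideanCLM (n := ι) (𝕜 := ℂ) A‖

end

/-!
The symbol `p`, rescaled to the standard torus, is the sum of its Fourier series
`∑ c(m, n) exp(2πi(m·a + n·b))`. The Weyl quantization of a character is a translation followed by
a multiplication by a character (`weylFun_eq_tsum`), and on the lattice distributions `Q_k` it acts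
as the discrete Weyl operator `f ↦ (k ↦ exp(2πi m·(k + n/2)/N) f(k + n))` on functions on `(ℤ/N)ᵈ`.
Hence the matrix of the quantization is `weylMatrix N c`
(`IsTorusSymbol.isQuantizationMatrix`), and it is the only one (`IsQuantizationMatrix.unique`).

To bound its norm, the Weyl quantization is compared with a positive one. Multiply the coefficients
by `γ(m, n) = Z⁻¹ ∑ₜ exp(-κ|t + n|²) exp(-κ|t - n|²) exp(-2πi m·t/(2N))`, the sum being over
`t ∈ ℤᵈ`. The form of the resulting matrix is an average of convolution forms on `ℤᵈ`
applied to Gaussian truncations of the periodic extensions of the vectors, and the symbols of these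
convolutions are restrictions of the symbol, so that the norm is at most its supremum
(`formBound_antiWick`). On the other hand `γ` is the characteristic function of a probability measure
with small first moments (`exists_measure_antiWick`), so the multiplication by `γ` averages the
translates of the symbol.

In the expansion `1 = γ + γ(1 - γ) + ⋯ + γ(1 - γ)^M + (1 - γ)^(M+1)` of the quantization
(`formBound_iterate`), the first term is bounded by the supremum of `|p|`. The symbol of the
`j`-th of the following ones is bounded by `2^(j-1)` times the supremum of the symbol with coefficients
`(1 - γ) c`, which is small because `p` is Lipschitz: for `κ` proportional to `√α₂ / (N √α₁)` it is of
order `δ = (N √(α₁ α₂))^(-1/2) ≤ N^(-(1-w)/2)`. The last term is bounded by the `ℓ¹` norm of its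
coefficients. These decay rapidly in `√α₁ |m| + √α₂ |n|`
(`IsTorusSymbol.norm_symbolCoeff_mul_le`), uniformly in the symbol, so that the norm is
`O(δ^(M+1) (α₁ α₂)^(-(d+1)/2))`, and a choice of `M` large enough in terms of `w` and `d` makes this a
negative power of `N` as well (`exists_l2OpNorm_le`).
-/

open MeasureTheory SchwartzMap
open scoped ContDiff ComplexConjugate

namespace TorusQuant

/-! ### Characters -/

/-- The character `x ↦ exp(2πix)` of `ℝ`. -/
noncomputable def cis (x : ℝ) : ℂ := Complex.exp (2 * Real.pi * x * Complex.I)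

lemma cis_add (x y : ℝ) : cis (x + y) = cis x * cis y := by
  unfold cis
  rw [← Complex.exp_add]
  congr 1
  push_cast
  ring

@[simp] lemma cis_zero : cis 0 = 1 := by simp [cis]

@[simp] lemma norm_cis (x : ℝ) : ‖cis x‖ = 1 := by
  have : cis x = Complex.exp ((2 * Real.pi * x : ℝ) * Complex.I) := by simp [cis]
  rw [this, Complex.norm_exp_ofReal_mul_I]

lemma cis_intCast (n : ℤ) : cis n = 1 := by
  unfold cis
  rw [Complex.exp_eq_one_iff]
  exact ⟨n, by push_cast; ring⟩

lemma cis_neg (x : ℝ) : cis (-x) = conj (cis x) := by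
  unfold cis
  rw [← Complex.exp_conj]
  congr 1
  simp [Complex.conj_ofNat]

@[fun_prop] lemma continuous_cis : Continuous cis := by
  unfold cis
  fun_prop

lemma norm_cis_sub_one_le (x : ℝ) : ‖cis x - 1‖ ≤ 2 * Real.pi * |x| := by
  have h : cis x = Complex.exp (Complex.I * (2 * Real.pi * x : ℝ)) := by
    unfold cis
    congr 1
    push_cast
    ring
  rw [h]
  refine (Real.norm_exp_I_mul_ofReal_sub_one_le).trans (le_of_eq ?_)
  rw [Real.norm_eq_abs, abs_mul, abs_of_pos (by positivity)]

variable {d : ℕ} {ι : Type*} [Fintype ι]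

/-- The pairing `∑ mᵢ aᵢ` of an integer vector with a real vector. -/
def zdot (m : ι → ℤ) (a : ι → ℝ) : ℝ := ∑ i, (m i : ℝ) * a i

lemma zdot_add (m : ι → ℤ) (a b : ι → ℝ) : zdot m (a + b) = zdot m a + zdot m b := by
  simp [zdot, mul_add, Finset.sum_add_distrib]

lemma zdot_neg (m : ι → ℤ) (a : ι → ℝ) : zdot m (-a) = -zdot m a := by
  simp [zdot]

lemma zdot_smul (m : ι → ℤ) (r : ℝ) (a : ι → ℝ) : zdot m (r • a) = r * zdot m a := by
  simp only [zdot, Finset.mul_sum, Pi.smul_apply, smul_eq_mul]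
  exact Finset.sum_congr rfl fun i _ => by ring

lemma neg_zdot (m : ι → ℤ) (a : ι → ℝ) : zdot (-m) a = -zdot m a := by
  simp [zdot]

@[simp] lemma zero_zdot (a : ι → ℝ) : zdot 0 a = 0 := by simp [zdot]

lemma cis_zdot_intCast (m q : ι → ℤ) : cis (zdot m fun i => (q i : ℝ)) = 1 := by
  have : zdot m (fun i => (q i : ℝ)) = ((∑ i, m i * q i : ℤ) : ℝ) := by
    simp [zdot]
  rw [this, cis_intCast]

@[fun_prop] lemma continuous_zdot (m : ι → ℤ) : Continuous (zdot m) := by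
  unfold zdot
  fun_prop

lemma abs_zdot_le (m : Fin d → ℤ) (a : Fin d → ℝ) : |zdot m a| ≤ d * ‖m‖ * ‖a‖ := by
  unfold zdot
  refine (Finset.abs_sum_le_sum_abs _ _).trans ?_
  calc ∑ i, |(m i : ℝ) * a i| ≤ ∑ _i : Fin d, ‖m‖ * ‖a‖ := by
        refine Finset.sum_le_sum fun i _ => ?_
        rw [abs_mul]
        have h1 := norm_le_pi_norm m i
        have h2 := norm_le_pi_norm a i
        rw [Real.norm_eq_abs] at h2
        rw [Int.norm_eq_abs] at h1
        gcongr
    _ = d * ‖m‖ * ‖a‖ := by simp [mul_assoc]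

/-- The trigonometric series `∑ c(m, n) exp(2πi(m·a + n·b))` on `ℝᵈ × ℝᵈ`. -/
noncomputable def trigSum (c : (Fin d → ℤ) × (Fin d → ℤ) → ℂ) (a b : Fin d → ℝ) : ℂ :=
  ∑' ζ, c ζ * cis (zdot ζ.1 a + zdot ζ.2 b)

/-! ### The discrete torus and the matrix of a trigonometric series -/

section Discrete

/-- The representative in `{0, …, N - 1}ᵈ` of a point of the discrete torus. -/
def liftN {N : ℕ} (k : Fin d → Fin N) : Fin d → ℤ := fun i => ((k i : ℕ) : ℤ)

/-- The phase `exp(2πi m·(s + n/2)/N)` of the discrete Weyl operator with index `(m, n)` at `s`. -/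
noncomputable def weylPhase (N : ℕ) (m n s : Fin d → ℤ) : ℂ :=
  cis (zdot m fun i => ((s i : ℝ) + (n i : ℝ) / 2) / N)

@[simp] lemma norm_weylPhase (N : ℕ) (m n s : Fin d → ℤ) : ‖weylPhase N m n s‖ = 1 := norm_cis _

lemma summable_mul_of_norm_le {ι : Type*} {c u : ι → ℂ} (hc : Summable c) {K : ℝ}
    (hu : ∀ i, ‖u i‖ ≤ K) : Summable fun i => c i * u i := by
  refine Summable.of_norm_bounded (hc.norm.mul_right K) fun i => ?_
  rw [norm_mul]
  gcongr
  exact hu i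

variable {N : ℕ} [NeZero N]

variable (N) in
/-- Reduction of an integer vector modulo `N`, coordinate by coordinate. -/
def modN (s : Fin d → ℤ) : Fin d → Fin N := fun i =>
  ⟨(s i % N).toNat, by
    have hN : (0 : ℤ) < N := by exact_mod_cast Nat.pos_of_ne_zero (NeZero.ne N)
    have h1 := Int.emod_nonneg (s i) hN.ne'
    have h2 := Int.emod_lt_of_pos (s i) hN
    omega⟩

lemma liftN_modN (s : Fin d → ℤ) (i : Fin d) : liftN (modN N s) i = s i % N := by
  have hN : (0 : ℤ) < N := by exact_mod_cast Nat.pos_of_ne_zero (NeZero.ne N)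
  simp [liftN, modN, Int.toNat_of_nonneg (Int.emod_nonneg (s i) hN.ne')]

lemma exists_liftN_modN (s : Fin d → ℤ) : ∃ q : Fin d → ℤ, s = liftN (modN N s) + (N : ℤ) • q := by
  refine ⟨fun i => s i / N, ?_⟩
  ext i
  simp [liftN_modN, Int.emod_add_mul_ediv]

lemma modN_add_smul (s q : Fin d → ℤ) : modN N (s + (N : ℤ) • q) = modN N s := by
  ext i
  simp [modN]

lemma modN_liftN (k : Fin d → Fin N) : modN N (liftN k) = k := by
  ext i
  have : ((k i : ℕ) : ℤ) % N = (k i : ℕ) := Int.emod_eq_of_lt (by positivity) (by exact_mod_cast (k i).2)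
  simp [modN, liftN, this]

lemma modN_liftN_modN_add (s n : Fin d → ℤ) : modN N (liftN (modN N s) + n) = modN N (s + n) := by
  obtain ⟨q, hq⟩ := exists_liftN_modN (N := N) s
  conv_rhs => rw [hq, add_right_comm, modN_add_smul]

/-- Translation invariance of the sum of a periodic function over a period. -/
lemma sum_liftN_add {M : Type*} [AddCommMonoid M] (h : (Fin d → ℤ) → M)
    (hh : ∀ s q, h (s + (N : ℤ) • q) = h s) (n : Fin d → ℤ) :
    ∑ k : Fin d → Fin N, h (liftN k + n) = ∑ k : Fin d → Fin N, h (liftN k) := by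
  have hb : Function.Bijective fun k : Fin d → Fin N => modN N (liftN k + n) := by
    rw [← Finite.injective_iff_bijective]
    refine Function.LeftInverse.injective (g := fun k => modN N (liftN k - n)) fun k => ?_
    simp only
    rw [sub_eq_add_neg, modN_liftN_modN_add, add_neg_cancel_right, modN_liftN]
  rw [← hb.sum_comp fun k => h (liftN k)]
  refine Finset.sum_congr rfl fun k _ => ?_
  obtain ⟨q, hq⟩ := exists_liftN_modN (N := N) (liftN k + n)
  conv_lhs => rw [hq, hh]

lemma weylPhase_add_smul (m n s q : Fin d → ℤ) :
    weylPhase N m n (s + (N : ℤ) • q) = weylPhase N m n s := by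
  have hN : (N : ℝ) ≠ 0 := by exact_mod_cast NeZero.ne N
  unfold weylPhase
  have : (fun i => (((s + (N : ℤ) • q) i : ℝ) + (n i : ℝ) / 2) / N) =
      (fun i => ((s i : ℝ) + (n i : ℝ) / 2) / N) + fun i => (q i : ℝ) := by
    ext i
    simp
    field_simp
    ring
  rw [this, zdot_add, cis_add, cis_zdot_intCast, mul_one]

/-- The matrix `∑ c(m, n) W(m, n)`, where `W(m, n)` is the discrete Weyl operator
`f ↦ (k ↦ exp(2πi m·(k + n/2)/N) f(k + n))` on functions on `(ℤ/N)ᵈ`. -/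
noncomputable def weylMatrix (N : ℕ) [NeZero N] (c : (Fin d → ℤ) × (Fin d → ℤ) → ℂ) :
    Matrix (Fin d → Fin N) (Fin d → Fin N) ℂ :=
  Matrix.of fun k l => ∑' ζ, c ζ * weylPhase N ζ.1 ζ.2 (liftN k) *
    if modN N (liftN k + ζ.2) = l then 1 else 0

lemma weylMatrix_mulVec {c : (Fin d → ℤ) × (Fin d → ℤ) → ℂ} (hc : Summable c)
    (f : (Fin d → Fin N) → ℂ) (k : Fin d → Fin N) :
    (weylMatrix N c).mulVec f k =
      ∑' ζ, c ζ * weylPhase N ζ.1 ζ.2 (liftN k) * f (modN N (liftN k + ζ.2)) := by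
  unfold weylMatrix Matrix.mulVec dotProduct
  simp only [Matrix.of_apply]
  simp_rw [← tsum_mul_right]
  rw [← Summable.tsum_finsetSum]
  · refine tsum_congr fun ζ => ?_
    rw [Finset.sum_eq_single (modN N (liftN k + ζ.2))]
    · simp
    · intro l _ hl
      simp [hl.symm]
    · simp
  · intro l _
    simp_rw [mul_assoc]
    refine summable_mul_of_norm_le hc (K := ‖f l‖) fun ζ => ?_
    rw [norm_mul, norm_weylPhase, one_mul]
    split_ifs <;> simp

/-- The sesquilinear form of `weylMatrix N c`. -/
noncomputable def weylForm (N : ℕ) [NeZero N] (c : (Fin d → ℤ) × (Fin d → ℤ) → ℂ)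
    (f g : (Fin d → Fin N) → ℂ) : ℂ :=
  ∑ k, conj (g k) *
    ∑' ζ, c ζ * weylPhase N ζ.1 ζ.2 (liftN k) * f (modN N (liftN k + ζ.2))

/-- The quantization of the series with coefficients `c` is bounded by `S` as a form. -/
def FormBound (N : ℕ) [NeZero N] (c : (Fin d → ℤ) × (Fin d → ℤ) → ℂ) (S : ℝ) : Prop :=
  ∀ f g : (Fin d → Fin N) → ℂ,
    ‖weylForm N c f g‖ ≤ S * ((∑ k, ‖f k‖ ^ 2) + ∑ k, ‖g k‖ ^ 2) / 2

lemma FormBound.l2OpNorm_le {c : (Fin d → ℤ) × (Fin d → ℤ) → ℂ} (hc : Summable c) {S : ℝ}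
    (hS : 0 ≤ S) (h : FormBound N c S) : l2OpNorm (weylMatrix N c) ≤ S := by
  unfold l2OpNorm
  refine ContinuousLinearMap.opNorm_le_of_re_inner_le hS fun x y hx hy => ?_
  have h1 := h x.ofLp (WithLp.ofLp y)
  have hx' : ∑ k, ‖x k‖ ^ 2 = 1 := by rw [← EuclideanSpace.norm_sq_eq, hx, one_pow]
  have hy' : ∑ k, ‖y k‖ ^ 2 = 1 := by rw [← EuclideanSpace.norm_sq_eq, hy, one_pow]
  rw [hx', hy'] at h1
  have h2 : inner ℂ y (Matrix.toEuclideanCLM (n := Fin d → Fin N) (𝕜 := ℂ) (weylMatrix N c) x) =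
      weylForm N c x.ofLp y.ofLp := by
    rw [PiLp.inner_apply]
    unfold weylForm
    refine Finset.sum_congr rfl fun k _ => ?_
    rw [← weylMatrix_mulVec hc, RCLike.inner_apply']
    rfl
  rw [← inner_conj_symm, RCLike.conj_re, h2]
  refine (RCLike.re_le_norm _).trans (h1.trans (le_of_eq (by ring)))

lemma summable_weylForm {c : (Fin d → ℤ) × (Fin d → ℤ) → ℂ} (hc : Summable c)
    (f : (Fin d → Fin N) → ℂ) (k : Fin d → Fin N) :
    Summable fun ζ => c ζ * weylPhase N ζ.1 ζ.2 (liftN k) * f (modN N (liftN k + ζ.2)) := by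
  simp_rw [mul_assoc]
  refine summable_mul_of_norm_le hc (K := ∑ l, ‖f l‖) fun ζ => ?_
  rw [norm_mul, norm_weylPhase, one_mul]
  exact Finset.single_le_sum (f := fun l => ‖f l‖) (fun _ _ => norm_nonneg _) (Finset.mem_univ _)

lemma FormBound.add {c c' : (Fin d → ℤ) × (Fin d → ℤ) → ℂ} (hc : Summable c) (hc' : Summable c')
    {S S' : ℝ} (h : FormBound N c S) (h' : FormBound N c' S') : FormBound N (c + c') (S + S') := by
  intro f g
  have : weylForm N (c + c') f g = weylForm N c f g + weylForm N c' f g := by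
    unfold weylForm
    rw [← Finset.sum_add_distrib]
    refine Finset.sum_congr rfl fun k _ => ?_
    rw [← mul_add, ← (summable_weylForm hc f k).tsum_add (summable_weylForm hc' f k)]
    congr 1
    refine tsum_congr fun ζ => ?_
    simp only [Pi.add_apply]
    ring
  rw [this]
  refine (norm_add_le _ _).trans ((add_le_add (h f g) (h' f g)).trans (le_of_eq ?_))
  ring

/-- The trivial bound of a quantization by the `ℓ¹` norm of the coefficients: each Weyl operator
is unitary. -/
lemma formBound_tsum_norm {c : (Fin d → ℤ) × (Fin d → ℤ) → ℂ} (hc : Summable c) :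
    FormBound N c (∑' ζ, ‖c ζ‖) := by
  intro f g
  have h1 : weylForm N c f g = ∑' ζ, c ζ * ∑ k, conj (g k) *
      (weylPhase N ζ.1 ζ.2 (liftN k) * f (modN N (liftN k + ζ.2))) := by
    unfold weylForm
    simp_rw [← tsum_mul_left]
    rw [← Summable.tsum_finsetSum fun k _ => (summable_weylForm hc f k).mul_left _]
    refine tsum_congr fun ζ => ?_
    rw [Finset.mul_sum]
    exact Finset.sum_congr rfl fun k _ => by ring
  have h2 : ∀ ζ : (Fin d → ℤ) × (Fin d → ℤ), ‖∑ k, conj (g k) *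
      (weylPhase N ζ.1 ζ.2 (liftN k) * f (modN N (liftN k + ζ.2)))‖ ≤
        ((∑ k, ‖f k‖ ^ 2) + ∑ k, ‖g k‖ ^ 2) / 2 := by
    intro ζ
    have h3 : ∑ k : Fin d → Fin N, ‖f (modN N (liftN k + ζ.2))‖ ^ 2 = ∑ k, ‖f k‖ ^ 2 := by
      have := sum_liftN_add (N := N) (fun s => ‖f (modN N s)‖ ^ 2)
        (fun s q => by rw [modN_add_smul]) ζ.2
      simpa only [modN_liftN] using this
    rw [← h3, ← Finset.sum_add_distrib, Finset.sum_div]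
    refine norm_sum_le_of_le _ fun k _ => ?_
    rw [norm_mul, norm_mul, norm_weylPhase, one_mul, RCLike.norm_conj]
    nlinarith [sq_nonneg (‖f (modN N (liftN k + ζ.2))‖ - ‖g k‖)]
  rw [h1]
  have h4 := hc.norm.mul_right (((∑ k, ‖f k‖ ^ 2) + ∑ k, ‖g k‖ ^ 2) / 2)
  refine (tsum_of_norm_bounded h4.hasSum fun ζ => ?_).trans (le_of_eq ?_)
  · rw [norm_mul]
    exact mul_le_mul_of_nonneg_left (h2 ζ) (norm_nonneg _)
  · rw [tsum_mul_right]
    ring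

end Discrete

/-! ### Convolution operators on `ℤᵈ` -/

section Torus

lemma exists_coe_torus {ι : Type*} (x : UnitAddTorus ι) : ∃ b : ι → ℝ, x = fun i => (b i : UnitAddCircle) := by
  choose b hb using fun i => QuotientAddGroup.mk_surjective (x i)
  exact ⟨b, funext fun i => (hb i).symm⟩

variable {ι : Type*} [Fintype ι]

/-- The normalised Haar measure of the torus `(ℝ/ℤ)^ι`. -/
noncomputable abbrev torusMeasure (ι : Type*) [Fintype ι] : Measure (UnitAddTorus ι) :=
  Measure.pi fun _ => AddCircle.haarAddCircle

lemma mFourier_coe (n : ι → ℤ) (b : ι → ℝ) :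
    UnitAddTorus.mFourier n (fun i => (b i : UnitAddCircle)) = cis (zdot n b) := by
  unfold UnitAddTorus.mFourier cis zdot
  simp only [ContinuousMap.coe_mk, fourier_coe_apply]
  rw [← Complex.exp_sum]
  congr 1
  push_cast
  rw [Finset.mul_sum, Finset.sum_mul]
  exact Finset.sum_congr rfl fun i _ => by ring

lemma norm_mFourier_apply (n : ι → ℤ) (x : UnitAddTorus ι) : ‖UnitAddTorus.mFourier n x‖ = 1 := by
  obtain ⟨b, rfl⟩ := exists_coe_torus x
  rw [mFourier_coe, norm_cis]

lemma mFourier_apply_add (n : ι → ℤ) (x y : UnitAddTorus ι) :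
    UnitAddTorus.mFourier n (x + y) = UnitAddTorus.mFourier n x * UnitAddTorus.mFourier n y := by
  obtain ⟨b, rfl⟩ := exists_coe_torus x
  obtain ⟨b', rfl⟩ := exists_coe_torus y
  rw [mFourier_coe, mFourier_coe, ← cis_add, ← zdot_add, ← mFourier_coe]
  rfl

lemma cis_half : cis 2⁻¹ = -1 := by
  unfold cis
  rw [← Complex.exp_pi_mul_I]
  congr 1
  push_cast
  ring

/-- The translation by half a period in one coordinate changes the sign of a character. -/
lemma mFourier_single_half [DecidableEq ι] {n : ι → ℤ} {j : ι} (hj : n j ≠ 0) :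
    UnitAddTorus.mFourier n
      (fun i => ((Pi.single j ((2 * n j : ℝ)⁻¹) : ι → ℝ) i : UnitAddCircle)) = -1 := by
  rw [mFourier_coe, ← cis_half]
  congr 1
  have : (n j : ℝ) ≠ 0 := by exact_mod_cast hj
  unfold zdot
  rw [Finset.sum_eq_single j]
  · rw [Pi.single_eq_same]
    field_simp
  · intro i _ hi
    rw [Pi.single_eq_of_ne hi, mul_zero]
  · simp

lemma integral_mFourier (n : ι → ℤ) :
    ∫ x, UnitAddTorus.mFourier n x ∂torusMeasure ι = if n = 0 then 1 else 0 := by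
  classical
  split_ifs with h
  · simp [h, UnitAddTorus.mFourier_zero]
  · obtain ⟨j, hj⟩ := Function.ne_iff.mp h
    refine integral_eq_zero_of_add_right_eq_neg
      (g := fun i => ((Pi.single j ((2 * n j : ℝ)⁻¹) : ι → ℝ) i : UnitAddCircle)) fun x => ?_
    rw [mFourier_apply_add, mFourier_single_half hj, mul_neg_one]

lemma integral_tsum_mFourier {κ : Type*} [Countable κ] {w : κ → ℂ} (hw : Summable w)
    (ν : κ → ι → ℤ) :
    ∫ x, ∑' i, w i * UnitAddTorus.mFourier (ν i) x ∂torusMeasure ι =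
      ∑' i, if ν i = 0 then w i else 0 := by
  rw [← integral_tsum_of_summable_integral_norm]
  · refine tsum_congr fun i => ?_
    rw [integral_const_mul, integral_mFourier]
    split_ifs <;> simp
  · intro i
    exact ((UnitAddTorus.mFourier (ν i)).continuous.integrable_of_hasCompactSupport
      (HasCompactSupport.of_compactSpace _)).const_mul _
  · simpa [norm_mul, norm_mFourier_apply] using hw.norm

lemma continuous_tsum_mFourier {κ : Type*} {w : κ → ℂ} (hw : Summable w) (ν : κ → ι → ℤ) :
    Continuous fun x => ∑' i, w i * UnitAddTorus.mFourier (ν i) x := by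
  refine continuous_tsum (fun i => by fun_prop) hw.norm fun i x => ?_
  rw [norm_mul, norm_mFourier_apply, mul_one]

lemma summable_mul_mFourier {κ : Type*} {w : κ → ℂ} (hw : Summable w) (ν : κ → ι → ℤ)
    (x : UnitAddTorus ι) : Summable fun i => w i * UnitAddTorus.mFourier (ν i) x :=
  summable_mul_of_norm_le hw fun i => (norm_mFourier_apply (ν i) x).le

lemma integral_norm_sq_tsum_mFourier {F : (ι → ℤ) → ℂ} (hF : Summable F) :
    ∫ x, ‖∑' s, F s * UnitAddTorus.mFourier (-s) x‖ ^ 2 ∂torusMeasure ι = ∑' s, ‖F s‖ ^ 2 := by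
  have h1 : ∀ x : UnitAddTorus ι, ((‖∑' s, F s * UnitAddTorus.mFourier (-s) x‖ ^ 2 : ℝ) : ℂ) =
      ∑' i : (ι → ℤ) × (ι → ℤ), (F i.1 * conj (F i.2)) * UnitAddTorus.mFourier (i.2 - i.1) x := by
    intro x
    have hs := summable_mul_mFourier hF (fun s => -s) x
    rw [Complex.ofReal_pow, ← Complex.mul_conj', Complex.conj_tsum,
      tsum_mul_tsum_of_summable_norm hs.norm (by simpa using hs.norm)]
    refine tsum_congr fun i => ?_
    rw [map_mul, ← UnitAddTorus.mFourier_neg, neg_neg, sub_eq_add_neg, UnitAddTorus.mFourier_add]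
    ring
  have h2 : Summable fun i : (ι → ℤ) × (ι → ℤ) => F i.1 * conj (F i.2) := by
    have hF' : Summable fun s => ‖conj (F s)‖ := by
      simpa only [RCLike.norm_conj] using hF.norm
    exact summable_mul_of_summable_norm (f := F) (g := fun s => conj (F s)) hF.norm hF'
  apply Complex.ofReal_injective
  rw [← integral_complex_ofReal]
  simp_rw [h1]
  rw [integral_tsum_mFourier h2, Complex.ofReal_tsum]
  have hinj : Function.Injective fun s : ι → ℤ => (s, s) := fun s t h => congrArg Prod.fst h
  rw [← hinj.tsum_eq]
  · refine tsum_congr fun s => ?_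
    rw [if_pos (sub_self s), Complex.mul_conj', Complex.ofReal_pow]
  · intro i hi
    by_contra hne
    refine hi ?_
    simp only
    rw [if_neg]
    intro h
    exact hne ⟨i.1, Prod.ext rfl (sub_eq_zero.mp h).symm⟩

/-- A convolution operator on `ℓ²(ℤᵈ)` is bounded by the supremum of its symbol, as a form. -/
theorem norm_tsum_convolution_le {q F G : (ι → ℤ) → ℂ} (hq : Summable q) (hF : Summable F)
    (hG : Summable G) {S : ℝ} (hS : ∀ b : ι → ℝ, ‖∑' n, q n * cis (zdot n b)‖ ≤ S) :
    ‖∑' i : (ι → ℤ) × (ι → ℤ), q i.1 * F (i.2 + i.1) * conj (G i.2)‖ ≤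
      S * ((∑' s, ‖F s‖ ^ 2) + ∑' s, ‖G s‖ ^ 2) / 2 := by
  have hG' : Summable fun s => conj (G s) := by
    rw [← summable_norm_iff]
    simpa only [RCLike.norm_conj] using hG.norm
  have h2 : Summable fun i : (ι → ℤ) × (ι → ℤ) => F i.1 * conj (G i.2) :=
    summable_mul_of_summable_norm (f := F) (g := fun s => conj (G s)) hF.norm hG'.norm
  have h3 : Summable fun i : (ι → ℤ) × ((ι → ℤ) × (ι → ℤ)) => q i.1 * (F i.2.1 * conj (G i.2.2)) :=
    summable_mul_of_summable_norm (f := q)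
      (g := fun i : (ι → ℤ) × (ι → ℤ) => F i.1 * conj (G i.2)) hq.norm h2.norm
  let Fq : UnitAddTorus ι → ℂ := fun x => ∑' n, q n * UnitAddTorus.mFourier n x
  let FF : UnitAddTorus ι → ℂ := fun x => ∑' s, F s * UnitAddTorus.mFourier (-s) x
  let FG : UnitAddTorus ι → ℂ := fun x => ∑' s, G s * UnitAddTorus.mFourier (-s) x
  have hcF : Continuous FF := continuous_tsum_mFourier hF _
  have hcG : Continuous FG := continuous_tsum_mFourier hG _
  have h1 : ∀ x, Fq x * (FF x * conj (FG x)) = ∑' i : (ι → ℤ) × ((ι → ℤ) × (ι → ℤ)),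
      (q i.1 * (F i.2.1 * conj (G i.2.2))) *
        UnitAddTorus.mFourier (i.1 + (i.2.2 - i.2.1)) x := by
    intro x
    have hsq := summable_mul_mFourier hq (fun s => s) x
    have hsF := summable_mul_mFourier hF (fun s => -s) x
    have hsG := summable_mul_mFourier hG (fun s => -s) x
    have hsG' : Summable fun s => ‖conj (G s * UnitAddTorus.mFourier (-s) x)‖ := by
      simpa using hsG.norm
    simp only [Fq, FF, FG]
    rw [Complex.conj_tsum, tsum_mul_tsum_of_summable_norm hsF.norm hsG',
      tsum_mul_tsum_of_summable_norm hsq.norm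
        (summable_mul_of_summable_norm hsF.norm hsG').norm]
    refine tsum_congr fun i => ?_
    rw [map_mul, ← UnitAddTorus.mFourier_neg, neg_neg, sub_eq_add_neg, UnitAddTorus.mFourier_add,
      UnitAddTorus.mFourier_add]
    ring
  have h4 : ∑' i : (ι → ℤ) × (ι → ℤ), q i.1 * F (i.2 + i.1) * conj (G i.2) =
      ∫ x, Fq x * (FF x * conj (FG x)) ∂torusMeasure ι := by
    simp_rw [h1]
    rw [integral_tsum_mFourier h3]
    have hinj : Function.Injective fun i : (ι → ℤ) × (ι → ℤ) => (i.1, (i.2 + i.1, i.2)) := by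
      intro i j h
      simp only [Prod.mk.injEq] at h
      exact Prod.ext h.1 h.2.2
    rw [← hinj.tsum_eq]
    · refine tsum_congr fun i => ?_
      rw [if_pos (by simp)]
      ring
    · intro i hi
      by_contra hne
      refine hi ?_
      simp only
      rw [if_neg]
      intro h
      refine hne ⟨(i.1, i.2.2), Prod.ext rfl (Prod.ext ?_ rfl)⟩
      simp only
      rw [add_sub_left_comm] at h
      rw [add_eq_zero_iff_eq_neg, neg_sub] at h
      rw [h, sub_add_cancel]
  have hint : ∀ {u : UnitAddTorus ι → ℝ}, Continuous u → Integrable u (torusMeasure ι) :=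
    fun hu => hu.integrable_of_hasCompactSupport (HasCompactSupport.of_compactSpace _)
  rw [h4]
  have h5 : ∀ x, ‖Fq x * (FF x * conj (FG x))‖ ≤ S / 2 * (‖FF x‖ ^ 2 + ‖FG x‖ ^ 2) := by
    intro x
    have h6 : ‖Fq x‖ ≤ S := by
      obtain ⟨b, rfl⟩ := exists_coe_torus x
      simp only [Fq, mFourier_coe]
      exact hS b
    have hS0 : 0 ≤ S := (norm_nonneg _).trans h6
    rw [norm_mul, norm_mul, RCLike.norm_conj]
    calc ‖Fq x‖ * (‖FF x‖ * ‖FG x‖) ≤ S * (‖FF x‖ * ‖FG x‖) := by gcongr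
      _ ≤ S / 2 * (‖FF x‖ ^ 2 + ‖FG x‖ ^ 2) := by
        nlinarith [mul_nonneg hS0 (sq_nonneg (‖FF x‖ - ‖FG x‖))]
  refine (norm_integral_le_of_norm_le (g := fun x => S / 2 * (‖FF x‖ ^ 2 + ‖FG x‖ ^ 2))
    (hint (by fun_prop)) (Filter.Eventually.of_forall h5)).trans (le_of_eq ?_)
  rw [integral_const_mul, integral_add (hint (by fun_prop)) (hint (by fun_prop)),
    integral_norm_sq_tsum_mFourier hF, integral_norm_sq_tsum_mFourier hG]
  ring

end Torus

/-! ### The positive quantization -/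

section Gauss

variable {d : ℕ}

/-- The Gaussian weight `exp(-κ|t|²)` at the lattice point `t`. -/
noncomputable def gaussW (κ : ℝ) (t : Fin d → ℤ) : ℝ := Real.exp (-κ * ∑ i, (t i : ℝ) ^ 2)

lemma gaussW_pos (κ : ℝ) (t : Fin d → ℤ) : 0 < gaussW κ t := Real.exp_pos _

lemma gaussW_le_one {κ : ℝ} (hκ : 0 ≤ κ) (t : Fin d → ℤ) : gaussW κ t ≤ 1 := by
  unfold gaussW
  rw [Real.exp_le_one_iff]
  have : 0 ≤ ∑ i, (t i : ℝ) ^ 2 := Finset.sum_nonneg fun i _ => sq_nonneg _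
  nlinarith

lemma gaussW_sq (κ : ℝ) (t : Fin d → ℤ) : gaussW κ t ^ 2 = gaussW (2 * κ) t := by
  unfold gaussW
  rw [← Real.exp_nat_mul]
  congr 1
  push_cast
  ring

/-- The parallelogram identity for Gaussian weights. -/
lemma gaussW_add_mul_gaussW_sub (κ : ℝ) (t n : Fin d → ℤ) :
    gaussW κ (t + n) * gaussW κ (t - n) = gaussW (2 * κ) t * gaussW (2 * κ) n := by
  unfold gaussW
  rw [← Real.exp_add, ← Real.exp_add]
  congr 1
  simp only [Finset.mul_sum, ← Finset.sum_add_distrib, Pi.add_apply, Pi.sub_apply]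
  refine Finset.sum_congr rfl fun i _ => ?_
  push_cast
  ring

lemma summable_gaussW {κ : ℝ} (hκ : 0 < κ) : Summable (gaussW κ : (Fin d → ℤ) → ℝ) := by
  have hs := summable_one_add_norm_lattice (d := d) one_pos 0
  refine Summable.of_nonneg_of_le (fun t => (gaussW_pos κ t).le) (fun t => ?_)
    (hs.mul_left ((2 * (1 + κ⁻¹)) ^ (d + 1) * ((d + 1).factorial * Real.exp 1)))
  simp only [one_smul, add_zero]
  set r := ‖(intVec t : Rd d)‖ with hr
  have hr0 : 0 ≤ r := norm_nonneg _
  have hrs : ∑ i, (t i : ℝ) ^ 2 = r ^ 2 := by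
    rw [hr, EuclideanSpace.norm_sq_eq]
    simp [intVec]
  have h1 : 1 + r ≤ 2 * (1 + κ⁻¹) * (1 + κ * r ^ 2) := by
    have e : 2 * (1 + κ⁻¹) * (1 + κ * r ^ 2) =
        2 + 2 * r ^ 2 + 2 * κ⁻¹ + 2 * κ * r ^ 2 := by
      field_simp
      ring
    rw [e]
    have : 0 ≤ κ⁻¹ := by positivity
    have : 0 ≤ κ * r ^ 2 := by positivity
    nlinarith [sq_nonneg (r - 1)]
  have h2 : (1 + κ * r ^ 2) ^ (d + 1) ≤ (d + 1).factorial * Real.exp (1 + κ * r ^ 2) := by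
    have := Real.pow_div_factorial_le_exp (1 + κ * r ^ 2) (by positivity) (d + 1)
    rwa [div_le_iff₀ (by positivity), mul_comm (Real.exp _)] at this
  have h3 : (1 + r) ^ (d + 1) ≤
      (2 * (1 + κ⁻¹)) ^ (d + 1) * ((d + 1).factorial * Real.exp (1 + κ * r ^ 2)) := by
    refine (pow_le_pow_left₀ (by positivity) h1 _).trans ?_
    rw [mul_pow]
    gcongr
  unfold gaussW
  rw [hrs, ← div_eq_mul_inv, le_div_iff₀ (by positivity)]
  calc Real.exp (-κ * r ^ 2) * (1 + r) ^ (d + 1)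
      ≤ Real.exp (-κ * r ^ 2) *
        ((2 * (1 + κ⁻¹)) ^ (d + 1) * ((d + 1).factorial * Real.exp (1 + κ * r ^ 2))) := by gcongr
    _ = (2 * (1 + κ⁻¹)) ^ (d + 1) *
        ((d + 1).factorial * (Real.exp (-κ * r ^ 2) * Real.exp (1 + κ * r ^ 2))) := by ring
    _ = _ := by
      rw [← Real.exp_add]
      congr 4
      ring

/-- The total mass of the weights `gaussW (2 * κ)`. -/
noncomputable def gaussZ (d : ℕ) (κ : ℝ) : ℝ := ∑' t : Fin d → ℤ, gaussW (2 * κ) t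

lemma gaussZ_pos (d : ℕ) {κ : ℝ} (hκ : 0 < κ) : 0 < gaussZ d κ :=
  (summable_gaussW (d := d) (by positivity : 0 < 2 * κ)).tsum_pos (fun t => (gaussW_pos _ t).le) 0
    (gaussW_pos _ _)

/-- The multiplier of the positive quantization: the quantization with multiplier
`antiWick κ N` averages the symbol against projections on Gaussian wave packets. It factors into a
Gaussian in `n` and the characteristic function, in `m`, of a Gaussian measure on a lattice. -/
noncomputable def antiWick (κ : ℝ) (N : ℕ) (ζ : (Fin d → ℤ) × (Fin d → ℤ)) : ℂ :=
  gaussW (2 * κ) ζ.2 * ((gaussZ d κ)⁻¹ *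
    ∑' t : Fin d → ℤ, gaussW (2 * κ) t * cis (zdot ζ.1 fun i => -(t i : ℝ) / (2 * N)))

/-- Decomposition of `ℤᵈ` into the cosets of `2ℤᵈ`. -/
def parityEquiv (d : ℕ) : (Fin d → Fin 2) × (Fin d → ℤ) ≃ (Fin d → ℤ) where
  toFun p := liftN p.1 + (2 : ℤ) • p.2
  invFun t := (modN 2 t, fun i => t i / 2)
  left_inv p := by
    refine Prod.ext ?_ ?_
    · have := modN_add_smul (N := 2) (liftN p.1) p.2
      simp only [Nat.cast_ofNat] at this
      simp only [this, modN_liftN]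
    · ext i
      have := (p.1 i).2
      simp only [liftN, Pi.add_apply, Pi.smul_apply, smul_eq_mul]
      omega
  right_inv t := by
    ext i
    simp only [Pi.add_apply, Pi.smul_apply, smul_eq_mul, liftN_modN]
    push_cast
    omega

lemma tsum_parity {E : Type*} [NormedAddCommGroup E] [CompleteSpace E] {u : (Fin d → ℤ) → E}
    (hu : Summable u) :
    ∑' t, u t = ∑ θ : Fin d → Fin 2, ∑' s : Fin d → ℤ, u (liftN θ + (2 : ℤ) • s) := by
  rw [← (parityEquiv d).tsum_eq u]
  refine (((parityEquiv d).summable_iff.mpr hu).tsum_prod).trans ?_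
  rw [tsum_fintype]
  rfl

lemma summable_gaussW_parity {κ : ℝ} (hκ : 0 < κ) (θ : Fin d → Fin 2) :
    Summable fun s : Fin d → ℤ => gaussW κ (liftN θ + (2 : ℤ) • s) := by
  refine (summable_gaussW hκ).comp_injective (i := fun s => liftN θ + (2 : ℤ) • s) fun s t h => ?_
  have h1 : parityEquiv d (θ, s) = parityEquiv d (θ, t) := h
  exact congrArg Prod.snd ((parityEquiv d).injective h1)

variable {N : ℕ} [NeZero N]

/-- The summand of the form of the positive quantization, at the lattice point `t` and at the
point `s` modulo `N` of the discrete torus. -/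
noncomputable def wickTerm (κ : ℝ) (c : (Fin d → ℤ) × (Fin d → ℤ) → ℂ)
    (f g : (Fin d → Fin N) → ℂ) (s t : Fin d → ℤ) (ζ : (Fin d → ℤ) × (Fin d → ℤ)) : ℂ :=
  c ζ * cis (zdot ζ.1 fun i => ((s i : ℝ) - (t i : ℝ) / 2) / N) *
    (f (modN N (s + ζ.2)) * gaussW κ (t + (2 : ℤ) • ζ.2)) * conj (g (modN N s) * gaussW κ t)

lemma norm_wickTerm_le {κ : ℝ} (hκ : 0 < κ) (c : (Fin d → ℤ) × (Fin d → ℤ) → ℂ)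
    (f g : (Fin d → Fin N) → ℂ) (s t : Fin d → ℤ) (ζ : (Fin d → ℤ) × (Fin d → ℤ)) :
    ‖wickTerm κ c f g s t ζ‖ ≤ (∑ k, ‖f k‖) * (∑ k, ‖g k‖) * (‖c ζ‖ * gaussW κ t) := by
  unfold wickTerm
  simp only [norm_mul, norm_cis, mul_one, RCLike.norm_conj, Complex.norm_real, Real.norm_eq_abs,
    abs_of_pos (gaussW_pos _ _)]
  have h1 : ‖f (modN N (s + ζ.2))‖ ≤ ∑ k, ‖f k‖ :=
    Finset.single_le_sum (f := fun l => ‖f l‖) (fun _ _ => norm_nonneg _) (Finset.mem_univ _)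
  have h2 : ‖g (modN N s)‖ ≤ ∑ k, ‖g k‖ :=
    Finset.single_le_sum (f := fun l => ‖g l‖) (fun _ _ => norm_nonneg _) (Finset.mem_univ _)
  have h3 := gaussW_le_one hκ.le (t + (2 : ℤ) • ζ.2)
  have h4 := (gaussW_pos κ t).le
  have h5 := (gaussW_pos κ (t + (2 : ℤ) • ζ.2)).le
  calc ‖c ζ‖ * (‖f (modN N (s + ζ.2))‖ * gaussW κ (t + (2 : ℤ) • ζ.2)) *
        (‖g (modN N s)‖ * gaussW κ t)
      ≤ ‖c ζ‖ * ((∑ k, ‖f k‖) * 1) * ((∑ k, ‖g k‖) * gaussW κ t) := by gcongr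
    _ = _ := by ring

lemma wickTerm_add_smul (κ : ℝ) (c : (Fin d → ℤ) × (Fin d → ℤ) → ℂ)
    (f g : (Fin d → Fin N) → ℂ) (s q t : Fin d → ℤ) (ζ : (Fin d → ℤ) × (Fin d → ℤ)) :
    wickTerm κ c f g (s + (N : ℤ) • q) t ζ = wickTerm κ c f g s t ζ := by
  have hN : (N : ℝ) ≠ 0 := by exact_mod_cast NeZero.ne N
  unfold wickTerm
  have : (fun i => (((s + (N : ℤ) • q) i : ℝ) - (t i : ℝ) / 2) / N) =
      (fun i => ((s i : ℝ) - (t i : ℝ) / 2) / N) + fun i => (q i : ℝ) := by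
    ext i
    simp
    field_simp
    ring
  rw [this, zdot_add, cis_add, cis_zdot_intCast, mul_one, add_right_comm, modN_add_smul,
    modN_add_smul]

/-- Unfolding of the positive quantization into wave packets. -/
lemma gaussZ_mul_weylForm_antiWick {κ : ℝ} (hκ : 0 < κ) {c : (Fin d → ℤ) × (Fin d → ℤ) → ℂ}
    (hc : Summable c) (f g : (Fin d → Fin N) → ℂ) :
    gaussZ d κ * weylForm N (fun ζ => antiWick κ N ζ * c ζ) f g =
      ∑ k : Fin d → Fin N, ∑' t, ∑' ζ, wickTerm κ c f g (liftN k) t ζ := by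
  have hN : (N : ℝ) ≠ 0 := by exact_mod_cast NeZero.ne N
  unfold weylForm
  rw [Finset.mul_sum]
  refine Finset.sum_congr rfl fun k _ => ?_
  have hsum : Summable (Function.uncurry fun t ζ => wickTerm κ c f g (liftN k) t ζ) := by
    have h1 : Summable fun i : (Fin d → ℤ) × ((Fin d → ℤ) × (Fin d → ℤ)) => gaussW κ i.1 * ‖c i.2‖ :=
      (summable_gaussW hκ).mul_of_nonneg hc.norm (fun t => (gaussW_pos κ t).le)
        (fun ζ => norm_nonneg _)
    refine Summable.of_norm_bounded (h1.mul_left ((∑ k, ‖f k‖) * (∑ k, ‖g k‖))) fun i => ?_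
    refine (norm_wickTerm_le hκ c f g (liftN k) i.1 i.2).trans (le_of_eq ?_)
    ring
  rw [← hsum.tsum_comm, ← tsum_mul_left, ← tsum_mul_left]
  refine tsum_congr fun ζ => ?_
  have hZ : (gaussZ d κ : ℂ) ≠ 0 := by exact_mod_cast (gaussZ_pos d hκ).ne'
  -- the substitution `t ↦ t + n` symmetrises the product of the two wave packets
  rw [← (Equiv.subRight ζ.2).tsum_eq (fun t => wickTerm κ c f g (liftN k) t ζ)]
  have h2 : ∀ t, wickTerm κ c f g (liftN k) (Equiv.subRight ζ.2 t) ζ =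
      (conj (g k) * (c ζ * weylPhase N ζ.1 ζ.2 (liftN k) * f (modN N (liftN k + ζ.2))) *
        gaussW (2 * κ) ζ.2) *
      (gaussW (2 * κ) t * cis (zdot ζ.1 fun i => -(t i : ℝ) / (2 * N))) := by
    intro t
    unfold wickTerm weylPhase
    have e1 : (Equiv.subRight ζ.2 t) + (2 : ℤ) • ζ.2 = t + ζ.2 := by
      simp only [Equiv.subRight_apply]
      rw [two_smul]
      abel
    have e2 : (fun i => ((liftN k i : ℝ) - ((Equiv.subRight ζ.2 t) i : ℝ) / 2) / (N : ℝ)) =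
        (fun i => ((liftN k i : ℝ) + (ζ.2 i : ℝ) / 2) / N) + fun i => -(t i : ℝ) / (2 * N) := by
      ext i
      simp only [Equiv.subRight_apply, Pi.add_apply, Pi.sub_apply]
      push_cast
      field_simp
      ring
    have e3 := gaussW_add_mul_gaussW_sub κ t ζ.2
    rw [e1, e2, zdot_add, cis_add, modN_liftN, map_mul, Complex.conj_ofReal]
    simp only [Equiv.subRight_apply]
    have e4 : (gaussW κ (t + ζ.2) : ℂ) * gaussW κ (t - ζ.2) =
      gaussW (2 * κ) t * gaussW (2 * κ) ζ.2 := by exact_mod_cast e3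
    linear_combination (c ζ * cis (zdot ζ.1 fun i => ((liftN k i : ℝ) + (ζ.2 i : ℝ) / 2) / N) *
      cis (zdot ζ.1 fun i => -(t i : ℝ) / (2 * N)) * f (modN N (liftN k + ζ.2)) * conj (g k)) * e4
  simp_rw [h2]
  rw [tsum_mul_left]
  unfold antiWick
  rw [Complex.ofReal_inv]
  field_simp

/-- The sum of the wave packet terms along one orbit of the diagonal translations is a
convolution form on `ℤᵈ`. -/
lemma norm_tsum_wickTerm_le {κ : ℝ} (hκ : 0 < κ) {c : (Fin d → ℤ) × (Fin d → ℤ) → ℂ}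
    (hc : Summable c) {S : ℝ} (hS : ∀ a b, ‖trigSum c a b‖ ≤ S) (f g : (Fin d → Fin N) → ℂ)
    (k : Fin d → ℤ) (θ : Fin d → Fin 2) :
    ‖∑' s, ∑' ζ, wickTerm κ c f g (k + s) (liftN θ + (2 : ℤ) • s) ζ‖ ≤
      S * ((∑' s, ‖f (modN N (k + s))‖ ^ 2 * gaussW (2 * κ) (liftN θ + (2 : ℤ) • s)) +
        ∑' s, ‖g (modN N (k + s))‖ ^ 2 * gaussW (2 * κ) (liftN θ + (2 : ℤ) • s)) / 2 := by
  have hN : (N : ℝ) ≠ 0 := by exact_mod_cast NeZero.ne N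
  let a : Fin d → ℝ := fun i => ((k i : ℝ) - (liftN θ i : ℝ) / 2) / N
  let q : (Fin d → ℤ) → ℂ := fun n => ∑' m, c (m, n) * cis (zdot m a)
  let W : ((Fin d → Fin N) → ℂ) → (Fin d → ℤ) → ℂ :=
    fun f s => f (modN N (k + s)) * gaussW κ (liftN θ + (2 : ℤ) • s)
  have hcs : Summable fun i : (Fin d → ℤ) × (Fin d → ℤ) => c i.swap :=
    (Equiv.prodComm _ _).summable_iff.mpr hc
  have hca : Summable fun i : (Fin d → ℤ) × (Fin d → ℤ) => c (i.2, i.1) * cis (zdot i.2 a) :=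
    summable_mul_of_norm_le hcs (K := 1) fun i => (norm_cis _).le
  have hq : Summable q := hca.prod
  have hW : ∀ f, Summable (W f) := by
    intro f
    refine Summable.of_norm_bounded ((summable_gaussW_parity hκ θ).mul_left (∑ k, ‖f k‖)) fun s => ?_
    simp only [W, norm_mul, Complex.norm_real, Real.norm_eq_abs, abs_of_pos (gaussW_pos _ _)]
    refine mul_le_mul_of_nonneg_right ?_ (gaussW_pos _ _).le
    exact Finset.single_le_sum (f := fun l => ‖f l‖) (fun _ _ => norm_nonneg _) (Finset.mem_univ _)
  have hqS : ∀ b : Fin d → ℝ, ‖∑' n, q n * cis (zdot n b)‖ ≤ S := by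
    intro b
    refine le_trans (le_of_eq ?_) (hS a b)
    congr 1
    unfold trigSum
    rw [← (Equiv.prodComm _ _).tsum_eq, Summable.tsum_prod]
    · refine tsum_congr fun n => ?_
      simp only [q]
      rw [← tsum_mul_right]
      refine tsum_congr fun m => ?_
      simp only [Equiv.prodComm_apply, Prod.swap_prod_mk]
      rw [cis_add, mul_assoc]
    · exact summable_mul_of_norm_le hcs (K := 1) fun i => (norm_cis _).le
  have key := norm_tsum_convolution_le hq (hW f) (hW g) hqS
  have hterm : ∀ s ζ, wickTerm κ c f g (k + s) (liftN θ + (2 : ℤ) • s) ζ =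
      c ζ * cis (zdot ζ.1 a) * W f (s + ζ.2) * conj (W g s) := by
    intro s ζ
    have e : (fun i => (((k + s) i : ℝ) - ((liftN θ + (2 : ℤ) • s) i : ℝ) / 2) / (N : ℝ)) = a := by
      ext i
      simp only [a, Pi.add_apply, Pi.smul_apply, smul_eq_mul]
      push_cast
      ring
    unfold wickTerm
    rw [e]
    simp only [W]
    rw [add_assoc k, add_assoc (liftN θ), ← smul_add]
  have hG : Summable fun s => conj (W g s) := by
    rw [← summable_norm_iff]
    simpa only [RCLike.norm_conj] using (hW g).norm
  have hWb : ∀ s, ‖W f s‖ ≤ ∑' s, ‖W f s‖ := fun s =>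
    (hW f).norm.le_tsum s fun _ _ => norm_nonneg _
  have hsum3 : Summable fun i : ((Fin d → ℤ) × (Fin d → ℤ)) × (Fin d → ℤ) =>
      c (i.1.2, i.1.1) * cis (zdot i.1.2 a) * W f (i.2 + i.1.1) * conj (W g i.2) := by
    have h1 : Summable fun i : ((Fin d → ℤ) × (Fin d → ℤ)) × (Fin d → ℤ) =>
        (c (i.1.2, i.1.1) * cis (zdot i.1.2 a)) * conj (W g i.2) :=
      summable_mul_of_summable_norm
        (f := fun i : (Fin d → ℤ) × (Fin d → ℤ) => c (i.2, i.1) * cis (zdot i.2 a))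
        (g := fun s => conj (W g s)) hca.norm hG.norm
    refine (summable_mul_of_norm_le h1 (u := fun i => W f (i.2 + i.1.1)) fun i => hWb _).congr
      fun i => ?_
    ring
  have e1 : ∑' i : (Fin d → ℤ) × (Fin d → ℤ), q i.1 * W f (i.2 + i.1) * conj (W g i.2) =
      ∑' s, ∑' ζ, wickTerm κ c f g (k + s) (liftN θ + (2 : ℤ) • s) ζ := by
    simp_rw [hterm]
    have hsum2 : Summable fun i : (Fin d → ℤ) × (Fin d → ℤ) =>
        q i.1 * W f (i.2 + i.1) * conj (W g i.2) := by
      have h1 : Summable fun i : (Fin d → ℤ) × (Fin d → ℤ) => q i.1 * conj (W g i.2) :=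
        summable_mul_of_summable_norm (f := q) (g := fun s => conj (W g s)) hq.norm hG.norm
      refine (summable_mul_of_norm_le h1 (u := fun i => W f (i.2 + i.1)) fun i => hWb _).congr
        fun i => ?_
      ring
    rw [((Equiv.prodComm _ _).tsum_eq
      (fun i : (Fin d → ℤ) × (Fin d → ℤ) => q i.1 * W f (i.2 + i.1) * conj (W g i.2))).symm]
    refine (((Equiv.prodComm _ _).summable_iff.mpr hsum2).tsum_prod).trans ?_
    refine tsum_congr fun s => ?_
    have h4 : Summable fun i : (Fin d → ℤ) × (Fin d → ℤ) =>
        c (i.2, i.1) * cis (zdot i.2 a) * W f (s + i.1) * conj (W g s) := by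
      have := hsum3.prod_symm.prod_factor s
      exact this
    rw [← (Equiv.prodComm _ _).tsum_eq, Summable.tsum_prod]
    · refine tsum_congr fun n => ?_
      simp only [Function.comp_apply, Equiv.prodComm_apply, Prod.swap_prod_mk, q]
      rw [← tsum_mul_right, ← tsum_mul_right]
    · exact h4
  have hnorm : ∀ (f : (Fin d → Fin N) → ℂ) s,
      ‖W f s‖ ^ 2 = ‖f (modN N (k + s))‖ ^ 2 * gaussW (2 * κ) (liftN θ + (2 : ℤ) • s) := by
    intro f s
    simp only [W, norm_mul, Complex.norm_real, Real.norm_eq_abs, abs_of_pos (gaussW_pos _ _)]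
    rw [mul_pow, gaussW_sq]
  simp_rw [hnorm] at key
  rw [← e1]
  exact key

/-- The positive quantization is bounded by the supremum of the symbol. -/
theorem formBound_antiWick {κ : ℝ} (hκ : 0 < κ) {c : (Fin d → ℤ) × (Fin d → ℤ) → ℂ}
    (hc : Summable c) {S : ℝ} (hS : ∀ a b, ‖trigSum c a b‖ ≤ S) :
    FormBound N (fun ζ => antiWick κ N ζ * c ζ) S := by
  intro f g
  have hZ := gaussZ_pos d hκ
  have hsumt : ∀ k : Fin d → ℤ, Summable fun i : (Fin d → ℤ) × ((Fin d → ℤ) × (Fin d → ℤ)) =>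
      wickTerm κ c f g k i.1 i.2 := by
    intro k
    have h1 : Summable fun i : (Fin d → ℤ) × ((Fin d → ℤ) × (Fin d → ℤ)) => gaussW κ i.1 * ‖c i.2‖ :=
      (summable_gaussW hκ).mul_of_nonneg hc.norm (fun t => (gaussW_pos κ t).le)
        (fun ζ => norm_nonneg _)
    refine Summable.of_norm_bounded (h1.mul_left ((∑ k, ‖f k‖) * (∑ k, ‖g k‖))) fun i => ?_
    refine (norm_wickTerm_le hκ c f g k i.1 i.2).trans (le_of_eq ?_)
    ring
  let E : (Fin d → ℤ) → (Fin d → ℤ) → ℂ := fun s t => ∑' ζ, wickTerm κ c f g s t ζ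
  have hE : ∀ k, Summable (E k) := fun k => (hsumt k).prod
  have hEper : ∀ t s q, E (s + (N : ℤ) • q) t = E s t := fun t s q =>
    tsum_congr fun ζ => wickTerm_add_smul κ c f g s q t ζ
  have hinj : ∀ θ : Fin d → Fin 2, Function.Injective fun s : Fin d → ℤ =>
      liftN θ + (2 : ℤ) • s := by
    intro θ s t h
    have h1 : parityEquiv d (θ, s) = parityEquiv d (θ, t) := h
    exact congrArg Prod.snd ((parityEquiv d).injective h1)
  have hEs : ∀ (k : Fin d → ℤ) (θ : Fin d → Fin 2),
      Summable fun s => E (k + s) (liftN θ + (2 : ℤ) • s) := by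
    intro k θ
    refine Summable.of_norm_bounded ((summable_gaussW_parity hκ θ).mul_left
      ((∑ k, ‖f k‖) * (∑ k, ‖g k‖) * ∑' ζ, ‖c ζ‖)) fun s => ?_
    refine (tsum_of_norm_bounded ((hc.norm.mul_right (gaussW κ (liftN θ + (2 : ℤ) • s))).mul_left
      ((∑ k, ‖f k‖) * (∑ k, ‖g k‖))).hasSum fun ζ => norm_wickTerm_le hκ c f g _ _ ζ).trans
      (le_of_eq ?_)
    rw [tsum_mul_left, tsum_mul_right]
    ring
  have e1 : gaussZ d κ * weylForm N (fun ζ => antiWick κ N ζ * c ζ) f g =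
      ∑ θ : Fin d → Fin 2, ∑ k : Fin d → Fin N,
        ∑' s, E (liftN k + s) (liftN θ + (2 : ℤ) • s) := by
    rw [gaussZ_mul_weylForm_antiWick hκ hc]
    have h1 : ∀ k : Fin d → Fin N, ∑' t, ∑' ζ, wickTerm κ c f g (liftN k) t ζ =
        ∑ θ : Fin d → Fin 2, ∑' s : Fin d → ℤ, E (liftN k) (liftN θ + (2 : ℤ) • s) :=
      fun k => tsum_parity (hE (liftN k))
    simp_rw [h1]
    rw [Finset.sum_comm]
    refine Finset.sum_congr rfl fun θ _ => ?_
    have hcomp : ∀ k, Summable fun s => E k (liftN θ + (2 : ℤ) • s) := fun k =>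
      (hE k).comp_injective (hinj θ)
    rw [← Summable.tsum_finsetSum fun k _ => hEs (liftN k) θ,
      ← Summable.tsum_finsetSum fun k _ => hcomp (liftN k)]
    exact tsum_congr fun s => (sum_liftN_add (N := N) (fun k => E k (liftN θ + (2 : ℤ) • s))
      (fun k q => hEper _ k q) s).symm
  have hgp : ∀ θ : Fin d → Fin 2,
      Summable fun s : Fin d → ℤ => gaussW (2 * κ) (liftN θ + (2 : ℤ) • s) :=
    fun θ => summable_gaussW_parity (by positivity) θ
  have e2 : ∀ f : (Fin d → Fin N) → ℂ, ∑ θ : Fin d → Fin 2, ∑ k : Fin d → Fin N,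
      ∑' s, ‖f (modN N (liftN k + s))‖ ^ 2 * gaussW (2 * κ) (liftN θ + (2 : ℤ) • s) =
      (∑ k, ‖f k‖ ^ 2) * gaussZ d κ := by
    intro f
    have h1 : ∀ θ : Fin d → Fin 2, ∑ k : Fin d → Fin N,
        ∑' s, ‖f (modN N (liftN k + s))‖ ^ 2 * gaussW (2 * κ) (liftN θ + (2 : ℤ) • s) =
        (∑ k, ‖f k‖ ^ 2) * ∑' s, gaussW (2 * κ) (liftN θ + (2 : ℤ) • s) := by
      intro θ
      rw [← Summable.tsum_finsetSum, ← tsum_mul_left]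
      · refine tsum_congr fun s => ?_
        rw [← Finset.sum_mul]
        congr 1
        have := sum_liftN_add (N := N) (fun s => ‖f (modN N s)‖ ^ 2)
          (fun s q => by rw [modN_add_smul]) s
        simpa only [modN_liftN] using this
      · intro k _
        refine Summable.of_nonneg_of_le
          (fun s => mul_nonneg (sq_nonneg _) (gaussW_pos _ _).le) (fun s => ?_)
          ((hgp θ).mul_left (∑ k, ‖f k‖ ^ 2))
        refine mul_le_mul_of_nonneg_right ?_ (gaussW_pos _ _).le
        exact Finset.single_le_sum (f := fun l => ‖f l‖ ^ 2) (fun _ _ => sq_nonneg _)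
          (Finset.mem_univ _)
    simp_rw [h1]
    rw [← Finset.mul_sum]
    unfold gaussZ
    rw [tsum_parity (summable_gaussW (by positivity : 0 < 2 * κ))]
  have e3 : ‖(gaussZ d κ : ℂ) * weylForm N (fun ζ => antiWick κ N ζ * c ζ) f g‖ ≤
      S * ((∑ k, ‖f k‖ ^ 2) + ∑ k, ‖g k‖ ^ 2) / 2 * gaussZ d κ := by
    rw [e1]
    have h1 := norm_sum_le_of_le Finset.univ (fun (θ : Fin d → Fin 2) _ =>
      norm_sum_le_of_le Finset.univ (fun (k : Fin d → Fin N) _ =>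
        norm_tsum_wickTerm_le hκ hc hS f g (liftN k) θ))
    refine h1.trans (le_of_eq ?_)
    simp_rw [← Finset.sum_div, ← Finset.mul_sum, Finset.sum_add_distrib]
    rw [e2 f, e2 g]
    ring
  rw [norm_mul, Complex.norm_real, Real.norm_eq_abs, abs_of_pos hZ, mul_comm] at e3
  exact le_of_mul_le_mul_right e3 hZ

end Gauss

section Moments

variable {d : ℕ}

lemma four_mul_round_sq_le (s : ℤ) {θ : ℕ} (hθ : θ < 2) :
    4 * (s + if s < 0 then (θ : ℤ) else 0) ^ 2 ≤ ((θ : ℤ) + 2 * s) ^ 2 := by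
  obtain rfl | rfl : θ = 0 ∨ θ = 1 := by omega
  · split_ifs <;> simp <;> nlinarith
  · split_ifs with h <;> push_cast <;> nlinarith

/-- Doubling of the scale of a lattice Gaussian sum costs a dimensional factor: a point of
`2ℤᵈ + θ`, divided by two, can be rounded to a lattice point without increasing its norm. -/
lemma tsum_gaussW_half_le {κ : ℝ} (hκ : 0 < κ) :
    ∑' t : Fin d → ℤ, gaussW (κ / 2) t ≤ 2 ^ d * (2 ^ d * gaussZ d κ) := by
  have h2 : 0 < 2 * κ := by positivity
  have h3 : 0 < κ / 2 := by positivity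
  rw [tsum_parity (summable_gaussW h3)]
  have hsh : ∀ σ : Fin d → Fin 2, Summable fun s : Fin d → ℤ => gaussW (2 * κ) (s + liftN σ) :=
    fun σ => (summable_gaussW h2).comp_injective (add_left_injective (liftN σ))
  have hpt : ∀ (θ : Fin d → Fin 2) (s : Fin d → ℤ), gaussW (κ / 2) (liftN θ + (2 : ℤ) • s) ≤
      ∑ σ : Fin d → Fin 2, gaussW (2 * κ) (s + liftN σ) := by
    intro θ s
    let σ : Fin d → Fin 2 := fun i => if s i < 0 then θ i else 0
    refine le_trans ?_ (Finset.single_le_sum (f := fun σ => gaussW (2 * κ) (s + liftN σ))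
      (fun σ _ => (gaussW_pos _ _).le) (Finset.mem_univ σ))
    unfold gaussW
    rw [Real.exp_le_exp, Finset.mul_sum, Finset.mul_sum]
    refine Finset.sum_le_sum fun i _ => ?_
    have e1 : (s + liftN σ) i = s i + if s i < 0 then ((θ i : ℕ) : ℤ) else 0 := by
      simp only [Pi.add_apply, liftN, σ]
      split_ifs <;> rfl
    have e2 : (liftN θ + (2 : ℤ) • s) i = ((θ i : ℕ) : ℤ) + 2 * s i := by
      simp [liftN]
    have key := four_mul_round_sq_le (s i) (θ i).2
    rw [← e1, ← e2] at key
    have key' : 4 * (((s + liftN σ) i : ℤ) : ℝ) ^ 2 ≤ (((liftN θ + (2 : ℤ) • s) i : ℤ) : ℝ) ^ 2 := by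
      exact_mod_cast key
    have := mul_le_mul_of_nonneg_left key' hκ.le
    linarith
  calc ∑ θ : Fin d → Fin 2, ∑' s : Fin d → ℤ, gaussW (κ / 2) (liftN θ + (2 : ℤ) • s)
      ≤ ∑ _θ : Fin d → Fin 2, ∑ σ : Fin d → Fin 2, ∑' s : Fin d → ℤ,
          gaussW (2 * κ) (s + liftN σ) := by
        refine Finset.sum_le_sum fun θ _ => ?_
        rw [← Summable.tsum_finsetSum fun σ _ => hsh σ]
        exact (summable_gaussW_parity h3 θ).tsum_le_tsum (hpt θ)
          (summable_sum fun σ _ => hsh σ)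
    _ = ∑ _θ : Fin d → Fin 2, ∑ _σ : Fin d → Fin 2, gaussZ d κ := by
        refine Finset.sum_congr rfl fun θ _ => Finset.sum_congr rfl fun σ _ => ?_
        have := (Equiv.addRight (liftN σ)).tsum_eq fun s => gaussW (2 * κ) s
        simp only [Equiv.coe_addRight] at this
        exact this
    _ = _ := by simp

lemma norm_mul_gaussW_le {κ : ℝ} (hκ : 0 < κ) (t : Fin d → ℤ) :
    ‖t‖ * gaussW (2 * κ) t ≤ (√κ)⁻¹ * gaussW (κ / 2) t := by
  have hs : 0 < √κ := Real.sqrt_pos.2 hκ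
  have hR : ‖t‖ ^ 2 ≤ ∑ i, (t i : ℝ) ^ 2 := by
    have h0 : 0 ≤ ∑ i, (t i : ℝ) ^ 2 := Finset.sum_nonneg fun i _ => sq_nonneg _
    have : ‖t‖ ≤ √(∑ i, (t i : ℝ) ^ 2) := by
      rw [pi_norm_le_iff_of_nonneg (Real.sqrt_nonneg _)]
      intro i
      rw [Int.norm_eq_abs, ← Real.sqrt_sq_eq_abs]
      exact Real.sqrt_le_sqrt (Finset.single_le_sum (f := fun i => (t i : ℝ) ^ 2)
        (fun _ _ => sq_nonneg _) (Finset.mem_univ i))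
    calc ‖t‖ ^ 2 ≤ √(∑ i, (t i : ℝ) ^ 2) ^ 2 := by gcongr
      _ = _ := Real.sq_sqrt h0
  unfold gaussW
  set R := ∑ i, (t i : ℝ) ^ 2 with hRdef
  have h1 : √κ * ‖t‖ ≤ Real.exp (3 / 2 * κ * R) := by
    have h2 := Real.add_one_le_exp (3 / 2 * κ * R)
    have h3 : (√κ * ‖t‖) ^ 2 ≤ κ * R := by
      rw [mul_pow, Real.sq_sqrt hκ.le]
      gcongr
    nlinarith [sq_nonneg (√κ * ‖t‖ - 1)]
  have e : Real.exp (-(κ / 2) * R) = Real.exp (3 / 2 * κ * R) * Real.exp (-(2 * κ) * R) := by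
    rw [← Real.exp_add]
    congr 1
    ring
  rw [e, ← mul_assoc]
  gcongr
  rw [inv_mul_eq_div, le_div_iff₀ hs, mul_comm]
  exact h1

lemma summable_norm_mul_gaussW {κ : ℝ} (hκ : 0 < κ) :
    Summable fun t : Fin d → ℤ => ‖t‖ * gaussW (2 * κ) t :=
  Summable.of_nonneg_of_le (fun t => mul_nonneg (norm_nonneg _) (gaussW_pos _ _).le)
    (norm_mul_gaussW_le hκ) ((summable_gaussW (by positivity : 0 < κ / 2)).mul_left _)

lemma tsum_norm_mul_gaussW_le {κ : ℝ} (hκ : 0 < κ) :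
    ∑' t : Fin d → ℤ, ‖t‖ * gaussW (2 * κ) t ≤ 4 ^ d * (√κ)⁻¹ * gaussZ d κ := by
  refine ((summable_norm_mul_gaussW hκ).tsum_le_tsum (norm_mul_gaussW_le hκ)
    ((summable_gaussW (by positivity : 0 < κ / 2)).mul_left _)).trans ?_
  rw [tsum_mul_left]
  have h := tsum_gaussW_half_le (d := d) hκ
  have e : (4 : ℝ) ^ d = 2 ^ d * 2 ^ d := by
    rw [← mul_pow]
    norm_num
  calc (√κ)⁻¹ * ∑' t : Fin d → ℤ, gaussW (κ / 2) t
      ≤ (√κ)⁻¹ * (2 ^ d * (2 ^ d * gaussZ d κ)) := by gcongr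
    _ = _ := by
      rw [e]
      ring

/-- The lattice part of the averaging: a Gaussian probability measure on `(2N)⁻¹ℤᵈ`. -/
lemma exists_measure_lattice {κ : ℝ} (hκ : 0 < κ) {N : ℕ} (hN : 1 ≤ N) :
    ∃ μ : Measure (Fin d → ℝ), IsProbabilityMeasure μ ∧ Integrable (fun a => ‖a‖) μ ∧
      ∫ a, ‖a‖ ∂μ ≤ 4 ^ d * (N * √κ)⁻¹ ∧
      ∀ m : Fin d → ℤ, ∫ a, cis (zdot m a) ∂μ = ((gaussZ d κ)⁻¹ : ℝ) *
        ∑' t : Fin d → ℤ, gaussW (2 * κ) t * cis (zdot m fun i => -(t i : ℝ) / (2 * N)) := by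
  have hZ := gaussZ_pos d hκ
  have hN' : (0 : ℝ) < N := by exact_mod_cast hN
  let x : (Fin d → ℤ) → (Fin d → ℝ) := fun t i => -(t i : ℝ) / (2 * N)
  let w : (Fin d → ℤ) → ℝ := fun t => (gaussZ d κ)⁻¹ * gaussW (2 * κ) t
  have hw0 : ∀ t, 0 ≤ w t := fun t => mul_nonneg (inv_pos.2 hZ).le (gaussW_pos _ _).le
  have hws : Summable w := (summable_gaussW (by positivity : 0 < 2 * κ)).mul_left _
  have hw1 : ∑' t, w t = 1 := by
    simp only [w]
    rw [tsum_mul_left]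
    exact inv_mul_cancel₀ hZ.ne'
  let μ : Measure (Fin d → ℝ) :=
    Measure.sum fun t => ENNReal.ofReal (w t) • Measure.dirac (x t)
  have htr : ∀ t, (ENNReal.ofReal (w t)).toReal = w t := fun t => ENNReal.toReal_ofReal (hw0 t)
  have hx : ∀ t, ‖x t‖ ≤ ‖t‖ * (N : ℝ)⁻¹ := by
    intro t
    rw [pi_norm_le_iff_of_nonneg (by positivity)]
    intro i
    have := norm_le_pi_norm t i
    rw [Int.norm_eq_abs] at this
    simp only [x]
    rw [Real.norm_eq_abs, abs_div, abs_neg, abs_of_pos (by positivity : (0 : ℝ) < 2 * N),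
      div_eq_mul_inv]
    have h3 : (2 * (N : ℝ))⁻¹ ≤ (N : ℝ)⁻¹ := by
      gcongr
      linarith
    gcongr
  have hbd : ∀ t, w t * ‖x t‖ ≤ (gaussZ d κ)⁻¹ * (N : ℝ)⁻¹ * (‖t‖ * gaussW (2 * κ) t) := by
    intro t
    calc w t * ‖x t‖ ≤ w t * (‖t‖ * (N : ℝ)⁻¹) := mul_le_mul_of_nonneg_left (hx t) (hw0 t)
      _ = _ := by
        simp only [w]
        ring
  have hsx : Summable fun t => w t * ‖x t‖ :=
    Summable.of_nonneg_of_le (fun t => mul_nonneg (hw0 t) (norm_nonneg _)) hbd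
      ((summable_norm_mul_gaussW hκ).mul_left _)
  refine ⟨μ, ⟨?_⟩, ?_, ?_, ?_⟩
  · simp only [μ]
    rw [Measure.sum_apply _ MeasurableSet.univ]
    simp only [Measure.smul_apply, measure_univ, smul_eq_mul, mul_one]
    rw [← ENNReal.ofReal_tsum_of_nonneg hw0 hws, hw1, ENNReal.ofReal_one]
  · refine (integrable_sum_dirac_iff fun t => ENNReal.ofReal_ne_top).mpr ?_
    simpa only [htr, norm_norm] using hsx
  · rw [integral_sum_dirac fun t => ENNReal.ofReal_ne_top]
    simp only [htr, smul_eq_mul]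
    refine (hsx.tsum_le_tsum hbd ((summable_norm_mul_gaussW hκ).mul_left _)).trans ?_
    rw [tsum_mul_left]
    calc (gaussZ d κ)⁻¹ * (N : ℝ)⁻¹ * ∑' t : Fin d → ℤ, ‖t‖ * gaussW (2 * κ) t
        ≤ (gaussZ d κ)⁻¹ * (N : ℝ)⁻¹ * (4 ^ d * (√κ)⁻¹ * gaussZ d κ) := by
          gcongr
          exact tsum_norm_mul_gaussW_le hκ
      _ = _ := by
        field_simp
  · intro m
    rw [integral_sum_dirac fun t => ENNReal.ofReal_ne_top, ← tsum_mul_left]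
    refine tsum_congr fun t => ?_
    simp only [htr, w, x, Complex.real_smul]
    push_cast
    ring

lemma integral_abs_gaussianReal_le (v : NNReal) :
    Integrable (fun x : ℝ => |x|) (ProbabilityTheory.gaussianReal 0 v) ∧
      ∫ x, |x| ∂ProbabilityTheory.gaussianReal 0 v ≤ √v := by
  have hm : MemLp id 2 (ProbabilityTheory.gaussianReal 0 v) :=
    ProbabilityTheory.memLp_id_gaussianReal 2
  have hi : Integrable (fun x : ℝ => |x|) (ProbabilityTheory.gaussianReal 0 v) :=
    (hm.integrable (by norm_num)).abs
  refine ⟨hi, ?_⟩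
  have hsq : Integrable (fun x : ℝ => x ^ 2) (ProbabilityTheory.gaussianReal 0 v) :=
    hm.integrable_sq
  have hvar : ∫ x, x ^ 2 ∂ProbabilityTheory.gaussianReal 0 v = v := by
    have := ProbabilityTheory.variance_fun_id_gaussianReal (μ := 0) (v := v)
    rw [ProbabilityTheory.variance_eq_integral measurable_id'.aemeasurable] at this
    simpa [ProbabilityTheory.integral_id_gaussianReal] using this
  rcases eq_or_ne v 0 with rfl | hv
  · simp
  · have hr : 0 < √(v : ℝ) := Real.sqrt_pos.2 (by exact_mod_cast pos_iff_ne_zero.mpr hv)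
    have h1 : ∀ x : ℝ, |x| ≤ √v / 2 + (2 * √v)⁻¹ * x ^ 2 := by
      intro x
      have : 0 ≤ (2 * √(v : ℝ))⁻¹ * (|x| - √v) ^ 2 := by positivity
      have e : (2 * √(v : ℝ))⁻¹ * (|x| - √v) ^ 2 = √v / 2 + (2 * √v)⁻¹ * |x| ^ 2 - |x| := by
        field_simp
        ring
      rw [e, sq_abs] at this
      linarith
    calc ∫ x, |x| ∂ProbabilityTheory.gaussianReal 0 v
        ≤ ∫ x, (√v / 2 + (2 * √v)⁻¹ * x ^ 2) ∂ProbabilityTheory.gaussianReal 0 v :=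
          integral_mono hi ((integrable_const _).add (hsq.const_mul _)) h1
      _ = √v / 2 + (2 * √v)⁻¹ * v := by
        rw [integral_add (integrable_const _) (hsq.const_mul _), integral_const_mul, hvar]
        simp
      _ = √v := by
        have : (v : ℝ) = √v * √v := (Real.mul_self_sqrt v.2).symm
        field_simp
        have := Real.sq_sqrt (NNReal.coe_nonneg v)
        linarith

/-- The continuous part of the averaging: a Gaussian probability measure on `ℝᵈ`. -/
lemma exists_measure_gaussian {κ : ℝ} (hκ : 0 < κ) :
    ∃ μ : Measure (Fin d → ℝ), IsProbabilityMeasure μ ∧ Integrable (fun a => ‖a‖) μ ∧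
      ∫ a, ‖a‖ ∂μ ≤ d * √κ ∧
      ∀ n : Fin d → ℤ, ∫ a, cis (zdot n a) ∂μ = gaussW (2 * κ) n := by
  -- the variance for which the characteristic function at `2πn` is `exp(-2κn²)`
  let v : NNReal := ⟨κ / Real.pi ^ 2, by positivity⟩
  have hv : (v : ℝ) = κ / Real.pi ^ 2 := rfl
  let μ : Measure (Fin d → ℝ) := Measure.pi fun _ => ProbabilityTheory.gaussianReal 0 v
  have hle : ∀ a : Fin d → ℝ, ‖a‖ ≤ ∑ i, |a i| := fun a => by
    rw [pi_norm_le_iff_of_nonneg (Finset.sum_nonneg fun i _ => abs_nonneg _)]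
    intro i
    exact Finset.single_le_sum (f := fun i => |a i|) (fun _ _ => abs_nonneg _) (Finset.mem_univ i)
  have h1 := integral_abs_gaussianReal_le v
  have hsi : ∀ i : Fin d, Integrable (fun a : Fin d → ℝ => |a i|) μ := fun i =>
    integrable_comp_eval (μ := fun _ : Fin d => ProbabilityTheory.gaussianReal 0 v) (i := i)
      (f := fun x : ℝ => |x|) h1.1
  have hsum : Integrable (fun a : Fin d → ℝ => ∑ i, |a i|) μ :=
    integrable_finsetSum _ fun i _ => hsi i
  have hint : Integrable (fun a : Fin d → ℝ => ‖a‖) μ :=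
    hsum.mono' (by fun_prop) (Filter.Eventually.of_forall fun a => by
      rw [norm_norm]
      exact hle a)
  refine ⟨μ, inferInstance, hint, ?_, ?_⟩
  · calc ∫ a, ‖a‖ ∂μ ≤ ∫ a, ∑ i, |a i| ∂μ := integral_mono hint hsum hle
      _ = ∑ _i : Fin d, ∫ x, |x| ∂ProbabilityTheory.gaussianReal 0 v := by
        rw [integral_finsetSum _ fun i _ => hsi i]
        refine Finset.sum_congr rfl fun i _ => ?_
        exact integral_comp_eval (μ := fun _ : Fin d => ProbabilityTheory.gaussianReal 0 v)
          (i := i) (f := fun x : ℝ => |x|) h1.1.1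
      _ ≤ ∑ _i : Fin d, √κ := by
        refine Finset.sum_le_sum fun i _ => h1.2.trans (Real.sqrt_le_sqrt ?_)
        rw [hv]
        exact div_le_self hκ.le (by nlinarith [Real.pi_gt_three])
      _ = d * √κ := by simp
  · intro n
    have e : ∀ a : Fin d → ℝ, cis (zdot n a) =
        ∏ i, Complex.exp ((2 * Real.pi * n i : ℝ) * a i * Complex.I) := by
      intro a
      unfold cis zdot
      rw [← Complex.exp_sum]
      congr 1
      push_cast
      rw [Finset.mul_sum, Finset.sum_mul]
      exact Finset.sum_congr rfl fun i _ => by ring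
    simp_rw [e]
    have h2 := integral_fintype_prod_eq_prod (μ := fun _ : Fin d => ProbabilityTheory.gaussianReal 0 v)
      (f := fun i (x : ℝ) => Complex.exp ((2 * Real.pi * n i : ℝ) * x * Complex.I))
    refine h2.trans ?_
    simp_rw [← charFun_apply_real, ProbabilityTheory.charFun_gaussianReal]
    rw [← Complex.exp_sum]
    unfold gaussW
    rw [Complex.ofReal_exp]
    congr 1
    push_cast
    rw [Finset.mul_sum]
    refine Finset.sum_congr rfl fun i _ => ?_
    have hvc : ((v : ℝ) : ℂ) = κ / Real.pi ^ 2 := by rw [hv]; push_cast; ring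
    have hp : (Real.pi : ℂ) ≠ 0 := by exact_mod_cast Real.pi_ne_zero
    have hvc' : ((v : NNReal) : ℂ) = κ / Real.pi ^ 2 := hvc
    rw [hvc]
    field_simp
    ring

/-- The multiplier of the positive quantization is the characteristic function of a probability
measure with small first moments. -/
theorem exists_measure_antiWick {κ : ℝ} (hκ : 0 < κ) {N : ℕ} (hN : 1 ≤ N) :
    ∃ ν : Measure ((Fin d → ℝ) × (Fin d → ℝ)), IsProbabilityMeasure ν ∧
      Integrable (fun x => ‖x.1‖) ν ∧ Integrable (fun x => ‖x.2‖) ν ∧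
      ∫ x, ‖x.1‖ ∂ν ≤ 4 ^ d * (N * √κ)⁻¹ ∧ ∫ x, ‖x.2‖ ∂ν ≤ d * √κ ∧
      ∀ ζ : (Fin d → ℤ) × (Fin d → ℤ),
        ∫ x, cis (zdot ζ.1 x.1 + zdot ζ.2 x.2) ∂ν = antiWick κ N ζ := by
  obtain ⟨μ₁, hp₁, hi₁, hm₁, hc₁⟩ := exists_measure_lattice (d := d) hκ hN
  obtain ⟨μ₂, hp₂, hi₂, hm₂, hc₂⟩ := exists_measure_gaussian (d := d) hκ
  refine ⟨μ₁.prod μ₂, inferInstance, hi₁.comp_fst _, hi₂.comp_snd _, ?_, ?_, fun ζ => ?_⟩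
  · rw [integral_fun_fst (f := fun a : Fin d → ℝ => ‖a‖)]
    simpa using hm₁
  · rw [integral_fun_snd (f := fun a : Fin d → ℝ => ‖a‖)]
    simpa using hm₂
  · simp_rw [cis_add]
    rw [integral_prod_mul (fun a => cis (zdot ζ.1 a)) fun b => cis (zdot ζ.2 b), hc₁, hc₂]
    unfold antiWick
    ring

end Moments

/-! ### Averaging of symbols -/

section Averaging

variable {d : ℕ} {ν : Measure ((Fin d → ℝ) × (Fin d → ℝ))} [IsProbabilityMeasure ν]
  {γ : (Fin d → ℤ) × (Fin d → ℤ) → ℂ}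

lemma summable_trigSum {c : (Fin d → ℤ) × (Fin d → ℤ) → ℂ} (hc : Summable c) (a b : Fin d → ℝ) :
    Summable fun ζ => c ζ * cis (zdot ζ.1 a + zdot ζ.2 b) :=
  summable_mul_of_norm_le hc fun _ => (norm_cis _).le

lemma continuous_trigSum_add {c : (Fin d → ℤ) × (Fin d → ℤ) → ℂ} (hc : Summable c)
    (a b : Fin d → ℝ) :
    Continuous fun x : (Fin d → ℝ) × (Fin d → ℝ) => trigSum c (a + x.1) (b + x.2) := by
  unfold trigSum
  refine continuous_tsum (fun ζ => by fun_prop) hc.norm fun ζ x => ?_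
  rw [norm_mul, norm_cis, mul_one]

lemma norm_trigSum_le {c : (Fin d → ℤ) × (Fin d → ℤ) → ℂ} (hc : Summable c) (a b : Fin d → ℝ) :
    ‖trigSum c a b‖ ≤ ∑' ζ, ‖c ζ‖ :=
  tsum_of_norm_bounded hc.norm.hasSum fun ζ => by rw [norm_mul, norm_cis, mul_one]

lemma norm_multiplier_le (hγ : ∀ ζ, ∫ x, cis (zdot ζ.1 x.1 + zdot ζ.2 x.2) ∂ν = γ ζ)
    (ζ : (Fin d → ℤ) × (Fin d → ℤ)) : ‖γ ζ‖ ≤ 1 := by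
  rw [← hγ]
  refine (norm_integral_le_of_norm_le_const (C := 1)
    (Filter.Eventually.of_forall fun x => (norm_cis _).le)).trans (by simp)

lemma summable_multiplier (hγ : ∀ ζ, ∫ x, cis (zdot ζ.1 x.1 + zdot ζ.2 x.2) ∂ν = γ ζ)
    {c : (Fin d → ℤ) × (Fin d → ℤ) → ℂ} (hc : Summable c) : Summable fun ζ => γ ζ * c ζ :=
  (summable_mul_of_norm_le hc (norm_multiplier_le hγ)).congr fun _ => mul_comm _ _

lemma summable_one_sub_multiplier
    (hγ : ∀ ζ, ∫ x, cis (zdot ζ.1 x.1 + zdot ζ.2 x.2) ∂ν = γ ζ)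
    {c : (Fin d → ℤ) × (Fin d → ℤ) → ℂ} (hc : Summable c) : Summable fun ζ => (1 - γ ζ) * c ζ :=
  (hc.sub (summable_multiplier hγ hc)).congr fun _ => by ring

/-- Multiplication of the coefficients by the characteristic function of a probability measure
averages the translates of the function. -/
lemma trigSum_multiplier (hγ : ∀ ζ, ∫ x, cis (zdot ζ.1 x.1 + zdot ζ.2 x.2) ∂ν = γ ζ)
    {c : (Fin d → ℤ) × (Fin d → ℤ) → ℂ} (hc : Summable c) (a b : Fin d → ℝ) :
    trigSum (fun ζ => γ ζ * c ζ) a b = ∫ x, trigSum c (a + x.1) (b + x.2) ∂ν := by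
  unfold trigSum
  rw [← integral_tsum_of_summable_integral_norm]
  · refine tsum_congr fun ζ => ?_
    simp only
    rw [← hγ, ← integral_mul_const, ← integral_mul_const]
    refine integral_congr_ae (Filter.Eventually.of_forall fun x => ?_)
    simp only [zdot_add, cis_add]
    ring
  · intro ζ
    refine Integrable.const_mul ?_ _
    refine (integrable_const (1 : ℝ)).mono' (by fun_prop) (Filter.Eventually.of_forall fun x => ?_)
    rw [norm_cis]
  · simpa [norm_mul] using hc.norm

lemma norm_trigSum_multiplier_le (hγ : ∀ ζ, ∫ x, cis (zdot ζ.1 x.1 + zdot ζ.2 x.2) ∂ν = γ ζ)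
    {c : (Fin d → ℤ) × (Fin d → ℤ) → ℂ} (hc : Summable c) {S : ℝ}
    (hS : ∀ a b, ‖trigSum c a b‖ ≤ S) (a b : Fin d → ℝ) :
    ‖trigSum (fun ζ => γ ζ * c ζ) a b‖ ≤ S := by
  rw [trigSum_multiplier hγ hc]
  have h : ∀ᵐ x ∂ν, ‖trigSum c (a + x.1) (b + x.2)‖ ≤ S :=
    Filter.Eventually.of_forall fun x => hS (a + x.1) (b + x.2)
  exact (norm_integral_le_of_norm_le_const h).trans (by simp)

lemma trigSum_one_sub_multiplier (hγ : ∀ ζ, ∫ x, cis (zdot ζ.1 x.1 + zdot ζ.2 x.2) ∂ν = γ ζ)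
    {c : (Fin d → ℤ) × (Fin d → ℤ) → ℂ} (hc : Summable c) (a b : Fin d → ℝ) :
    trigSum (fun ζ => (1 - γ ζ) * c ζ) a b =
      trigSum c a b - trigSum (fun ζ => γ ζ * c ζ) a b := by
  have h := summable_multiplier hγ hc
  unfold trigSum
  rw [← (summable_trigSum hc a b).tsum_sub (summable_trigSum h a b)]
  exact tsum_congr fun ζ => by ring

/-- The averaging moves a Lipschitz function by at most the first moments of the measure. -/
lemma norm_trigSum_one_sub_multiplier_le
    (hγ : ∀ ζ, ∫ x, cis (zdot ζ.1 x.1 + zdot ζ.2 x.2) ∂ν = γ ζ)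
    (h1 : Integrable (fun x => ‖x.1‖) ν) (h2 : Integrable (fun x => ‖x.2‖) ν)
    {c : (Fin d → ℤ) × (Fin d → ℤ) → ℂ} (hc : Summable c) {L₁ L₂ : ℝ}
    (hL : ∀ a b a' b' : Fin d → ℝ,
      ‖trigSum c (a + a') (b + b') - trigSum c a b‖ ≤ L₁ * ‖a'‖ + L₂ * ‖b'‖)
    (a b : Fin d → ℝ) :
    ‖trigSum (fun ζ => (1 - γ ζ) * c ζ) a b‖ ≤
      L₁ * (∫ x, ‖x.1‖ ∂ν) + L₂ * ∫ x, ‖x.2‖ ∂ν := by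
  rw [trigSum_one_sub_multiplier hγ hc, trigSum_multiplier hγ hc, norm_sub_rev]
  have hi : Integrable (fun x : (Fin d → ℝ) × (Fin d → ℝ) => trigSum c (a + x.1) (b + x.2)) ν := by
    have hb : ∀ᵐ x ∂ν, ‖trigSum c (a + x.1) (b + x.2)‖ ≤ ∑' ζ, ‖c ζ‖ :=
      Filter.Eventually.of_forall fun x => norm_trigSum_le hc (a + x.1) (b + x.2)
    refine (integrable_const (∑' ζ, ‖c ζ‖)).mono' ?_ hb
    exact (continuous_trigSum_add hc a b).aestronglyMeasurable
  have e : ∫ x, trigSum c (a + x.1) (b + x.2) ∂ν - trigSum c a b =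
      ∫ x, (trigSum c (a + x.1) (b + x.2) - trigSum c a b) ∂ν := by
    have h := integral_sub hi (integrable_const (μ := ν) (trigSum c a b))
    rw [h, integral_const, probReal_univ, one_smul]
  rw [e, ← integral_const_mul, ← integral_const_mul,
    ← integral_add (h1.const_mul _) (h2.const_mul _)]
  have hb : ∀ᵐ x ∂ν, ‖trigSum c (a + x.1) (b + x.2) - trigSum c a b‖ ≤
      L₁ * ‖x.1‖ + L₂ * ‖x.2‖ := Filter.Eventually.of_forall fun x => hL a b x.1 x.2
  exact norm_integral_le_of_norm_le ((h1.const_mul _).add (h2.const_mul _)) hb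

lemma norm_one_sub_multiplier_le
    (hγ : ∀ ζ, ∫ x, cis (zdot ζ.1 x.1 + zdot ζ.2 x.2) ∂ν = γ ζ)
    (h1 : Integrable (fun x => ‖x.1‖) ν) (h2 : Integrable (fun x => ‖x.2‖) ν)
    (ζ : (Fin d → ℤ) × (Fin d → ℤ)) :
    ‖1 - γ ζ‖ ≤ 2 * Real.pi * d * (‖ζ.1‖ * (∫ x, ‖x.1‖ ∂ν) + ‖ζ.2‖ * ∫ x, ‖x.2‖ ∂ν) := by
  have hi : Integrable (fun x : (Fin d → ℝ) × (Fin d → ℝ) =>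
      cis (zdot ζ.1 x.1 + zdot ζ.2 x.2)) ν := by
    refine (integrable_const (1 : ℝ)).mono' (by fun_prop) (Filter.Eventually.of_forall fun x => ?_)
    rw [norm_cis]
  have e : γ ζ - 1 = ∫ x, (cis (zdot ζ.1 x.1 + zdot ζ.2 x.2) - 1) ∂ν := by
    rw [integral_sub hi (integrable_const _), hγ]
    simp
  rw [norm_sub_rev, e, ← integral_const_mul, ← integral_const_mul,
    ← integral_add (h1.const_mul _) (h2.const_mul _), ← integral_const_mul]
  refine norm_integral_le_of_norm_le (((h1.const_mul _).add (h2.const_mul _)).const_mul _)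
    (Filter.Eventually.of_forall fun x => ?_)
  refine (norm_cis_sub_one_le _).trans ?_
  have h3 := abs_add_le (zdot ζ.1 x.1) (zdot ζ.2 x.2)
  have h4 := abs_zdot_le ζ.1 x.1
  have h5 := abs_zdot_le ζ.2 x.2
  calc 2 * Real.pi * |zdot ζ.1 x.1 + zdot ζ.2 x.2|
      ≤ 2 * Real.pi * (d * ‖ζ.1‖ * ‖x.1‖ + d * ‖ζ.2‖ * ‖x.2‖) := by
        have := Real.pi_pos
        gcongr
        linarith
    _ = _ := by ring

variable {N : ℕ} [NeZero N]

/-- The expansion `1 = γ + γ(1 - γ) + γ(1 - γ)² + … + (1 - γ)ᴹ` of the quantization: all the terms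
but the last one are positive quantizations of averages of the symbol, and the last one is
estimated by the `ℓ¹` norm of its coefficients. -/
lemma formBound_iterate (hγ : ∀ ζ, ∫ x, cis (zdot ζ.1 x.1 + zdot ζ.2 x.2) ∂ν = γ ζ)
    (hpos : ∀ (c : (Fin d → ℤ) × (Fin d → ℤ) → ℂ) (S : ℝ), Summable c →
      (∀ a b, ‖trigSum c a b‖ ≤ S) → FormBound N (fun ζ => γ ζ * c ζ) S) (M : ℕ) :
    ∀ (c : (Fin d → ℤ) × (Fin d → ℤ) → ℂ) (η : ℝ), Summable c →
      (∀ a b, ‖trigSum c a b‖ ≤ η) →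
      FormBound N c ((2 ^ M - 1) * η + ∑' ζ, ‖1 - γ ζ‖ ^ M * ‖c ζ‖) := by
  induction M with
  | zero =>
    intro c η hc _
    simpa using formBound_tsum_norm (N := N) hc
  | succ M ih =>
    intro c η hc hη
    have hs1 := summable_multiplier hγ hc
    have hs2 := summable_one_sub_multiplier hγ hc
    have hη2 : ∀ a b, ‖trigSum (fun ζ => (1 - γ ζ) * c ζ) a b‖ ≤ 2 * η := by
      intro a b
      rw [trigSum_one_sub_multiplier hγ hc]
      have := norm_trigSum_multiplier_le hγ hc hη a b
      refine (norm_sub_le _ _).trans ?_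
      linarith [hη a b]
    have h := (hpos c η hc hη).add hs1 hs2 (ih _ (2 * η) hs2 hη2)
    have e1 : (fun ζ => γ ζ * c ζ) + (fun ζ => (1 - γ ζ) * c ζ) = c := by
      funext ζ
      simp only [Pi.add_apply]
      ring
    have e2 : η + ((2 ^ M - 1) * (2 * η) + ∑' ζ, ‖1 - γ ζ‖ ^ M * ‖(1 - γ ζ) * c ζ‖) =
        (2 ^ (M + 1) - 1) * η + ∑' ζ, ‖1 - γ ζ‖ ^ (M + 1) * ‖c ζ‖ := by
      have : ∀ ζ, ‖1 - γ ζ‖ ^ M * ‖(1 - γ ζ) * c ζ‖ = ‖1 - γ ζ‖ ^ (M + 1) * ‖c ζ‖ := by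
        intro ζ
        rw [norm_mul]
        ring
      simp_rw [this]
      ring
    rwa [e1, e2] at h

/-- The quantization is bounded by the supremum of the symbol, up to an error controlled by the
Lipschitz constants of the symbol and by moments of its Fourier coefficients. -/
theorem formBound_of_lipschitz {N : ℕ} [NeZero N] {κ : ℝ} (hκ : 0 < κ)
    {c : (Fin d → ℤ) × (Fin d → ℤ) → ℂ} (hc : Summable c)
    {S L₁ L₂ : ℝ} (hL₁ : 0 ≤ L₁) (hL₂ : 0 ≤ L₂) (hS : ∀ a b, ‖trigSum c a b‖ ≤ S)
    (hL : ∀ a b a' b' : Fin d → ℝ,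
      ‖trigSum c (a + a') (b + b') - trigSum c a b‖ ≤ L₁ * ‖a'‖ + L₂ * ‖b'‖) (M : ℕ) {R : ℝ}
    (hR : HasSum (fun ζ : (Fin d → ℤ) × (Fin d → ℤ) => (2 * Real.pi * d *
      (‖ζ.1‖ * (4 ^ d * (N * √κ)⁻¹) + ‖ζ.2‖ * (d * √κ))) ^ (M + 1) * ‖c ζ‖) R) :
    FormBound N c (S + 2 ^ M * (L₁ * (4 ^ d * (N * √κ)⁻¹) + L₂ * (d * √κ)) + R) := by
  obtain ⟨ν, hν, hi1, hi2, hm1, hm2, hγ⟩ := exists_measure_antiWick (d := d) hκ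
    (Nat.one_le_iff_ne_zero.mpr (NeZero.ne N))
  set γ := antiWick (d := d) κ N with hγdef
  set η := L₁ * (4 ^ d * ((N : ℝ) * √κ)⁻¹) + L₂ * (d * √κ) with hηdef
  have hη0 : 0 ≤ η := by positivity
  have hs1 := summable_multiplier hγ hc
  have hs2 := summable_one_sub_multiplier hγ hc
  have hη : ∀ a b, ‖trigSum (fun ζ => (1 - γ ζ) * c ζ) a b‖ ≤ η := by
    intro a b
    refine (norm_trigSum_one_sub_multiplier_le hγ hi1 hi2 hc hL a b).trans ?_
    rw [hηdef]
    gcongr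
  have h := (formBound_antiWick (N := N) hκ hc hS).add hs1 hs2
    (formBound_iterate hγ (fun c S hc hS => formBound_antiWick hκ hc hS) M _ η hs2 hη)
  have e1 : (fun ζ => antiWick κ N ζ * c ζ) + (fun ζ => (1 - γ ζ) * c ζ) = c := by
    funext ζ
    simp only [Pi.add_apply, hγdef]
    ring
  rw [e1] at h
  have hle : ∀ ζ, ‖1 - γ ζ‖ ^ M * ‖(1 - γ ζ) * c ζ‖ ≤ (2 * Real.pi * d *
      (‖ζ.1‖ * (4 ^ d * (N * √κ)⁻¹) + ‖ζ.2‖ * (d * √κ))) ^ (M + 1) * ‖c ζ‖ := by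
    intro ζ
    rw [norm_mul, ← mul_assoc, ← pow_succ]
    gcongr
    refine (norm_one_sub_multiplier_le hγ hi1 hi2 ζ).trans ?_
    have := Real.pi_pos
    gcongr
  have hsum : Summable fun ζ => ‖1 - γ ζ‖ ^ M * ‖(1 - γ ζ) * c ζ‖ :=
    Summable.of_nonneg_of_le (fun ζ => by positivity) hle hR.summable
  have hR' : ∑' ζ, ‖1 - γ ζ‖ ^ M * ‖(1 - γ ζ) * c ζ‖ ≤ R := by
    rw [← hR.tsum_eq]
    exact hsum.tsum_le_tsum hle hR.summable
  intro f g
  refine (h f g).trans ?_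
  have h2 : (2 ^ M - 1) * η ≤ 2 ^ M * η := by nlinarith
  have h3 : S + ((2 ^ M - 1) * η + ∑' ζ, ‖1 - γ ζ‖ ^ M * ‖(1 - γ ζ) * c ζ‖) ≤
      S + 2 ^ M * η + R := by linarith
  have h4 : 0 ≤ (∑ k, ‖f k‖ ^ 2) + ∑ k, ‖g k‖ ^ 2 := by positivity
  exact div_le_div_of_nonneg_right (mul_le_mul_of_nonneg_right h3 h4) zero_le_two

end Averaging

/-! ### Fourier coefficients of smooth periodic functions -/

section FourierCoefficients

variable {ι : Type*}

/-- The function on the torus `(ℝ/ℤ)^ι` induced by a function `f` on `ℝ^ι`; it is meaningful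
when `f` is invariant under integer translations. -/
noncomputable def torusLift (f : (ι → ℝ) → ℂ) : UnitAddTorus ι → ℂ :=
  fun x => f (exists_coe_torus x).choose

lemma torusLift_coe {f : (ι → ℝ) → ℂ} (hf : ∀ (n : ι → ℤ) a, f (a + fun i => (n i : ℝ)) = f a)
    (a : ι → ℝ) : torusLift f (fun i => (a i : UnitAddCircle)) = f a := by
  unfold torusLift
  have hb := (exists_coe_torus fun i => (a i : UnitAddCircle)).choose_spec
  set b := (exists_coe_torus fun i => (a i : UnitAddCircle)).choose
  have h1 : ∀ i, ∃ n : ℤ, b i - a i = n := by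
    intro i
    have h2 : ((b i - a i : ℝ) : UnitAddCircle) = 0 := by
      rw [AddCircle.coe_sub, sub_eq_zero]
      exact (congrFun hb i).symm
    obtain ⟨n, hn⟩ := (AddCircle.coe_eq_zero_iff (1 : ℝ)).mp h2
    exact ⟨n, by rw [← hn]; simp⟩
  choose n hn using h1
  rw [← hf n a]
  congr 1
  ext i
  simp [← hn i]

lemma continuous_torusLift {f : (ι → ℝ) → ℂ}
    (hf : ∀ (n : ι → ℤ) a, f (a + fun i => (n i : ℝ)) = f a) (hc : Continuous f) :
    Continuous (torusLift f) := by
  have hq : IsOpenQuotientMap (Pi.map fun (_ : ι) (t : ℝ) => (t : UnitAddCircle)) :=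
    IsOpenQuotientMap.piMap fun _ => QuotientAddGroup.isOpenQuotientMap_mk
  rw [← hq.continuous_comp_iff]
  have : torusLift f ∘ (Pi.map fun (_ : ι) (t : ℝ) => (t : UnitAddCircle)) = f :=
    funext fun a => torusLift_coe hf a
  rwa [this]

variable [Fintype ι]

lemma mFourierCoeff_torusLift_add {f : (ι → ℝ) → ℂ}
    (hf : ∀ (n : ι → ℤ) a, f (a + fun i => (n i : ℝ)) = f a) (y : ι → ℝ) (ν : ι → ℤ) :
    UnitAddTorus.mFourierCoeff (torusLift fun a => f (a + y)) ν =
      cis (zdot ν y) * UnitAddTorus.mFourierCoeff (torusLift f) ν := by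
  have hf' : ∀ (n : ι → ℤ) a, f (a + (fun i => (n i : ℝ)) + y) = f (a + y) := by
    intro n a
    rw [add_right_comm, hf]
  have h1 : ∀ x : UnitAddTorus ι, torusLift (fun a => f (a + y)) x =
      torusLift f (x + fun i => (y i : UnitAddCircle)) := by
    intro x
    obtain ⟨b, rfl⟩ := exists_coe_torus x
    rw [torusLift_coe hf', ← torusLift_coe hf]
    rfl
  change ∫ x, UnitAddTorus.mFourier (-ν) x • _ ∂torusMeasure ι =
    _ * ∫ x, UnitAddTorus.mFourier (-ν) x • _ ∂torusMeasure ι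
  rw [← integral_add_right_eq_self (μ := torusMeasure ι)
    (fun x => UnitAddTorus.mFourier (-ν) x • torusLift f x) (fun i => (y i : UnitAddCircle)),
    ← integral_const_mul]
  refine integral_congr_ae (Filter.Eventually.of_forall fun x => ?_)
  simp only [smul_eq_mul]
  rw [h1, mFourier_apply_add, mFourier_coe, neg_zdot, cis_neg]
  have h2 : cis (zdot ν y) * conj (cis (zdot ν y)) = 1 := by
    rw [Complex.mul_conj', norm_cis]
    norm_num
  linear_combination (-UnitAddTorus.mFourier (-ν) x *
    torusLift f (x + fun i => (y i : UnitAddCircle))) * h2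

lemma mFourierCoeff_sub {f g : UnitAddTorus ι → ℂ} (hf : Continuous f) (hg : Continuous g)
    (ν : ι → ℤ) : UnitAddTorus.mFourierCoeff (fun x => f x - g x) ν =
      UnitAddTorus.mFourierCoeff f ν - UnitAddTorus.mFourierCoeff g ν := by
  have hint : ∀ {u : UnitAddTorus ι → ℂ}, Continuous u →
      Integrable (fun x => UnitAddTorus.mFourier (-ν) x • u x) (torusMeasure ι) := fun hu =>
    ((UnitAddTorus.mFourier (-ν)).continuous.smul hu).integrable_of_hasCompactSupport
      (HasCompactSupport.of_compactSpace _)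
  change ∫ x, UnitAddTorus.mFourier (-ν) x • (f x - g x) ∂torusMeasure ι =
    (∫ x, UnitAddTorus.mFourier (-ν) x • f x ∂torusMeasure ι) -
      ∫ x, UnitAddTorus.mFourier (-ν) x • g x ∂torusMeasure ι
  rw [← integral_sub (hint hf) (hint hg)]
  simp_rw [smul_sub]

lemma norm_mFourierCoeff_torusLift_le {f : (ι → ℝ) → ℂ} {B : ℝ} (hB : ∀ a, ‖f a‖ ≤ B)
    (ν : ι → ℤ) : ‖UnitAddTorus.mFourierCoeff (torusLift f) ν‖ ≤ B := by
  change ‖∫ x, UnitAddTorus.mFourier (-ν) x • torusLift f x ∂torusMeasure ι‖ ≤ B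
  refine (norm_integral_le_of_norm_le_const (C := B)
    (Filter.Eventually.of_forall fun x => ?_)).trans (le_of_eq ?_)
  · rw [norm_smul, norm_mFourier_apply, one_mul]
    exact hB _
  · simp

variable {V : Type*} [NormedAddCommGroup V] [NormedSpace ℝ V]

/-- Decay of the Fourier coefficients of `p ∘ L`. If the translation by `y` changes the sign
of the character `ν`, then each difference `p(· + L y) - p` doubles the `ν`-th coefficient and costs
one derivative of `p`. -/
lemma norm_mFourierCoeff_comp_le (L : (ι → ℝ) →L[ℝ] V) {y : ι → ℝ} {ν : ι → ℤ}
    (hy : cis (zdot ν y) = -1) (k : ℕ) : ∀ {p : V → ℂ} {B : ℝ}, ContDiff ℝ ∞ p →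
      (∀ (n : ι → ℤ) v, p (v + L fun i => (n i : ℝ)) = p v) →
      (∀ v, ‖iteratedFDeriv ℝ k p v‖ ≤ B) →
      ‖UnitAddTorus.mFourierCoeff (torusLift fun a => p (L a)) ν‖ ≤ B * (‖L y‖ / 2) ^ k := by
  induction k with
  | zero =>
    intro p B _ _ hB
    rw [pow_zero, mul_one]
    refine norm_mFourierCoeff_torusLift_le (fun a => ?_) ν
    simpa using hB (L a)
  | succ k ih =>
    intro p B hp hper hB
    have hp' : ContDiff ℝ ∞ fun v => p (v + L y) := by fun_prop
    have hq : ∀ v, ‖iteratedFDeriv ℝ k (fun v => p (v + L y) - p v) v‖ ≤ B * ‖L y‖ := by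
      intro v
      have h1 : iteratedFDeriv ℝ k (fun v => p (v + L y) - p v) v =
          iteratedFDeriv ℝ k p (v + L y) - iteratedFDeriv ℝ k p v := by
        rw [fun_iteratedFDeriv_sub_apply ((hp'.of_le (by exact_mod_cast le_top)).contDiffAt)
          ((hp.of_le (by exact_mod_cast le_top)).contDiffAt), iteratedFDeriv_comp_add_right]
      have h2 := Convex.norm_image_sub_le_of_norm_fderiv_le (𝕜 := ℝ) (s := Set.univ)
        (f := iteratedFDeriv ℝ k p) (C := B)
        (fun x _ => (hp.differentiable_iteratedFDeriv (by exact_mod_cast ENat.natCast_lt_top k)) x)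
        (fun x _ => by rw [norm_fderiv_iteratedFDeriv]; exact hB x) convex_univ
        (Set.mem_univ v) (Set.mem_univ (v + L y))
      rwa [add_sub_cancel_left, ← h1] at h2
    have hf : ∀ (n : ι → ℤ) a, p (L (a + fun i => (n i : ℝ))) = p (L a) := by
      intro n a
      rw [map_add, hper]
    have hf' : ∀ (n : ι → ℤ) a, p (L (a + (fun i => (n i : ℝ)) + y)) = p (L (a + y)) := by
      intro n a
      rw [add_right_comm, hf]
    have hc : Continuous fun a => p (L a) := hp.continuous.comp L.continuous
    have hc' : Continuous fun a => p (L (a + y)) := hc.comp (continuous_add_const y)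
    have h3 := ih (hp'.sub hp) (fun n v => by rw [add_right_comm, hper, hper]) hq
    have h4 : (torusLift fun a => p (L a + L y) - p (L a)) =
        fun x => torusLift (fun a => p (L (a + y))) x - torusLift (fun a => p (L a)) x := by
      funext x
      simp [torusLift]
    rw [h4, mFourierCoeff_sub (continuous_torusLift hf' hc') (continuous_torusLift hf hc),
      mFourierCoeff_torusLift_add (f := fun a => p (L a)) hf, hy] at h3
    have h5 : ∀ z : ℂ, ‖-1 * z - z‖ = 2 * ‖z‖ := by
      intro z
      rw [show -1 * z - z = -(2 * z) by ring, norm_neg, norm_mul, Complex.norm_ofNat]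
    rw [h5] at h3
    rw [pow_succ]
    linarith

/-- The translation by half a period of the character in the coordinate `j` gives decay of the
coefficients in the `j`-th frequency. -/
lemma norm_mFourierCoeff_mul_pow_le (L : (ι → ℝ) →L[ℝ] V) {p : V → ℂ} {B : ℝ} (k : ℕ)
    (hp : ContDiff ℝ ∞ p) (hper : ∀ (n : ι → ℤ) v, p (v + L fun i => (n i : ℝ)) = p v)
    (hB : ∀ v, ‖iteratedFDeriv ℝ k p v‖ ≤ B) {j : ι} {r : ℝ} (hr : 0 < r) [DecidableEq ι]
    (hL : ∀ t, ‖L (Pi.single j t)‖ ≤ r⁻¹ * |t|) (ν : ι → ℤ) :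
    ‖UnitAddTorus.mFourierCoeff (torusLift fun a => p (L a)) ν‖ * (r * ‖ν j‖) ^ k ≤ B := by
  have hB0 : 0 ≤ B := (norm_nonneg _).trans (hB 0)
  by_cases hj : ν j = 0
  · rcases Nat.eq_zero_or_pos k with rfl | hk
    · rw [pow_zero, mul_one]
      exact norm_mFourierCoeff_torusLift_le (fun a => by simpa using hB (L a)) ν
    · simp [hj, hk.ne', hB0]
  · have hy : cis (zdot ν (Pi.single j ((2 * ν j : ℝ)⁻¹))) = -1 := by
      rw [← mFourier_coe, mFourier_single_half hj]
    have h1 := norm_mFourierCoeff_comp_le L hy k hp hper hB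
    have hpos : 0 < ‖ν j‖ := norm_pos_iff.mpr hj
    have h2 : ‖L (Pi.single j ((2 * ν j : ℝ)⁻¹))‖ / 2 * (r * ‖ν j‖) ≤ 1 := by
      have h3 := hL ((2 * ν j : ℝ)⁻¹)
      rw [abs_inv, abs_mul, abs_two, ← Int.norm_eq_abs] at h3
      calc ‖L (Pi.single j ((2 * ν j : ℝ)⁻¹))‖ / 2 * (r * ‖ν j‖)
          ≤ (r⁻¹ * (2 * ‖ν j‖)⁻¹) / 2 * (r * ‖ν j‖) := by gcongr
        _ = 1 / 4 := by field_simp; norm_num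
        _ ≤ 1 := by norm_num
    calc _ ≤ B * (‖L (Pi.single j ((2 * ν j : ℝ)⁻¹))‖ / 2) ^ k * (r * ‖ν j‖) ^ k := by gcongr
      _ = B * (‖L (Pi.single j ((2 * ν j : ℝ)⁻¹))‖ / 2 * (r * ‖ν j‖)) ^ k := by
        rw [mul_assoc, ← mul_pow]
      _ ≤ B * 1 ^ k := by gcongr
      _ = B := by simp

end FourierCoefficients

/-! ### Fourier coefficients of a torus symbol -/

section SymbolCoefficients

variable {d : ℕ}

/-- The dilation `(a, b) ↦ (α₁^(-1/2) a, α₂^(-1/2) b)` of the standard torus to the torus of the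
symbols. -/
noncomputable def torusDilation (d : ℕ) (α₁ α₂ : ℝ) : (Fin d ⊕ Fin d → ℝ) →L[ℝ] Rd d × Rd d :=
  LinearMap.toContinuousLinearMap
    { toFun := fun x => ((√α₁)⁻¹ • WithLp.toLp 2 fun i => x (Sum.inl i),
        (√α₂)⁻¹ • WithLp.toLp 2 fun i => x (Sum.inr i))
      map_add' := fun x y => by
        ext i <;> simp [mul_add]
      map_smul' := fun r x => by
        ext i <;> simp [mul_left_comm] }

lemma torusDilation_elim (α₁ α₂ : ℝ) (a b : Fin d → ℝ) :
    torusDilation d α₁ α₂ (Sum.elim a b) =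
      ((√α₁)⁻¹ • WithLp.toLp 2 a, (√α₂)⁻¹ • WithLp.toLp 2 b) := rfl

/-- The Fourier coefficients of a symbol, as a function of the pair of frequencies `(m, n)`
dual to `(x, ξ)`. -/
noncomputable def symbolCoeff (α₁ α₂ : ℝ) (p : Rd d × Rd d → ℂ)
    (ζ : (Fin d → ℤ) × (Fin d → ℤ)) : ℂ :=
  UnitAddTorus.mFourierCoeff (torusLift fun a => p (torusDilation d α₁ α₂ a)) (Sum.elim ζ.1 ζ.2)

/-- The weight `1 + α₁^(1/2) |m| + α₂^(1/2) |n|` in which the coefficients of symbols decay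
rapidly, uniformly with respect to the parameters. -/
noncomputable def freqWeight (α₁ α₂ : ℝ) (ζ : (Fin d → ℤ) × (Fin d → ℤ)) : ℝ :=
  1 + √α₁ * ‖ζ.1‖ + √α₂ * ‖ζ.2‖

lemma one_le_freqWeight (α₁ α₂ : ℝ) (ζ : (Fin d → ℤ) × (Fin d → ℤ)) :
    1 ≤ freqWeight α₁ α₂ ζ := by
  have h1 : 0 ≤ √α₁ * ‖ζ.1‖ := by positivity
  have h2 : 0 ≤ √α₂ * ‖ζ.2‖ := by positivity
  unfold freqWeight
  linarith

variable {C : ℕ → ℝ} {α₁ α₂ : ℝ} {p : Rd d × Rd d → ℂ}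

lemma _root_.IsTorusSymbol.const_nonneg (hp : IsTorusSymbol C α₁ α₂ p) (k : ℕ) : 0 ≤ C k :=
  (norm_nonneg _).trans (hp.bound k 0)

lemma _root_.IsTorusSymbol.norm_le (hp : IsTorusSymbol C α₁ α₂ p) (ρ : Rd d × Rd d) : ‖p ρ‖ ≤ C 0 := by
  simpa using hp.bound 0 ρ

lemma _root_.IsTorusSymbol.periodic (hp : IsTorusSymbol C α₁ α₂ p) (n : Fin d ⊕ Fin d → ℤ)
    (v : Rd d × Rd d) : p (v + torusDilation d α₁ α₂ fun i => (n i : ℝ)) = p v := by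
  obtain ⟨x, ξ⟩ := v
  exact (hp.periodic_fst (fun i => n (Sum.inl i)) _ _).trans
    (hp.periodic_snd (fun i => n (Sum.inr i)) _ _)

lemma norm_torusDilation_single_inl (α₁ α₂ : ℝ) (i : Fin d) (t : ℝ) :
    ‖torusDilation d α₁ α₂ (Pi.single (Sum.inl i) t)‖ ≤ (√α₁)⁻¹ * |t| := by
  have h : (Pi.single (Sum.inl i) t : Fin d ⊕ Fin d → ℝ) = Sum.elim (Pi.single i t) 0 := by
    ext j; rcases j with j | j <;> simp [Pi.single_apply]
  have h2 : (WithLp.toLp 2 (0 : Fin d → ℝ) : Rd d) = 0 := rfl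
  rw [h, torusDilation_elim, h2, smul_zero, Prod.norm_mk, norm_zero, norm_smul]
  have h3 : (WithLp.toLp 2 (Pi.single i t) : Rd d) = EuclideanSpace.single i t := rfl
  rw [h3, PiLp.norm_single, Real.norm_of_nonneg (by positivity), Real.norm_eq_abs]
  exact max_le le_rfl (by positivity)

lemma norm_torusDilation_single_inr (α₁ α₂ : ℝ) (i : Fin d) (t : ℝ) :
    ‖torusDilation d α₁ α₂ (Pi.single (Sum.inr i) t)‖ ≤ (√α₂)⁻¹ * |t| := by
  have h : (Pi.single (Sum.inr i) t : Fin d ⊕ Fin d → ℝ) = Sum.elim (0 : Fin d → ℝ) (Pi.single i t) := by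
    ext j; rcases j with j | j <;> simp [Pi.single_apply]
  have h2 : (WithLp.toLp 2 (0 : Fin d → ℝ) : Rd d) = 0 := rfl
  rw [h, torusDilation_elim, h2, smul_zero, Prod.norm_mk, norm_zero, norm_smul]
  have h3 : (WithLp.toLp 2 (Pi.single i t) : Rd d) = EuclideanSpace.single i t := rfl
  rw [h3, PiLp.norm_single, Real.norm_of_nonneg (by positivity), Real.norm_eq_abs]
  exact max_le (by positivity) le_rfl

lemma exists_norm_eq_norm_apply (hd : 1 ≤ d) (m : Fin d → ℤ) : ∃ i, ‖m‖ = ‖m i‖ := by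
  have : Nonempty (Fin d) := ⟨⟨0, hd⟩⟩
  obtain ⟨i, -, hi⟩ := Finset.exists_max_image Finset.univ (fun i => ‖m i‖) Finset.univ_nonempty
  exact ⟨i, le_antisymm ((pi_norm_le_iff_of_nonneg (norm_nonneg _)).mpr fun j => hi j
    (Finset.mem_univ j)) (norm_le_pi_norm m i)⟩

/-- Rapid decay of the Fourier coefficients of symbols, with constants that depend only on the
symbol constants. -/
lemma _root_.IsTorusSymbol.norm_symbolCoeff_mul_le (hd : 1 ≤ d) (h₁ : 0 < α₁) (h₂ : 0 < α₂)
    (hp : IsTorusSymbol C α₁ α₂ p) (k : ℕ) (ζ : (Fin d → ℤ) × (Fin d → ℤ)) :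
    ‖symbolCoeff α₁ α₂ p ζ‖ * freqWeight α₁ α₂ ζ ^ k ≤ 3 ^ k * (C 0 + 2 * C k) := by
  obtain ⟨i, hi⟩ := exists_norm_eq_norm_apply hd ζ.1
  obtain ⟨j, hj⟩ := exists_norm_eq_norm_apply hd ζ.2
  have e0 : ‖symbolCoeff α₁ α₂ p ζ‖ ≤ C 0 :=
    norm_mFourierCoeff_torusLift_le (fun a => hp.norm_le _) _
  have e1 : ‖symbolCoeff α₁ α₂ p ζ‖ * (√α₁ * ‖ζ.1‖) ^ k ≤ C k := by
    rw [hi]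
    exact norm_mFourierCoeff_mul_pow_le (torusDilation d α₁ α₂) k hp.smooth hp.periodic
      (hp.bound k) (Real.sqrt_pos.mpr h₁) (norm_torusDilation_single_inl α₁ α₂ i)
      (Sum.elim ζ.1 ζ.2)
  have e2 : ‖symbolCoeff α₁ α₂ p ζ‖ * (√α₂ * ‖ζ.2‖) ^ k ≤ C k := by
    rw [hj]
    exact norm_mFourierCoeff_mul_pow_le (torusDilation d α₁ α₂) k hp.smooth hp.periodic
      (hp.bound k) (Real.sqrt_pos.mpr h₂) (norm_torusDilation_single_inr α₁ α₂ j)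
      (Sum.elim ζ.1 ζ.2)
  have hu : 0 ≤ √α₁ * ‖ζ.1‖ := by positivity
  have hv : 0 ≤ √α₂ * ‖ζ.2‖ := by positivity
  unfold freqWeight
  generalize √α₁ * ‖ζ.1‖ = u at *
  generalize √α₂ * ‖ζ.2‖ = v at *
  have h3 : (1 + u + v) ^ k ≤ 3 ^ k * (1 + u ^ k + v ^ k) := by
    have hmax : 1 + u + v ≤ 3 * max 1 (max u v) := by
      have a1 := le_max_left 1 (max u v)
      have a2 := (le_max_left u v).trans (le_max_right 1 (max u v))
      have a3 := (le_max_right u v).trans (le_max_right 1 (max u v))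
      linarith
    refine (pow_le_pow_left₀ (by positivity) hmax k).trans ?_
    rw [mul_pow]
    have hu' : 0 ≤ u ^ k := by positivity
    have hv' : 0 ≤ v ^ k := by positivity
    gcongr
    rcases max_choice 1 (max u v) with h | h
    · rw [h, one_pow]; linarith
    · rw [h]
      rcases max_choice u v with h' | h' <;> rw [h'] <;> linarith
  calc _ ≤ ‖symbolCoeff α₁ α₂ p ζ‖ * (3 ^ k * (1 + u ^ k + v ^ k)) := by gcongr
    _ = 3 ^ k * (‖symbolCoeff α₁ α₂ p ζ‖ + ‖symbolCoeff α₁ α₂ p ζ‖ * u ^ k +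
        ‖symbolCoeff α₁ α₂ p ζ‖ * v ^ k) := by ring
    _ ≤ 3 ^ k * (C 0 + C k + C k) := by gcongr
    _ = _ := by ring

lemma norm_toLp_le (a : Fin d → ℝ) : ‖(WithLp.toLp 2 a : Rd d)‖ ≤ d * ‖a‖ := by
  have h : (WithLp.toLp 2 a : Rd d) = ∑ i, EuclideanSpace.single i (a i) := by
    ext j
    simp [Pi.single_apply]
  rw [h]
  refine (norm_sum_le _ _).trans ?_
  calc ∑ i, ‖EuclideanSpace.single i (a i)‖ ≤ ∑ _i : Fin d, ‖a‖ := by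
        refine Finset.sum_le_sum fun i _ => ?_
        rw [PiLp.norm_single]
        exact norm_le_pi_norm a i
    _ = d * ‖a‖ := by simp

lemma norm_intVec_le (m : Fin d → ℤ) : ‖(intVec m : Rd d)‖ ≤ d * ‖m‖ := by
  refine (norm_toLp_le _).trans ?_
  gcongr
  exact (pi_norm_le_iff_of_nonneg (norm_nonneg m)).mpr fun i => norm_le_pi_norm m i

lemma summable_one_add_norm_inv_pow (d : ℕ) :
    Summable fun m : Fin d → ℤ => ((1 + ‖m‖) ^ (d + 1))⁻¹ := by
  have h := (summable_one_add_norm_lattice (d := d) one_pos 0).mul_left ((d + 1 : ℝ) ^ (d + 1))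
  refine Summable.of_nonneg_of_le (fun m => by positivity) (fun m => ?_) h
  rw [one_smul, add_zero]
  have h1 : 1 + ‖(intVec m : Rd d)‖ ≤ (d + 1) * (1 + ‖m‖) := by
    have h2 : ‖(intVec m : Rd d)‖ ≤ d * ‖m‖ := norm_intVec_le m
    have h4 := norm_nonneg m
    have h5 : (0 : ℝ) ≤ d := by positivity
    nlinarith
  rw [inv_le_comm₀ (by positivity) (by positivity), mul_inv, inv_inv, inv_mul_le_iff₀ (by positivity),
    ← mul_pow]
  gcongr

/-- A power of the weight dominates a summable weight, at the cost of powers of `√(α₁ α₂)`. -/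
lemma freqWeight_pow_ge (h₁ : 0 < α₁) (h₂ : 0 < α₂) (h₁' : α₁ ≤ 1) (h₂' : α₂ ≤ 1)
    (ζ : (Fin d → ℤ) × (Fin d → ℤ)) (k : ℕ) :
    √(α₁ * α₂) ^ k * ((1 + ‖ζ.1‖) ^ k * (1 + ‖ζ.2‖) ^ k) ≤ freqWeight α₁ α₂ ζ ^ (2 * k) := by
  rw [pow_mul, ← mul_pow, ← mul_pow, Real.sqrt_mul h₁.le]
  have a1 : √α₁ ≤ 1 := Real.sqrt_le_one.mpr h₁'
  have a2 : √α₂ ≤ 1 := Real.sqrt_le_one.mpr h₂'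
  have b1 : √α₁ * (1 + ‖ζ.1‖) ≤ freqWeight α₁ α₂ ζ := by
    have : 0 ≤ √α₂ * ‖ζ.2‖ := by positivity
    unfold freqWeight; linarith
  have b2 : √α₂ * (1 + ‖ζ.2‖) ≤ freqWeight α₁ α₂ ζ := by
    have : 0 ≤ √α₁ * ‖ζ.1‖ := by positivity
    unfold freqWeight; linarith
  refine pow_le_pow_left₀ (by positivity) ?_ k
  calc √α₁ * √α₂ * ((1 + ‖ζ.1‖) * (1 + ‖ζ.2‖)) = (√α₁ * (1 + ‖ζ.1‖)) * (√α₂ * (1 + ‖ζ.2‖)) := by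
        ring
    _ ≤ freqWeight α₁ α₂ ζ * freqWeight α₁ α₂ ζ := by
      have := one_le_freqWeight α₁ α₂ ζ
      gcongr
    _ = _ := by ring

/-- The constant in the summed form of the decay of Fourier coefficients. -/
noncomputable def symbolConst (d : ℕ) (C : ℕ → ℝ) (k : ℕ) : ℝ :=
  3 ^ (k + 2 * (d + 1)) * (C 0 + 2 * C (k + 2 * (d + 1))) *
    ∑' ζ : (Fin d → ℤ) × (Fin d → ℤ), ((1 + ‖ζ.1‖) ^ (d + 1))⁻¹ * ((1 + ‖ζ.2‖) ^ (d + 1))⁻¹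

lemma _root_.IsTorusSymbol.summable_weighted (hd : 1 ≤ d) (h₁ : 0 < α₁) (h₂ : 0 < α₂) (h₁' : α₁ ≤ 1)
    (h₂' : α₂ ≤ 1) (hp : IsTorusSymbol C α₁ α₂ p) (k : ℕ) :
    Summable (fun ζ => freqWeight α₁ α₂ ζ ^ k * ‖symbolCoeff α₁ α₂ p ζ‖) ∧
      ∑' ζ, freqWeight α₁ α₂ ζ ^ k * ‖symbolCoeff α₁ α₂ p ζ‖ ≤
        symbolConst d C k * (√(α₁ * α₂) ^ (d + 1))⁻¹ := by
  have hs : Summable fun ζ : (Fin d → ℤ) × (Fin d → ℤ) =>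
      ((1 + ‖ζ.1‖) ^ (d + 1))⁻¹ * ((1 + ‖ζ.2‖) ^ (d + 1))⁻¹ :=
    (summable_one_add_norm_inv_pow d).mul_of_nonneg (summable_one_add_norm_inv_pow d)
      (fun m => by positivity) (fun m => by positivity)
  have hpos : 0 < √(α₁ * α₂) := Real.sqrt_pos.mpr (mul_pos h₁ h₂)
  have hb : ∀ ζ : (Fin d → ℤ) × (Fin d → ℤ), freqWeight α₁ α₂ ζ ^ k * ‖symbolCoeff α₁ α₂ p ζ‖ ≤
      3 ^ (k + 2 * (d + 1)) * (C 0 + 2 * C (k + 2 * (d + 1))) * (√(α₁ * α₂) ^ (d + 1))⁻¹ *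
        (((1 + ‖ζ.1‖) ^ (d + 1))⁻¹ * ((1 + ‖ζ.2‖) ^ (d + 1))⁻¹) := by
    intro ζ
    have e1 := hp.norm_symbolCoeff_mul_le hd h₁ h₂ (k + 2 * (d + 1)) ζ
    have e2 := freqWeight_pow_ge h₁ h₂ h₁' h₂' ζ (d + 1)
    have hw := one_le_freqWeight α₁ α₂ ζ
    rw [← mul_inv, mul_assoc (3 ^ (k + 2 * (d + 1)) * _), ← mul_inv, ← div_eq_mul_inv,
      le_div_iff₀ (by positivity)]
    refine le_trans ?_ e1
    rw [pow_add _ k]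
    calc _ ≤ freqWeight α₁ α₂ ζ ^ k * ‖symbolCoeff α₁ α₂ p ζ‖ *
          freqWeight α₁ α₂ ζ ^ (2 * (d + 1)) := by gcongr
      _ = _ := by ring
  have hsum := hs.mul_left
    (3 ^ (k + 2 * (d + 1)) * (C 0 + 2 * C (k + 2 * (d + 1))) * (√(α₁ * α₂) ^ (d + 1))⁻¹)
  have hl : Summable (fun ζ => freqWeight α₁ α₂ ζ ^ k * ‖symbolCoeff α₁ α₂ p ζ‖) := by
    refine Summable.of_nonneg_of_le (fun ζ => ?_) hb hsum
    have hw := one_le_freqWeight α₁ α₂ ζ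
    positivity
  refine ⟨hl, (hl.tsum_le_tsum hb hsum).trans (le_of_eq ?_)⟩
  rw [tsum_mul_left]
  unfold symbolConst
  ring

lemma _root_.IsTorusSymbol.summable_symbolCoeff (hd : 1 ≤ d) (h₁ : 0 < α₁) (h₂ : 0 < α₂) (h₁' : α₁ ≤ 1)
    (h₂' : α₂ ≤ 1) (hp : IsTorusSymbol C α₁ α₂ p) : Summable (symbolCoeff α₁ α₂ p) := by
  rw [← summable_norm_iff]
  simpa using (hp.summable_weighted hd h₁ h₂ h₁' h₂' 0).1

/-- A symbol is the sum of its Fourier series. -/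
lemma _root_.IsTorusSymbol.trigSum_symbolCoeff (hd : 1 ≤ d) (h₁ : 0 < α₁) (h₂ : 0 < α₂) (h₁' : α₁ ≤ 1)
    (h₂' : α₂ ≤ 1) (hp : IsTorusSymbol C α₁ α₂ p) (a b : Fin d → ℝ) :
    trigSum (symbolCoeff α₁ α₂ p) a b =
      p ((√α₁)⁻¹ • WithLp.toLp 2 a, (√α₂)⁻¹ • WithLp.toLp 2 b) := by
  have hper : ∀ (n : Fin d ⊕ Fin d → ℤ) a, p (torusDilation d α₁ α₂ (a + fun i => (n i : ℝ))) =
      p (torusDilation d α₁ α₂ a) := by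
    intro n a
    rw [map_add, hp.periodic]
  have hc : Continuous (torusLift fun a => p (torusDilation d α₁ α₂ a)) :=
    continuous_torusLift hper (hp.smooth.continuous.comp (torusDilation d α₁ α₂).continuous)
  have hs := hp.summable_symbolCoeff hd h₁ h₂ h₁' h₂'
  let e : (Fin d ⊕ Fin d → ℤ) ≃ (Fin d → ℤ) × (Fin d → ℤ) := Equiv.sumArrowEquivProdArrow _ _ _
  have hs' : Summable (UnitAddTorus.mFourierCoeff
      (torusLift fun a => p (torusDilation d α₁ α₂ a))) := by
    refine (e.symm.summable_iff).mp (hs.congr fun ζ => ?_)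
    rfl
  have h := UnitAddTorus.hasSum_mFourier_series_apply_of_summable
    (f := ⟨_, hc⟩) hs' (fun i => ((Sum.elim a b i : ℝ) : UnitAddCircle))
  rw [ContinuousMap.coe_mk, torusLift_coe hper, torusDilation_elim] at h
  rw [← h.tsum_eq, ← e.symm.tsum_eq]
  refine tsum_congr fun ζ => ?_
  rw [mFourier_coe, smul_eq_mul]
  change _ * _ = symbolCoeff α₁ α₂ p ζ * _
  congr 2
  simp [zdot, e, Fintype.sum_sum_type, Equiv.sumArrowEquivProdArrow]

end SymbolCoefficients

/-! ### Weyl quantization of trigonometric series -/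

section WeylSeries

open scoped FourierTransform

variable {d : ℕ}

lemma integral_cis_mul_eq_fourier (φ : Rd d → ℂ) (η : Rd d) :
    ∫ y, cis (-inner ℝ y η) * φ y = 𝓕 φ η := by
  rw [Real.fourier_eq']
  refine integral_congr_ae (Filter.Eventually.of_forall fun y => ?_)
  simp only [cis, smul_eq_mul]
  congr 2
  push_cast
  ring

lemma integral_cis_mul_fourier (φ : 𝓢(Rd d, ℂ)) (x : Rd d) :
    ∫ η, cis (inner ℝ x η) * 𝓕 (φ : Rd d → ℂ) η = φ x := by
  have h : 𝓕⁻ (𝓕 φ) x = φ x := by rw [FourierTransform.fourierInv_fourier_eq]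
  rw [SchwartzMap.fourierInv_coe, SchwartzMap.fourier_coe, Real.fourierInv_eq'] at h
  rw [← h]
  refine integral_congr_ae (Filter.Eventually.of_forall fun y => ?_)
  simp only [cis, smul_eq_mul]
  rw [real_inner_comm]
  congr 2
  push_cast
  ring

lemma integrable_fourier (φ : 𝓢(Rd d, ℂ)) : Integrable (𝓕 (φ : Rd d → ℂ)) := by
  rw [← SchwartzMap.fourier_coe]
  exact SchwartzMap.integrable _

/-- The inner integral of the Weyl quantization of one character. -/
noncomputable def weylInner (t : ℝ) (φ : Rd d → ℂ) (x w v ξ : Rd d) : ℂ :=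
  ∫ y, cis (inner ℝ (x - y) ξ / t + inner ℝ (x + y) w - inner ℝ v ξ) * φ y

lemma weylInner_eq {t : ℝ} (ht : 0 < t) (φ : Rd d → ℂ) (x w v ξ : Rd d) :
    weylInner t φ x w v ξ =
      cis (inner ℝ x (t⁻¹ • ξ) + inner ℝ x w - t * inner ℝ v (t⁻¹ • ξ)) * 𝓕 φ (t⁻¹ • ξ - w) := by
  unfold weylInner
  rw [← integral_cis_mul_eq_fourier, ← integral_const_mul]
  refine integral_congr_ae (Filter.Eventually.of_forall fun y => ?_)
  simp only
  rw [← mul_assoc, ← cis_add]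
  congr 2
  rw [inner_sub_left, inner_add_left, inner_sub_right, inner_smul_right, inner_smul_right,
    inner_smul_right]
  field_simp
  ring

lemma integrable_weylInner {t : ℝ} (ht : 0 < t) (φ : 𝓢(Rd d, ℂ)) (x w v : Rd d) :
    Integrable (weylInner t φ x w v) := by
  have h : weylInner t φ x w v = fun ξ => cis (inner ℝ x (t⁻¹ • ξ) + inner ℝ x w -
      t * inner ℝ v (t⁻¹ • ξ)) * 𝓕 (φ : Rd d → ℂ) (t⁻¹ • ξ - w) :=
    funext fun ξ => weylInner_eq ht φ x w v ξ
  rw [h]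
  refine Integrable.bdd_mul (c := 1) ?_ (Continuous.aestronglyMeasurable (by fun_prop))
    (Filter.Eventually.of_forall fun ξ => (norm_cis _).le)
  exact ((integrable_fourier φ).comp_sub_right w).comp_smul (inv_ne_zero ht.ne')

lemma integral_norm_weylInner {t : ℝ} (ht : 0 < t) (φ : 𝓢(Rd d, ℂ)) (x w v : Rd d) :
    ∫ ξ, ‖weylInner t φ x w v ξ‖ = t ^ d * ∫ ξ, ‖𝓕 (φ : Rd d → ℂ) ξ‖ := by
  simp_rw [weylInner_eq ht, norm_mul, norm_cis, one_mul]
  rw [Measure.integral_comp_inv_smul_of_nonneg volume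
    (fun η => ‖𝓕 (φ : Rd d → ℂ) (η - w)‖) ht.le, finrank_euclideanSpace_fin, smul_eq_mul,
    integral_sub_right_eq_self (fun η => ‖𝓕 (φ : Rd d → ℂ) η‖) w]

/-- The Weyl quantization of the character `(x, ξ) ↦ cis (2⟨w, x⟩ - ⟨v, ξ⟩)` is the translation
by `t v` followed by a multiplication by a character. -/
lemma integral_weylInner {t : ℝ} (ht : 0 < t) (φ : 𝓢(Rd d, ℂ)) (x w v : Rd d) :
    ∫ ξ, weylInner t φ x w v ξ =
      ((t ^ d : ℝ) : ℂ) * (cis (2 * inner ℝ x w - t * inner ℝ v w) * φ (x - t • v)) := by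
  simp_rw [weylInner_eq ht]
  rw [Measure.integral_comp_inv_smul_of_nonneg volume
    (fun η => cis (inner ℝ x η + inner ℝ x w - t * inner ℝ v η) * 𝓕 (φ : Rd d → ℂ) (η - w)) ht.le,
    finrank_euclideanSpace_fin, Complex.real_smul, ← integral_add_right_eq_self (μ := volume)
    (fun η => cis (inner ℝ x η + inner ℝ x w - t * inner ℝ v η) * 𝓕 (φ : Rd d → ℂ) (η - w)) w,
    ← integral_cis_mul_fourier φ]
  congr 1
  rw [← integral_const_mul]
  refine integral_congr_ae (Filter.Eventually.of_forall fun η => ?_)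
  simp only [add_sub_cancel_right]
  rw [← mul_assoc, ← cis_add]
  congr 2
  rw [inner_add_right, inner_add_right, inner_sub_left, inner_smul_left, RCLike.conj_to_real]
  ring

/-- The Weyl quantization of an absolutely convergent series of characters, term by term. -/
lemma weylFun_eq_tsum {κ : Type*} [Countable κ] {c : κ → ℂ} (hc : Summable c) (w v : κ → Rd d)
    {h t : ℝ} (ht : 0 < t) (hh : t = 2 * Real.pi * h) {p : Rd d × Rd d → ℂ}
    (hp : ∀ x ξ, p (x, ξ) = ∑' i, c i * cis (2 * inner ℝ x (w i) - inner ℝ (v i) ξ))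
    (φ : 𝓢(Rd d, ℂ)) (x : Rd d) :
    weylFun h p φ x =
      ∑' i, c i * (cis (2 * inner ℝ x (w i) - t * inner ℝ (v i) (w i)) * φ (x - t • v i)) := by
  have h1 : ∀ ξ : Rd d, ∫ y : Rd d, Complex.exp (Complex.I * ((inner ℝ (x - y) ξ / h : ℝ) : ℂ)) *
        p ((2⁻¹ : ℝ) • (x + y), ξ) * φ y = ∑' i, c i * weylInner t φ x (w i) (v i) ξ := by
    intro ξ
    simp only [weylInner, ← integral_const_mul]
    have hint : ∀ i, Integrable fun y => c i * (cis (inner ℝ (x - y) ξ / t +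
        inner ℝ (x + y) (w i) - inner ℝ (v i) ξ) * φ y) := by
      intro i
      refine Integrable.const_mul (Integrable.bdd_mul (c := 1) (SchwartzMap.integrable φ)
        (Continuous.aestronglyMeasurable (by fun_prop))
        (Filter.Eventually.of_forall fun y => (norm_cis _).le)) _
    rw [integral_tsum_of_summable_integral_norm hint]
    · refine integral_congr_ae (Filter.Eventually.of_forall fun y => ?_)
      simp only
      rw [hp, ← tsum_mul_left, ← tsum_mul_right]
      refine tsum_congr fun i => ?_
      have h2 : Complex.exp (Complex.I * ((inner ℝ (x - y) ξ / h : ℝ) : ℂ)) =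
          cis (inner ℝ (x - y) ξ / t) := by
        unfold cis
        congr 1
        have : (inner ℝ (x - y) ξ / h : ℝ) = 2 * Real.pi * (inner ℝ (x - y) ξ / t) := by
          have h3 : h ≠ 0 := by rintro rfl; simp [hh] at ht
          rw [hh]
          field_simp
        rw [this]
        push_cast
        ring
      rw [h2, add_sub_assoc, cis_add, inner_smul_left, RCLike.conj_to_real]
      rw [show (2 : ℝ) * (2⁻¹ * inner ℝ (x + y) (w i)) = inner ℝ (x + y) (w i) by ring]
      ring
    · simp_rw [norm_mul, norm_cis, one_mul, integral_const_mul]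
      exact hc.norm.mul_right _
  unfold weylFun
  simp_rw [h1]
  rw [← integral_tsum_of_summable_integral_norm
    (fun i => (integrable_weylInner ht φ x (w i) (v i)).const_mul (c i))]
  · simp_rw [integral_const_mul, integral_weylInner ht]
    rw [← tsum_mul_left]
    refine tsum_congr fun i => ?_
    rw [← hh]
    have : ((t ^ d : ℝ) : ℂ) ≠ 0 := by exact_mod_cast (pow_pos ht d).ne'
    push_cast at this ⊢
    field_simp
  · simp_rw [norm_mul, integral_const_mul, integral_norm_weylInner ht]
    exact hc.norm.mul_right _

lemma hasDerivAt_cis (x : ℝ) : HasDerivAt cis (2 * Real.pi * Complex.I * cis x) x := by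
  unfold cis
  have h := ((((hasDerivAt_id x).ofReal_comp).const_mul (2 * Real.pi : ℂ)).mul_const
    Complex.I).cexp
  refine h.congr_deriv ?_
  simp
  ring

lemma iteratedDeriv_cis (n : ℕ) :
    iteratedDeriv n cis = fun x => (2 * Real.pi * Complex.I) ^ n * cis x := by
  induction n with
  | zero => simp
  | succ n ih =>
    rw [iteratedDeriv_succ, ih]
    funext x
    rw [((hasDerivAt_cis x).const_mul _).deriv]
    ring

lemma contDiff_cis : ContDiff ℝ ∞ cis := by
  unfold cis
  have : ContDiff ℝ ∞ fun x : ℝ => (x : ℂ) := Complex.ofRealCLM.contDiff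
  fun_prop

lemma contDiff_cis_inner (w : Rd d) : ContDiff ℝ ∞ fun x => cis (inner ℝ w x) :=
  contDiff_cis.comp (innerSL ℝ w).contDiff

lemma norm_iteratedFDeriv_cis_inner_le (w : Rd d) (n : ℕ) (x : Rd d) :
    ‖iteratedFDeriv ℝ n (fun x => cis (inner ℝ w x)) x‖ ≤ (2 * Real.pi * ‖w‖) ^ n := by
  have h := (innerSL ℝ w).iteratedFDeriv_comp_right contDiff_cis x (i := n)
    (by exact_mod_cast le_top)
  have h2 : cis ∘ (innerSL ℝ w) = fun x => cis (inner ℝ w x) := rfl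
  rw [h2] at h
  rw [h]
  refine (ContinuousMultilinearMap.norm_compContinuousLinearMap_le _ _).trans ?_
  rw [norm_iteratedFDeriv_eq_norm_iteratedDeriv, iteratedDeriv_cis]
  simp [mul_pow, abs_of_pos Real.pi_pos]

/-- The Schwartz bounds of a translated Schwartz function multiplied by a character. -/
lemma norm_iteratedFDeriv_cis_mul_le (φ : 𝓢(Rd d, ℂ)) (w s : Rd d) (k n : ℕ) (x : Rd d) :
    (1 + ‖x‖) ^ k * ‖iteratedFDeriv ℝ n (fun x => cis (inner ℝ w x) * φ (x - s)) x‖ ≤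
      (1 + ‖s‖) ^ k * (1 + 2 * Real.pi * ‖w‖) ^ n * (2 ^ k *
        ((Finset.Iic (k, n)).sup fun m => SchwartzMap.seminorm ℂ m.1 m.2) φ) := by
  have hw := contDiff_cis_inner w
  have hφ : ContDiff ℝ ∞ fun x => φ (x - s) := φ.smooth'.comp (by fun_prop)
  set S := (2 : ℝ) ^ k * ((Finset.Iic (k, n)).sup fun m => SchwartzMap.seminorm ℂ m.1 m.2) φ
  have hS0 : 0 ≤ S := mul_nonneg (by positivity) (apply_nonneg _ _)
  have hx : (1 + ‖x‖) ^ k ≤ (1 + ‖s‖) ^ k * (1 + ‖x - s‖) ^ k := by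
    rw [← mul_pow]
    have h1 : ‖x‖ ≤ ‖x - s‖ + ‖s‖ := norm_le_norm_sub_add x s
    gcongr
    nlinarith [norm_nonneg (x - s), norm_nonneg s]
  have hb : ∀ i ≤ n, (1 + ‖x‖) ^ k * ‖iteratedFDeriv ℝ i (fun x => φ (x - s)) x‖ ≤
      (1 + ‖s‖) ^ k * S := by
    intro i hi
    have h1 := SchwartzMap.one_add_le_sup_seminorm_apply (𝕜 := ℂ) (m := (k, n)) (k := k)
      (n := i) le_rfl hi φ (x - s)
    rw [iteratedFDeriv_comp_sub]
    calc _ ≤ (1 + ‖s‖) ^ k * (1 + ‖x - s‖) ^ k * ‖iteratedFDeriv ℝ i (⇑φ) (x - s)‖ := by gcongr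
      _ ≤ _ := by
        rw [mul_assoc]
        gcongr
  refine (mul_le_mul_of_nonneg_left (norm_iteratedFDeriv_mul_le hw hφ x (n := n)
    (by exact_mod_cast le_top)) (by positivity)).trans ?_
  rw [Finset.mul_sum, add_comm 1 (2 * Real.pi * ‖w‖), add_pow _ _ n, mul_assoc, mul_left_comm,
    Finset.sum_mul]
  refine Finset.sum_le_sum fun i hi => ?_
  calc _ = (n.choose i : ℝ) * ‖iteratedFDeriv ℝ i (fun x => cis (inner ℝ w x)) x‖ *
        ((1 + ‖x‖) ^ k * ‖iteratedFDeriv ℝ (n - i) (fun x => φ (x - s)) x‖) := by ring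
    _ ≤ (n.choose i : ℝ) * (2 * Real.pi * ‖w‖) ^ i * ((1 + ‖s‖) ^ k * S) := by
      refine mul_le_mul (mul_le_mul_of_nonneg_left (norm_iteratedFDeriv_cis_inner_le w i x)
        (by positivity)) (hb _ (Nat.sub_le n i)) (by positivity) (by positivity)
    _ = _ := by
      rw [one_pow]
      ring

/-- A series of modulated and translated copies of a Schwartz function is a Schwartz function if
its coefficients decay rapidly with respect to the frequencies and translations. -/
lemma exists_schwartz_tsum {κ : Type*} {c : κ → ℂ} {w s : κ → Rd d}
    (hc : ∀ k n : ℕ, Summable fun i => ‖c i‖ * ((1 + ‖s i‖) ^ k * (1 + 2 * Real.pi * ‖w i‖) ^ n))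
    (φ : 𝓢(Rd d, ℂ)) :
    ∃ ψ : 𝓢(Rd d, ℂ), ∀ x, ψ x = ∑' i, c i * (cis (inner ℝ (w i) x) * φ (x - s i)) := by
  set S : ℕ → ℕ → ℝ := fun k n => 2 ^ k *
    ((Finset.Iic (k, n)).sup fun m => SchwartzMap.seminorm ℂ m.1 m.2) φ
  have hbase : ∀ i, ContDiff ℝ ∞ fun x => cis (inner ℝ (w i) x) * φ (x - s i) := fun i =>
    (contDiff_cis_inner (w i)).mul (φ.smooth'.comp (by fun_prop))
  have hcd : ∀ i, ContDiff ℝ ∞ fun x => c i * (cis (inner ℝ (w i) x) * φ (x - s i)) := fun i =>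
    contDiff_const.mul (hbase i)
  have hb : ∀ k n i x, (1 + ‖x‖) ^ k *
      ‖iteratedFDeriv ℝ n (fun x => c i * (cis (inner ℝ (w i) x) * φ (x - s i))) x‖ ≤
        ‖c i‖ * ((1 + ‖s i‖) ^ k * (1 + 2 * Real.pi * ‖w i‖) ^ n) * S k n := by
    intro k n i x
    have h1 : iteratedFDeriv ℝ n (fun x => c i * (cis (inner ℝ (w i) x) * φ (x - s i))) x =
        c i • iteratedFDeriv ℝ n (fun x => cis (inner ℝ (w i) x) * φ (x - s i)) x :=
      iteratedFDeriv_const_smul_apply (a := c i)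
        (f := fun x => cis (inner ℝ (w i) x) * φ (x - s i)) (((hbase i).of_le (by exact_mod_cast le_top)).contDiffAt)
    rw [h1, norm_smul, mul_left_comm, mul_assoc]
    exact mul_le_mul_of_nonneg_left (norm_iteratedFDeriv_cis_mul_le φ (w i) (s i) k n x)
      (norm_nonneg _)
  have hb0 : ∀ (n : ℕ) (i : κ) (x : Rd d), (n : ℕ∞) ≤ ⊤ →
      ‖iteratedFDeriv ℝ n (fun x => c i * (cis (inner ℝ (w i) x) * φ (x - s i))) x‖ ≤
        ‖c i‖ * ((1 + ‖s i‖) ^ 0 * (1 + 2 * Real.pi * ‖w i‖) ^ n) * S 0 n := by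
    intro n i x _
    simpa using hb 0 n i x
  have hs0 : ∀ n : ℕ, (n : ℕ∞) ≤ ⊤ → Summable fun i =>
      ‖c i‖ * ((1 + ‖s i‖) ^ 0 * (1 + 2 * Real.pi * ‖w i‖) ^ n) * S 0 n :=
    fun n _ => (hc 0 n).mul_right _
  refine ⟨⟨fun x => ∑' i, c i * (cis (inner ℝ (w i) x) * φ (x - s i)),
    contDiff_tsum hcd hs0 hb0, fun k n =>
      ⟨∑' i, ‖c i‖ * ((1 + ‖s i‖) ^ k * (1 + 2 * Real.pi * ‖w i‖) ^ n) * S k n, fun x => ?_⟩⟩,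
    fun x => rfl⟩
  rw [iteratedFDeriv_tsum_apply hcd hs0 hb0 le_top]
  have hpos : (0 : ℝ) < (1 + ‖x‖) ^ k := by positivity
  have h2 : ‖∑' i, iteratedFDeriv ℝ n (fun x => c i * (cis (inner ℝ (w i) x) * φ (x - s i))) x‖ ≤
      ((1 + ‖x‖) ^ k)⁻¹ *
        ∑' i, ‖c i‖ * ((1 + ‖s i‖) ^ k * (1 + 2 * Real.pi * ‖w i‖) ^ n) * S k n := by
    rw [← tsum_mul_left]
    refine tsum_of_norm_bounded (((hc k n).mul_right (S k n)).mul_left _).hasSum fun i => ?_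
    rw [inv_mul_eq_div, le_div_iff₀ hpos, mul_comm]
    exact hb k n i x
  calc _ ≤ (1 + ‖x‖) ^ k * (((1 + ‖x‖) ^ k)⁻¹ * ∑' i, ‖c i‖ *
        ((1 + ‖s i‖) ^ k * (1 + 2 * Real.pi * ‖w i‖) ^ n) * S k n) := by
        gcongr
        linarith
    _ = _ := by rw [mul_inv_cancel_left₀ hpos.ne']

end WeylSeries

/-! ### The matrix of the quantization -/

section QuantizationMatrix

variable {d : ℕ}

lemma inner_intVec (x : Rd d) (m : Fin d → ℤ) : inner ℝ x (intVec m) = zdot m x.ofLp := by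
  rw [PiLp.inner_apply]
  unfold zdot
  refine Finset.sum_congr rfl fun i _ => ?_
  simp [intVec]

lemma intVec_inner (m : Fin d → ℤ) (x : Rd d) : inner ℝ (intVec m) x = zdot m x.ofLp := by
  rw [real_inner_comm, inner_intVec]

/-- The point `a (j + s / N)`. -/
noncomputable def latticePoint (a : ℝ) (N : ℕ) (s j : Fin d → ℤ) : Rd d :=
  a • (intVec j + (N : ℝ)⁻¹ • intVec s)

/-- The sum of the values of `φ` over the shifted lattice `a (ℤᵈ + s / N)`. -/
noncomputable def latticeSum {E : Type*} [NormedAddCommGroup E] (a : ℝ) (N : ℕ) (φ : Rd d → E)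
    (s : Fin d → ℤ) : E :=
  ∑' j, φ (latticePoint a N s j)

lemma latticePoint_add_smul (a : ℝ) (N : ℕ) [NeZero N] (s q j : Fin d → ℤ) :
    latticePoint a N (s + (N : ℤ) • q) j = latticePoint a N s (j + q) := by
  have hN : (N : ℝ) ≠ 0 := by exact_mod_cast NeZero.ne N
  unfold latticePoint
  congr 1
  ext i
  simp [intVec]
  field_simp
  ring

lemma latticeSum_add_smul {E : Type*} [NormedAddCommGroup E] (a : ℝ) (N : ℕ) [NeZero N]
    (φ : Rd d → E) (s q : Fin d → ℤ) :
    latticeSum a N φ (s + (N : ℤ) • q) = latticeSum a N φ s := by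
  unfold latticeSum
  simp_rw [latticePoint_add_smul]
  exact (Equiv.addRight q).tsum_eq fun j => φ (latticePoint a N s j)

lemma basisQ_apply {α₁ : ℝ} (h₁ : 0 < α₁) (N : ℕ) (k : Fin d → Fin N) (φ : 𝓢(Rd d, ℂ)) :
    basisQ N α₁ k φ = (((√α₁ * N) ^ (-(d : ℝ) / 2) : ℝ) : ℂ) *
      latticeSum (√α₁)⁻¹ N φ (liftN k) := by
  have h : basisQ N α₁ k φ = (((√α₁ * N) ^ (-(d : ℝ) / 2) : ℝ) : ℂ) *
      diracComb (√α₁)⁻¹ ((N : ℝ)⁻¹ • intVec fun i => ((k i : ℕ) : ℤ)) φ := rfl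
  rw [h, diracComb_apply (inv_pos.mpr (Real.sqrt_pos.mpr h₁))]
  rfl

lemma sum_smul_basisQ_apply {α₁ : ℝ} (h₁ : 0 < α₁) (N : ℕ) (f : (Fin d → Fin N) → ℂ)
    (φ : 𝓢(Rd d, ℂ)) :
    (∑ k, f k • basisQ N α₁ k) φ = (((√α₁ * N) ^ (-(d : ℝ) / 2) : ℝ) : ℂ) *
      ∑ k, f k * latticeSum (√α₁)⁻¹ N φ (liftN k) := by
  have h : (∑ k, f k • basisQ N α₁ k) φ = ∑ k, f k * basisQ N α₁ k φ := by
    rw [_root_.sum_apply]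
    rfl
  rw [h, Finset.mul_sum]
  refine Finset.sum_congr rfl fun k _ => ?_
  rw [basisQ_apply h₁]
  ring

lemma summable_norm_latticePoint {a : ℝ} (ha : 0 < a) (N : ℕ) (φ : 𝓢(Rd d, ℂ))
    (s : Fin d → ℤ) : Summable fun j => ‖φ (latticePoint a N s j)‖ := by
  obtain ⟨K, -, hK⟩ := exists_schwartz_lattice_bound ha ((N : ℝ)⁻¹ • (intVec s : Rd d))
  exact (hK φ).1.norm

lemma exists_latticeSum_norm_le (a : ℝ) (N : ℕ) [NeZero N] (φ : 𝓢(Rd d, ℂ)) :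
    ∃ K, ∀ s : Fin d → ℤ, latticeSum a N (fun x => ‖φ x‖) s ≤ K := by
  refine ⟨∑ k : Fin d → Fin N, latticeSum a N (fun x => ‖φ x‖) (liftN k), fun s => ?_⟩
  obtain ⟨q, hq⟩ := exists_liftN_modN (N := N) s
  rw [hq, latticeSum_add_smul]
  exact Finset.single_le_sum
    (f := fun k : Fin d → Fin N => latticeSum a N (fun x => ‖φ x‖) (liftN k))
    (fun k _ => tsum_nonneg fun j => norm_nonneg _) (Finset.mem_univ _)

lemma norm_latticeSum_le {a : ℝ} (ha : 0 < a) (N : ℕ) (φ : 𝓢(Rd d, ℂ)) (s : Fin d → ℤ) :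
    ‖latticeSum a N φ s‖ ≤ latticeSum a N (fun x => ‖φ x‖) s :=
  norm_tsum_le_tsum_norm (summable_norm_latticePoint ha N φ s)

/-- `ψ` is the transform of the Schwartz function `φ` by the Weyl quantization of the series
`∑ c(m, n) cis (r m·x - r' n·ξ)`, where the parameter `h` satisfies `2πh r' = (N r)⁻¹`: each character
acts by a translation followed by a multiplication by a character. -/
def IsWeylTransform (N : ℕ) (r : ℝ) (c : (Fin d → ℤ) × (Fin d → ℤ) → ℂ)
    (φ ψ : 𝓢(Rd d, ℂ)) : Prop :=
  ∀ x, ψ x = ∑' ζ : (Fin d → ℤ) × (Fin d → ℤ),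
    c ζ * cis (-(zdot ζ.1 fun i => (ζ.2 i : ℝ) / 2 / N)) *
      (cis (inner ℝ (r • intVec ζ.1) x) * φ (x - (N * r)⁻¹ • intVec ζ.2))

/-- On a lattice of mesh `r⁻¹` the characters of frequency `r m` are constant, which leaves the
discrete Weyl phases. -/
lemma IsWeylTransform.apply_latticePoint {N : ℕ} {r : ℝ} (hr : r ≠ 0)
    {c : (Fin d → ℤ) × (Fin d → ℤ) → ℂ} {φ ψ : 𝓢(Rd d, ℂ)} (h : IsWeylTransform N r c φ ψ)
    (s j : Fin d → ℤ) :
    ψ (latticePoint r⁻¹ N s j) =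
      ∑' ζ, c ζ * weylPhase N ζ.1 (-ζ.2) s * φ (latticePoint r⁻¹ N (s - ζ.2) j) := by
  rw [h]
  refine tsum_congr fun ζ => ?_
  have h1 : latticePoint r⁻¹ N s j - (N * r)⁻¹ • intVec ζ.2 = latticePoint r⁻¹ N (s - ζ.2) j := by
    unfold latticePoint
    ext i
    simp [intVec]
    ring
  have h2 : inner ℝ (r • intVec ζ.1) (latticePoint r⁻¹ N s j) =
      zdot ζ.1 (fun i => (j i : ℝ)) + zdot ζ.1 (fun i => (s i : ℝ) / N) := by
    rw [inner_smul_left, RCLike.conj_to_real, intVec_inner, ← zdot_add, ← zdot_smul]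
    congr 1
    ext i
    simp [latticePoint, intVec]
    field_simp
  have h3 : weylPhase N ζ.1 (-ζ.2) s = cis (-(zdot ζ.1 fun i => (ζ.2 i : ℝ) / 2 / N)) *
      cis (zdot ζ.1 (fun i => (s i : ℝ) / N)) := by
    unfold weylPhase
    rw [← cis_add, ← zdot_neg, ← zdot_add]
    congr 2
    ext i
    simp
    ring
  rw [h1, h2, h3, cis_add, cis_zdot_intCast]
  ring

lemma IsWeylTransform.latticeSum_eq {N : ℕ} [NeZero N] {r : ℝ} (hr : 0 < r)
    {c : (Fin d → ℤ) × (Fin d → ℤ) → ℂ} (hc : Summable c) {φ ψ : 𝓢(Rd d, ℂ)}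
    (h : IsWeylTransform N r c φ ψ) (s : Fin d → ℤ) :
    latticeSum r⁻¹ N ψ s =
      ∑' ζ, c ζ * weylPhase N ζ.1 (-ζ.2) s * latticeSum r⁻¹ N φ (s - ζ.2) := by
  obtain ⟨K, hK⟩ := exists_latticeSum_norm_le r⁻¹ N φ
  have hr' : 0 < r⁻¹ := inv_pos.mpr hr
  have hs : Summable (Function.uncurry fun (ζ : (Fin d → ℤ) × (Fin d → ℤ)) (j : Fin d → ℤ) =>
      c ζ * weylPhase N ζ.1 (-ζ.2) s * φ (latticePoint r⁻¹ N (s - ζ.2) j)) := by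
    rw [← summable_norm_iff]
    rw [summable_prod_of_nonneg fun _ => norm_nonneg _]
    simp only [Function.uncurry_apply_pair, norm_mul, norm_weylPhase, mul_one]
    refine ⟨fun ζ => (summable_norm_latticePoint hr' N φ _).mul_left _, ?_⟩
    simp_rw [tsum_mul_left]
    refine Summable.of_nonneg_of_le (fun ζ => by positivity) (fun ζ => ?_) (hc.norm.mul_right K)
    exact mul_le_mul_of_nonneg_left (hK (s - ζ.2)) (norm_nonneg _)
  have h1 : latticeSum r⁻¹ N ψ s = ∑' j, ∑' ζ : (Fin d → ℤ) × (Fin d → ℤ),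
      c ζ * weylPhase N ζ.1 (-ζ.2) s * φ (latticePoint r⁻¹ N (s - ζ.2) j) :=
    tsum_congr fun j => h.apply_latticePoint hr.ne' s j
  rw [h1, hs.tsum_comm]
  refine tsum_congr fun ζ => ?_
  rw [tsum_mul_left]
  rfl

/-- The transposed Weyl operator acts on the lattice sums by the matrix `weylMatrix N c`. -/
lemma IsWeylTransform.sum_mul_latticeSum {N : ℕ} [NeZero N] {r : ℝ} (hr : 0 < r)
    {c : (Fin d → ℤ) × (Fin d → ℤ) → ℂ} (hc : Summable c) {φ ψ : 𝓢(Rd d, ℂ)}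
    (h : IsWeylTransform N r c φ ψ) (f : (Fin d → Fin N) → ℂ) :
    ∑ k, (weylMatrix N c).mulVec f k * latticeSum r⁻¹ N φ (liftN k) =
      ∑ k, f k * latticeSum r⁻¹ N ψ (liftN k) := by
  obtain ⟨K, hK⟩ := exists_latticeSum_norm_le r⁻¹ N φ
  have hr' : 0 < r⁻¹ := inv_pos.mpr hr
  simp_rw [h.latticeSum_eq hr hc, weylMatrix_mulVec hc, ← tsum_mul_right, ← tsum_mul_left]
  rw [← Summable.tsum_finsetSum fun k _ => (summable_weylForm hc f k).mul_right _,
    ← Summable.tsum_finsetSum]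
  · refine tsum_congr fun ζ => ?_
    have h1 := sum_liftN_add (N := N) (fun s => c ζ * (f (modN N s) * weylPhase N ζ.1 (-ζ.2) s *
      latticeSum r⁻¹ N φ (s - ζ.2))) (fun s q => by
        rw [modN_add_smul, weylPhase_add_smul, add_sub_right_comm, latticeSum_add_smul]) ζ.2
    simp only [modN_liftN, add_sub_cancel_right] at h1
    have h2 : ∀ k : Fin d → Fin N, weylPhase N ζ.1 (-ζ.2) (liftN k + ζ.2) =
        weylPhase N ζ.1 ζ.2 (liftN k) := by
      intro k
      unfold weylPhase
      congr 2
      ext i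
      simp
      ring
    simp only [h2] at h1
    calc _ = ∑ k : Fin d → Fin N, c ζ * (f (modN N (liftN k + ζ.2)) *
          weylPhase N ζ.1 ζ.2 (liftN k) * latticeSum r⁻¹ N φ (liftN k)) :=
          Finset.sum_congr rfl fun k _ => by ring
      _ = _ := h1.trans (Finset.sum_congr rfl fun k _ => by ring)
  · intro k _
    refine Summable.mul_left _ ?_
    simp_rw [mul_assoc]
    refine summable_mul_of_norm_le hc (K := K) fun ζ => ?_
    rw [norm_mul, norm_weylPhase, one_mul]
    exact (norm_latticeSum_le hr' N φ _).trans (hK _)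

lemma two_pi_mul_hTilde {N : ℕ} (α₁ α₂ : ℝ) :
    2 * Real.pi * hTilde N α₁ α₂ = (N * √(α₁ * α₂))⁻¹ := by
  have := Real.pi_pos
  unfold hTilde
  rw [div_eq_mul_inv, mul_inv, mul_inv]
  field_simp

variable {C : ℕ → ℝ} {α₁ α₂ : ℝ} {p : Rd d × Rd d → ℂ}

lemma _root_.IsTorusSymbol.exists_weylTransform {N : ℕ} [NeZero N] (hd : 1 ≤ d) (h₁ : 0 < α₁)
    (h₂ : 0 < α₂) (h₁' : α₁ ≤ 1) (h₂' : α₂ ≤ 1) (hp : IsTorusSymbol C α₁ α₂ p)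
    (φ : 𝓢(Rd d, ℂ)) : ∃ ψ, IsWeylTransform N (√α₁) (symbolCoeff α₁ α₂ p) φ ψ := by
  have hN : (0 : ℝ) < N := by exact_mod_cast Nat.pos_of_ne_zero (NeZero.ne N)
  have hs₁ := Real.sqrt_pos.mpr h₁
  have hs₂ := Real.sqrt_pos.mpr h₂
  refine exists_schwartz_tsum (fun k n => ?_) φ
  set K₁ : ℝ := 1 + d * (N * √α₁ * √α₂)⁻¹
  set K₂ : ℝ := 1 + 2 * Real.pi * d
  have hsum := ((hp.summable_weighted hd h₁ h₂ h₁' h₂' (k + n)).1).mul_left (K₁ ^ k * K₂ ^ n)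
  refine Summable.of_nonneg_of_le (fun ζ => by positivity) (fun ζ => ?_) hsum
  rw [norm_mul, norm_cis, mul_one]
  have hu : 0 ≤ √α₁ * ‖ζ.1‖ := by positivity
  have hv : 0 ≤ √α₂ * ‖ζ.2‖ := by positivity
  have e1 : 1 + ‖((N * √α₁)⁻¹ • intVec ζ.2 : Rd d)‖ ≤ K₁ * freqWeight α₁ α₂ ζ := by
    rw [norm_smul, Real.norm_of_nonneg (by positivity)]
    calc 1 + (N * √α₁)⁻¹ * ‖(intVec ζ.2 : Rd d)‖ ≤ 1 + (N * √α₁)⁻¹ * (d * ‖ζ.2‖) := by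
          gcongr
          exact norm_intVec_le ζ.2
      _ = 1 + d * (N * √α₁ * √α₂)⁻¹ * (√α₂ * ‖ζ.2‖) := by field_simp
      _ ≤ _ := by
        have h3 : (0 : ℝ) ≤ d * (N * √α₁ * √α₂)⁻¹ := by positivity
        unfold freqWeight
        nlinarith
  have e2 : 1 + 2 * Real.pi * ‖(√α₁ • intVec ζ.1 : Rd d)‖ ≤ K₂ * freqWeight α₁ α₂ ζ := by
    rw [norm_smul, Real.norm_of_nonneg (by positivity)]
    calc 1 + 2 * Real.pi * (√α₁ * ‖(intVec ζ.1 : Rd d)‖)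
        ≤ 1 + 2 * Real.pi * (√α₁ * (d * ‖ζ.1‖)) := by
          gcongr
          exact norm_intVec_le ζ.1
      _ = 1 + 2 * Real.pi * d * (√α₁ * ‖ζ.1‖) := by ring
      _ ≤ _ := by
        have h3 : (0 : ℝ) ≤ 2 * Real.pi * d := by positivity
        unfold freqWeight
        nlinarith
  have e3 : 0 ≤ K₁ * freqWeight α₁ α₂ ζ := le_trans (by positivity) e1
  calc _ ≤ ‖symbolCoeff α₁ α₂ p ζ‖ *
        ((K₁ * freqWeight α₁ α₂ ζ) ^ k * (K₂ * freqWeight α₁ α₂ ζ) ^ n) := by gcongr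
    _ = _ := by
      rw [mul_pow, mul_pow, pow_add]
      ring

lemma _root_.IsTorusSymbol.weylFun_eq {N : ℕ} [NeZero N] (hd : 1 ≤ d) (h₁ : 0 < α₁)
    (h₂ : 0 < α₂) (h₁' : α₁ ≤ 1) (h₂' : α₂ ≤ 1) (hp : IsTorusSymbol C α₁ α₂ p)
    {φ ψ : 𝓢(Rd d, ℂ)} (h : IsWeylTransform N (√α₁) (symbolCoeff α₁ α₂ p) φ ψ) (x : Rd d) :
    ψ x = weylFun (hTilde N α₁ α₂) (fun ρ => p (ρ.1, -ρ.2)) φ x := by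
  have hN : (0 : ℝ) < N := by exact_mod_cast Nat.pos_of_ne_zero (NeZero.ne N)
  have hs₁ := Real.sqrt_pos.mpr h₁
  have hs₂ := Real.sqrt_pos.mpr h₂
  have ht : 0 < (N * √(α₁ * α₂))⁻¹ := by
    rw [Real.sqrt_mul h₁.le]
    positivity
  have hsym : ∀ x ξ : Rd d, p (x, -ξ) = ∑' ζ : (Fin d → ℤ) × (Fin d → ℤ), symbolCoeff α₁ α₂ p ζ *
      cis (2 * inner ℝ x ((√α₁ / 2) • intVec ζ.1) - inner ℝ (√α₂ • intVec ζ.2) ξ) := by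
    intro x ξ
    have h3 := hp.trigSum_symbolCoeff hd h₁ h₂ h₁' h₂' (√α₁ • x.ofLp) (√α₂ • (-ξ).ofLp)
    have h4 : (√α₁)⁻¹ • WithLp.toLp 2 (√α₁ • x.ofLp) = x := by
      ext i
      simp [hs₁.ne']
    have h5 : (√α₂)⁻¹ • WithLp.toLp 2 (√α₂ • (-ξ).ofLp) = -ξ := by
      ext i
      simp [hs₂.ne']
    rw [h4, h5] at h3
    rw [← h3]
    refine tsum_congr fun ζ => ?_
    congr 2
    rw [inner_smul_right, inner_smul_left, RCLike.conj_to_real, inner_intVec, intVec_inner,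
      zdot_smul, zdot_smul, WithLp.ofLp_neg, zdot_neg]
    ring
  rw [weylFun_eq_tsum (hp.summable_symbolCoeff hd h₁ h₂ h₁' h₂')
    (fun ζ => (√α₁ / 2) • intVec ζ.1) (fun ζ => √α₂ • intVec ζ.2) ht
    (two_pi_mul_hTilde α₁ α₂).symm hsym, h]
  refine tsum_congr fun ζ => ?_
  have h6 : (N * √(α₁ * α₂))⁻¹ • (√α₂ • intVec ζ.2 : Rd d) = (N * √α₁)⁻¹ • intVec ζ.2 := by
    rw [smul_smul, Real.sqrt_mul h₁.le]
    congr 1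
    field_simp
  rw [h6, mul_assoc, ← mul_assoc (cis _) (cis _), ← cis_add]
  congr 3
  rw [inner_smul_right, inner_smul_right, inner_smul_left, inner_smul_left, inner_intVec,
    intVec_inner, inner_intVec, RCLike.conj_to_real, RCLike.conj_to_real, Real.sqrt_mul h₁.le]
  have h7 : zdot ζ.1 (fun i => (ζ.2 i : ℝ) / 2 / N) =
      (2 * N : ℝ)⁻¹ * zdot ζ.1 (intVec ζ.2 : Rd d).ofLp := by
    rw [← zdot_smul]
    congr 1
    ext i
    simp [intVec]
    ring
  rw [h7]
  field_simp
  ring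

lemma _root_.IsTorusSymbol.isQuantizationMatrix {N : ℕ} [NeZero N] (hd : 1 ≤ d) (h₁ : 0 < α₁)
    (h₂ : 0 < α₂) (h₁' : α₁ ≤ 1) (h₂' : α₂ ≤ 1) (hp : IsTorusSymbol C α₁ α₂ p) :
    IsQuantizationMatrix N α₁ α₂ p (weylMatrix N (symbolCoeff α₁ α₂ p)) := by
  intro u _ f hu φ
  obtain ⟨ψ, hψ⟩ := hp.exists_weylTransform (N := N) hd h₁ h₂ h₁' h₂' φ
  refine ⟨ψ, hp.weylFun_eq hd h₁ h₂ h₁' h₂' hψ, ?_⟩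
  rw [hu, sum_smul_basisQ_apply h₁, sum_smul_basisQ_apply h₁,
    hψ.sum_mul_latticeSum (Real.sqrt_pos.mpr h₁) (hp.summable_symbolCoeff hd h₁ h₂ h₁' h₂')]

lemma exists_schwartz_bump (x₀ : Rd d) {r : ℝ} (hr : 0 < r) :
    ∃ φ : 𝓢(Rd d, ℂ), φ x₀ = 1 ∧ ∀ x, r ≤ dist x x₀ → φ x = 0 := by
  let b : ContDiffBump x₀ := ⟨r / 2, r, by positivity, by linarith⟩
  have h1 : ContDiff ℝ ∞ fun x => ((b x : ℝ) : ℂ) := Complex.ofRealCLM.contDiff.comp b.contDiff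
  have h2 : HasCompactSupport fun x => ((b x : ℝ) : ℂ) :=
    b.hasCompactSupport.comp_left (g := fun t : ℝ => (t : ℂ)) Complex.ofReal_zero
  refine ⟨h2.toSchwartzMap h1, ?_, fun x hx => ?_⟩
  · change ((b x₀ : ℝ) : ℂ) = 1
    rw [b.one_of_mem_closedBall (Metric.mem_closedBall_self b.rIn_pos.le), Complex.ofReal_one]
  · change ((b x : ℝ) : ℂ) = 0
    rw [b.zero_of_le_dist hx, Complex.ofReal_zero]

lemma le_dist_latticePoint {a : ℝ} (ha : 0 < a) {N : ℕ} [NeZero N] {k l : Fin d → Fin N}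
    {j : Fin d → ℤ} (h : k ≠ l ∨ j ≠ 0) :
    a / N ≤ dist (latticePoint a N (liftN k) j) (latticePoint a N (liftN l) 0) := by
  have hN : (0 : ℝ) < N := by exact_mod_cast Nat.pos_of_ne_zero (NeZero.ne N)
  obtain ⟨i, hi⟩ : ∃ i, N * j i + (k i : ℕ) - (l i : ℕ) ≠ 0 := by
    by_contra! hall
    have hj : ∀ i, j i = 0 := by
      intro i
      have h1 := hall i
      have h2 := (k i).2
      have h3 := (l i).2
      have h4 : |(N : ℤ) * j i| < N := by
        rw [abs_lt]
        omega
      rcases mul_eq_zero.mp (Int.eq_zero_of_abs_lt_dvd (dvd_mul_right _ _) h4) with h5 | h5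
      · exact absurd (by exact_mod_cast h5) (NeZero.ne N)
      · exact h5
    rcases h with h | h
    · refine h (funext fun i => Fin.ext ?_)
      have h1 := hall i
      rw [hj i] at h1
      omega
    · exact h (funext hj)
  have h5 : ‖(latticePoint a N (liftN k) j - latticePoint a N (liftN l) 0) i‖ ≤
      dist (latticePoint a N (liftN k) j) (latticePoint a N (liftN l) 0) := by
    rw [dist_eq_norm]
    exact PiLp.norm_apply_le _ i
  refine le_trans ?_ h5
  have h6 : (latticePoint a N (liftN k) j - latticePoint a N (liftN l) 0) i =
      a / N * ((N * j i + (k i : ℕ) - (l i : ℕ) : ℤ) : ℝ) := by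
    simp [latticePoint, intVec, liftN]
    field_simp
  rw [h6, norm_mul, Real.norm_of_nonneg (by positivity)]
  refine le_mul_of_one_le_right (by positivity) ?_
  rw [Real.norm_eq_abs, ← Int.cast_abs]
  exact_mod_cast Int.one_le_abs hi

/-- The coordinates of a combination of the `Q_k` are detected by test functions supported close
to one point of a lattice. -/
lemma exists_schwartz_latticeSum {a : ℝ} (ha : 0 < a) {N : ℕ} [NeZero N] (l : Fin d → Fin N) :
    ∃ φ : 𝓢(Rd d, ℂ), ∀ f : (Fin d → Fin N) → ℂ, ∑ k, f k * latticeSum a N φ (liftN k) = f l := by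
  have hN : (0 : ℝ) < N := by exact_mod_cast Nat.pos_of_ne_zero (NeZero.ne N)
  obtain ⟨φ, h1, h0⟩ := exists_schwartz_bump (latticePoint a N (liftN l) 0) (div_pos ha hN)
  refine ⟨φ, fun f => ?_⟩
  rw [Finset.sum_eq_single l]
  · unfold latticeSum
    rw [tsum_eq_single 0 fun j hj => h0 _ (le_dist_latticePoint ha (Or.inr hj)), h1, mul_one]
  · intro k _ hk
    have : latticeSum a N φ (liftN k) = 0 := by
      unfold latticeSum
      rw [← tsum_zero (β := Fin d → ℤ)]
      exact tsum_congr fun j => h0 _ (le_dist_latticePoint ha (Or.inl hk))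
    rw [this, mul_zero]
  · simp

/-- The matrix is determined by the operator: the image of a distribution is determined by its
pairings, and the coordinates in the `Q_k` can be read off from pairings. -/
lemma IsQuantizationMatrix.unique {N : ℕ} [NeZero N] (h₁ : 0 < α₁) (h₂ : 0 < α₂)
    {A B : Matrix (Fin d → Fin N) (Fin d → Fin N) ℂ} (hA : IsQuantizationMatrix N α₁ α₂ p A)
    (hB : IsQuantizationMatrix N α₁ α₂ p B) : B = A := by
  have hN : 0 < N := Nat.pos_of_ne_zero (NeZero.ne N)
  have hN' : (0 : ℝ) < N := by exact_mod_cast hN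
  have hs₁ := Real.sqrt_pos.mpr h₁
  have h : ∀ f, B.mulVec f = A.mulVec f := by
    intro f
    funext l
    have hu : ∑ k, f k • basisQ N α₁ k ∈ torusSpace d (hTilde N α₁ α₂) α₁ α₂ :=
      Submodule.sum_mem _ fun k _ =>
        Submodule.smul_mem _ _ (basisQ_mem_torusSpace N hN α₁ α₂ h₁ h₂ k)
    obtain ⟨φ, hφ⟩ := exists_schwartz_latticeSum (inv_pos.mpr hs₁) l
    obtain ⟨ψ, hψ, e1⟩ := hA _ hu f rfl φ
    obtain ⟨ψ', hψ', e2⟩ := hB _ hu f rfl φ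
    have hψψ : ψ' = ψ := SchwartzMap.ext fun x => (hψ' x).trans (hψ x).symm
    rw [hψψ, ← e1, sum_smul_basisQ_apply h₁, sum_smul_basisQ_apply h₁, hφ, hφ] at e2
    have hne : (((√α₁ * N) ^ (-(d : ℝ) / 2) : ℝ) : ℂ) ≠ 0 := by
      exact_mod_cast (Real.rpow_pos_of_pos (by positivity) _).ne'
    exact mul_left_cancel₀ hne e2
  ext k l
  have := congrFun (h (Pi.single l 1)) k
  simpa using this

end QuantizationMatrix

/-! ### Bounds of the quantization matrix -/

section Bounds

variable {d : ℕ} {C : ℕ → ℝ} {α₁ α₂ : ℝ} {p : Rd d × Rd d → ℂ}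

lemma _root_.IsTorusSymbol.norm_sub_le (hp : IsTorusSymbol C α₁ α₂ p) (ρ ρ' : Rd d × Rd d) :
    ‖p ρ' - p ρ‖ ≤ C 1 * ‖ρ' - ρ‖ :=
  Convex.norm_image_sub_le_of_norm_fderiv_le (𝕜 := ℝ)
    (fun x _ => (hp.smooth.differentiable (by simp)) x)
    (fun x _ => by rw [← norm_iteratedFDeriv_one]; exact hp.bound 1 x) convex_univ
    (Set.mem_univ ρ) (Set.mem_univ ρ')

lemma _root_.IsTorusSymbol.bddAbove (hp : IsTorusSymbol C α₁ α₂ p) :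
    BddAbove (Set.range fun ρ => ‖p ρ‖) :=
  ⟨C 0, by rintro _ ⟨ρ, rfl⟩; exact hp.norm_le ρ⟩

lemma _root_.IsTorusSymbol.norm_trigSum_sub_le (hd : 1 ≤ d) (h₁ : 0 < α₁) (h₂ : 0 < α₂)
    (h₁' : α₁ ≤ 1) (h₂' : α₂ ≤ 1) (hp : IsTorusSymbol C α₁ α₂ p) (a b a' b' : Fin d → ℝ) :
    ‖trigSum (symbolCoeff α₁ α₂ p) (a + a') (b + b') - trigSum (symbolCoeff α₁ α₂ p) a b‖ ≤
      C 1 * d / √α₁ * ‖a'‖ + C 1 * d / √α₂ * ‖b'‖ := by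
  have hC := hp.const_nonneg 1
  rw [hp.trigSum_symbolCoeff hd h₁ h₂ h₁' h₂', hp.trigSum_symbolCoeff hd h₁ h₂ h₁' h₂']
  refine (hp.norm_sub_le _ _).trans ?_
  rw [Prod.mk_sub_mk, ← smul_sub, ← smul_sub, ← WithLp.toLp_sub, ← WithLp.toLp_sub,
    add_sub_cancel_left, add_sub_cancel_left]
  have e1 : ‖((√α₁)⁻¹ • WithLp.toLp 2 a' : Rd d)‖ ≤ (√α₁)⁻¹ * (d * ‖a'‖) := by
    rw [norm_smul, Real.norm_of_nonneg (by positivity)]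
    gcongr
    exact norm_toLp_le a'
  have e2 : ‖((√α₂)⁻¹ • WithLp.toLp 2 b' : Rd d)‖ ≤ (√α₂)⁻¹ * (d * ‖b'‖) := by
    rw [norm_smul, Real.norm_of_nonneg (by positivity)]
    gcongr
    exact norm_toLp_le b'
  calc _ ≤ C 1 * ((√α₁)⁻¹ * (d * ‖a'‖) + (√α₂)⁻¹ * (d * ‖b'‖)) := by
        refine mul_le_mul_of_nonneg_left ?_ hC
        rw [Prod.norm_mk]
        refine max_le (e1.trans ?_) (e2.trans ?_)
        · exact le_add_of_nonneg_right (by positivity)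
        · exact le_add_of_nonneg_left (by positivity)
    _ = _ := by ring

/-- The bound of the quantization matrix in terms of the small parameter `δ = (N √(α₁ α₂))^(-1/2)`.
It comes from the anti-Wick regularization at the scale `κ = δ² α₂`, for which the two moments
of the regularizing measure are proportional to `δ` in the original variables. -/
lemma _root_.IsTorusSymbol.l2OpNorm_le {N : ℕ} [NeZero N] (hd : 1 ≤ d) (h₁ : 0 < α₁)
    (h₂ : 0 < α₂) (h₁' : α₁ ≤ 1) (h₂' : α₂ ≤ 1) (hp : IsTorusSymbol C α₁ α₂ p) (M : ℕ) {δ : ℝ}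
    (hδ : 0 < δ) (hδN : N * √(α₁ * α₂) * δ ^ 2 = 1) :
    l2OpNorm (weylMatrix N (symbolCoeff α₁ α₂ p)) ≤ (⨆ ρ, ‖p ρ‖) +
      2 ^ M * (C 1 * (d * (4 ^ d + d))) * δ +
      (2 * Real.pi * (d * (4 ^ d + d))) ^ (M + 1) * symbolConst d C (M + 1) *
        (δ ^ (M + 1) * (√(α₁ * α₂) ^ (d + 1))⁻¹) := by
  have hN : (0 : ℝ) < N := by exact_mod_cast Nat.pos_of_ne_zero (NeZero.ne N)
  have hs₁ := Real.sqrt_pos.mpr h₁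
  have hs₂ := Real.sqrt_pos.mpr h₂
  have hC := hp.const_nonneg 1
  have hc := hp.summable_symbolCoeff hd h₁ h₂ h₁' h₂'
  have hS : ∀ a b, ‖trigSum (symbolCoeff α₁ α₂ p) a b‖ ≤ ⨆ ρ, ‖p ρ‖ := by
    intro a b
    rw [hp.trigSum_symbolCoeff hd h₁ h₂ h₁' h₂']
    exact le_ciSup hp.bddAbove _
  have hκ : √((√α₂ * δ) ^ 2) = √α₂ * δ := Real.sqrt_sq (by positivity)
  have hκ' : (N * (√α₂ * δ))⁻¹ = √α₁ * δ := by
    rw [Real.sqrt_mul h₁.le] at hδN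
    refine inv_eq_of_mul_eq_one_right ?_
    linear_combination hδN
  have hsum := hp.summable_weighted hd h₁ h₂ h₁' h₂' (M + 1)
  have hterm : ∀ ζ : (Fin d → ℤ) × (Fin d → ℤ),
      (2 * Real.pi * d * (‖ζ.1‖ * (4 ^ d * (√α₁ * δ)) + ‖ζ.2‖ * (d * (√α₂ * δ)))) ^ (M + 1) *
        ‖symbolCoeff α₁ α₂ p ζ‖ ≤ (2 * Real.pi * (d * (4 ^ d + d)) * δ) ^ (M + 1) *
          (freqWeight α₁ α₂ ζ ^ (M + 1) * ‖symbolCoeff α₁ α₂ p ζ‖) := by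
    intro ζ
    rw [← mul_assoc (_ ^ (M + 1)) (_ ^ (M + 1)), ← mul_pow]
    have hu : 0 ≤ √α₁ * ‖ζ.1‖ := by positivity
    have hv : 0 ≤ √α₂ * ‖ζ.2‖ := by positivity
    have e1 : 4 ^ d * (√α₁ * ‖ζ.1‖) + d * (√α₂ * ‖ζ.2‖) ≤ (4 ^ d + d) * freqWeight α₁ α₂ ζ := by
      rw [add_mul]
      unfold freqWeight
      gcongr <;> linarith
    gcongr ?_ ^ _ * _
    calc _ = 2 * Real.pi * d * δ * (4 ^ d * (√α₁ * ‖ζ.1‖) + d * (√α₂ * ‖ζ.2‖)) := by ring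
      _ ≤ 2 * Real.pi * d * δ * ((4 ^ d + d) * freqWeight α₁ α₂ ζ) := by gcongr
      _ = _ := by ring
  have hmaj := hsum.1.mul_left ((2 * Real.pi * (d * (4 ^ d + d)) * δ) ^ (M + 1))
  have hR := Summable.of_nonneg_of_le (fun ζ => by positivity) hterm hmaj
  have hform := formBound_of_lipschitz (N := N) (κ := (√α₂ * δ) ^ 2) (by positivity) hc
    (L₁ := C 1 * d / √α₁) (L₂ := C 1 * d / √α₂) (by positivity) (by positivity) hS
    (hp.norm_trigSum_sub_le hd h₁ h₂ h₁' h₂') M (R := ∑' ζ : (Fin d → ℤ) × (Fin d → ℤ),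
      (2 * Real.pi * d * (‖ζ.1‖ * (4 ^ d * (√α₁ * δ)) + ‖ζ.2‖ * (d * (√α₂ * δ)))) ^ (M + 1) *
        ‖symbolCoeff α₁ α₂ p ζ‖) (by rw [hκ, hκ']; exact hR.hasSum)
  rw [hκ, hκ'] at hform
  have hS0 : 0 ≤ ⨆ ρ, ‖p ρ‖ := Real.iSup_nonneg fun ρ => norm_nonneg _
  have hR0 : 0 ≤ ∑' ζ : (Fin d → ℤ) × (Fin d → ℤ),
      (2 * Real.pi * d * (‖ζ.1‖ * (4 ^ d * (√α₁ * δ)) + ‖ζ.2‖ * (d * (√α₂ * δ)))) ^ (M + 1) *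
        ‖symbolCoeff α₁ α₂ p ζ‖ := tsum_nonneg fun ζ => by positivity
  refine (hform.l2OpNorm_le hc (by positivity)).trans ?_
  refine add_le_add (add_le_add le_rfl (le_of_eq ?_)) ?_
  · field_simp
  · refine (hR.tsum_le_tsum hterm hmaj).trans ?_
    rw [tsum_mul_left]
    refine (mul_le_mul_of_nonneg_left hsum.2 (by positivity)).trans (le_of_eq ?_)
    rw [mul_pow _ δ]
    ring

/-- The norm of the quantization matrix exceeds the supremum of the symbol by at most a negative
power of `N`, uniformly with respect to the symbol and the parameters. -/
theorem exists_l2OpNorm_le (hd : 1 ≤ d) {w : ℝ} (hw₀ : 0 < w) (hw₁ : w < 1) (C : ℕ → ℝ) :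
    ∃ K τ : ℝ, 0 < τ ∧ ∀ (N : ℕ) [NeZero N] (α₁ α₂ : ℝ), 0 < α₁ → α₁ ≤ α₂ → α₂ ≤ 1 →
      (N : ℝ) ^ (-w) ≤ √(α₁ * α₂) → ∀ p : Rd d × Rd d → ℂ, IsTorusSymbol C α₁ α₂ p →
        l2OpNorm (weylMatrix N (symbolCoeff α₁ α₂ p)) ≤ (⨆ ρ, ‖p ρ‖) + K * (N : ℝ) ^ (-τ) := by
  obtain ⟨M, hM⟩ := exists_nat_ge (w * (d + 1) / ((1 - w) / 2))
  have hw : 0 < (1 - w) / 2 := by linarith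
  rw [div_le_iff₀ hw] at hM
  refine ⟨2 ^ M * (C 1 * (d * (4 ^ d + d))) +
    (2 * Real.pi * (d * (4 ^ d + d))) ^ (M + 1) * symbolConst d C (M + 1), (1 - w) / 2, hw, ?_⟩
  intro N _ α₁ α₂ h₁ h₁₂ h₂' hN p hp
  have h₂ : 0 < α₂ := h₁.trans_le h₁₂
  have h₁' : α₁ ≤ 1 := h₁₂.trans h₂'
  have hN1 : (1 : ℝ) ≤ N := by exact_mod_cast Nat.pos_of_ne_zero (NeZero.ne N)
  have hN0 : (0 : ℝ) < N := by linarith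
  set s := √(α₁ * α₂)
  have hs : 0 < s := Real.sqrt_pos.mpr (mul_pos h₁ h₂)
  have hNs : 0 < N * s := by positivity
  have hδN : N * s * ((√(N * s))⁻¹) ^ 2 = 1 := by
    rw [inv_pow, Real.sq_sqrt hNs.le, mul_inv_cancel₀ hNs.ne']
  have hδ : (√(N * s))⁻¹ ≤ (N : ℝ) ^ (-((1 - w) / 2)) := by
    rw [Real.rpow_neg hN0.le]
    gcongr
    refine Real.le_sqrt_of_sq_le ?_
    rw [← Real.rpow_natCast, ← Real.rpow_mul hN0.le]
    calc (N : ℝ) ^ ((1 - w) / 2 * (2 : ℕ)) = N * (N : ℝ) ^ (-w) := by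
          rw [← Real.rpow_one_add' hN0.le (by linarith)]
          congr 1
          push_cast
          ring
      _ ≤ N * s := by gcongr
  have hs' : (s ^ (d + 1))⁻¹ ≤ (N : ℝ) ^ (w * (d + 1)) := by
    rw [← inv_pow]
    have : s⁻¹ ≤ (N : ℝ) ^ w := by
      rw [inv_le_comm₀ hs (by positivity), ← Real.rpow_neg hN0.le]
      exact hN
    calc (s⁻¹) ^ (d + 1) ≤ ((N : ℝ) ^ w) ^ (d + 1) := by gcongr
      _ = _ := by
        rw [← Real.rpow_natCast, ← Real.rpow_mul hN0.le]
        push_cast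
        rfl
  -- The order `M` of the iteration is large enough to absorb the powers of `1/s` lost in the
  -- summation of the Fourier coefficients.
  have htail : ((√(N * s))⁻¹) ^ (M + 1) * (s ^ (d + 1))⁻¹ ≤ (N : ℝ) ^ (-((1 - w) / 2)) := by
    calc ((√(N * s))⁻¹) ^ (M + 1) * (s ^ (d + 1))⁻¹
        ≤ ((N : ℝ) ^ (-((1 - w) / 2))) ^ (M + 1) * (N : ℝ) ^ (w * (d + 1)) := by gcongr
      _ = (N : ℝ) ^ (-((1 - w) / 2) * (M + 1 : ℕ) + w * (d + 1)) := by
        rw [← Real.rpow_natCast, ← Real.rpow_mul hN0.le, ← Real.rpow_add hN0]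
      _ ≤ (N : ℝ) ^ (-((1 - w) / 2)) := by
        refine Real.rpow_le_rpow_of_exponent_le hN1 ?_
        push_cast
        linarith
  have hC := hp.const_nonneg 1
  have hsc : 0 ≤ symbolConst d C (M + 1) := by
    have e1 := hp.const_nonneg 0
    have e2 := hp.const_nonneg (M + 1 + 2 * (d + 1))
    have e3 : 0 ≤ ∑' ζ : (Fin d → ℤ) × (Fin d → ℤ),
      ((1 + ‖ζ.1‖) ^ (d + 1))⁻¹ * ((1 + ‖ζ.2‖) ^ (d + 1))⁻¹ := tsum_nonneg fun ζ => by positivity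
    unfold symbolConst
    positivity
  refine (hp.l2OpNorm_le hd h₁ h₂ h₁' h₂' M (by positivity) hδN).trans ?_
  rw [add_mul, ← add_assoc]
  gcongr

lemma _root_.IsTorusSymbol.isQuantizationMatrix_iff {N : ℕ} [NeZero N] (hd : 1 ≤ d) (h₁ : 0 < α₁)
    (h₂ : 0 < α₂) (h₁' : α₁ ≤ 1) (h₂' : α₂ ≤ 1) (hp : IsTorusSymbol C α₁ α₂ p)
    (B : Matrix (Fin d → Fin N) (Fin d → Fin N) ℂ) :
    IsQuantizationMatrix N α₁ α₂ p B ↔ B = weylMatrix N (symbolCoeff α₁ α₂ p) := by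
  have hA := hp.isQuantizationMatrix (N := N) hd h₁ h₂ h₁' h₂'
  exact ⟨fun hB => IsQuantizationMatrix.unique h₁ h₂ hA hB, fun h => h ▸ hA⟩

end Bounds

end TorusQuant

theorem mainTheorem6 (d : ℕ) (hd : 1 ≤ d) (w : ℝ) (hw₀ : 0 < w) (hw₁ : w < 1) (C : ℕ → ℝ) :
    (∀ ε : ℝ, 0 < ε → ∃ N₀ : ℕ, ∀ N : ℕ, N₀ ≤ N → ∀ α₁ α₂ : ℝ,
      0 < α₁ → α₁ ≤ α₂ → α₂ ≤ 1 → (N : ℝ) ^ (-w) ≤ √(α₁ * α₂) →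
      ∀ p : Rd d × Rd d → ℂ, IsTorusSymbol C α₁ α₂ p →
        ∃ A : Matrix (Fin d → Fin N) (Fin d → Fin N) ℂ,
          (∀ B, IsQuantizationMatrix N α₁ α₂ p B ↔ B = A) ∧
          l2OpNorm A ≤ (⨆ ρ : Rd d × Rd d, ‖p ρ‖) + ε) ∧
    (∃ K : ℝ, 0 < K ∧ ∀ N : ℕ, 1 ≤ N → ∀ α₁ α₂ : ℝ,
      0 < α₁ → α₁ ≤ α₂ → α₂ ≤ 1 → (N : ℝ) ^ (-w) ≤ √(α₁ * α₂) →
      ∀ p : Rd d × Rd d → ℂ, IsTorusSymbol C α₁ α₂ p →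
        ∃ A : Matrix (Fin d → Fin N) (Fin d → Fin N) ℂ,
          (∀ B, IsQuantizationMatrix N α₁ α₂ p B ↔ B = A) ∧ l2OpNorm A ≤ K) := by
  obtain ⟨K, τ, hτ, hK⟩ := TorusQuant.exists_l2OpNorm_le hd hw₀ hw₁ C
  constructor
  · intro ε hε
    have hlim : Filter.Tendsto (fun N : ℕ => K * (N : ℝ) ^ (-τ)) Filter.atTop (nhds (K * 0)) :=
      ((tendsto_rpow_neg_atTop hτ).comp tendsto_natCast_atTop_atTop).const_mul K
    rw [mul_zero] at hlim
    obtain ⟨N₀, hN₀⟩ := Filter.eventually_atTop.mp (hlim.eventually (gt_mem_nhds hε))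
    refine ⟨max N₀ 1, fun N hN α₁ α₂ h₁ h₁₂ h₂' hs p hp => ?_⟩
    have : NeZero N := ⟨by omega⟩
    refine ⟨_, hp.isQuantizationMatrix_iff hd h₁ (h₁.trans_le h₁₂) (h₁₂.trans h₂') h₂',
      (hK N α₁ α₂ h₁ h₁₂ h₂' hs p hp).trans ?_⟩
    have h := hN₀ N ((le_max_left _ _).trans hN)
    linarith
  · refine ⟨|C 0| + |K| + 1, by positivity, fun N hN α₁ α₂ h₁ h₁₂ h₂' hs p hp => ?_⟩
    have : NeZero N := ⟨by omega⟩
    refine ⟨_, hp.isQuantizationMatrix_iff hd h₁ (h₁.trans_le h₁₂) (h₁₂.trans h₂') h₂',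
      (hK N α₁ α₂ h₁ h₁₂ h₂' hs p hp).trans ?_⟩
    have h3 : (⨆ ρ, ‖p ρ‖) ≤ |C 0| := ciSup_le fun ρ => (hp.norm_le ρ).trans (le_abs_self _)
    have hN1 : (1 : ℝ) ≤ N := by exact_mod_cast hN
    have h4 : (N : ℝ) ^ (-τ) ≤ 1 := Real.rpow_le_one_of_one_le_of_nonpos hN1 (by linarith)
    have h5 : (0 : ℝ) ≤ (N : ℝ) ^ (-τ) := by positivity
    have h6 : K * (N : ℝ) ^ (-τ) ≤ |K| * 1 :=
      mul_le_mul (le_abs_self K) h4 h5 (abs_nonneg K)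
    linarith
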